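/- **Theorem.** Let $\mathcal N$ be a finite acyclic directed multigraph with edge set $\epsilon$, $|\epsilon|\ge 2$, positive integer edge capacities $c(e)$, and messages $m_1,\dots,m_{|\mu|}$. Each message $m_i$ has one source node and a nonempty set of receiver nodes; the source is not one of them, and each of them can be reached from the source by a directed path. Let $\mathcal T_i$ be the set of directed Steiner trees of $m_i$: the edge sets of out-arborescences that are rooted at the source of $m_i$ and contain all receivers of $m_i$. For a nonzero vector $\hat q=(q_1,\dots,q_{|\mu|})$ with nonnegative real entries, consider the linear program $$\begin{array}{lll} \max & \lambda & \\ \text{s.t.} & \displaystyle\sum_{i}\ \sum_{T\in\mathcal T_i,\ e\in T} x_i(T)\ \le\ c(e) & \forall e\in\epsilon,\\ & \displaystyle\sum_{T\in\mathcal T_i} x_i(T)\ \ge\ \lambda q_i & \forall i,\\ & x,\lambda\ \ge\ 0, & \end{array}$$ with one variable $x_i(T)$ for each message $m_i$ and each $T\in\mathcal T_i$, and with optimal value $\lambda_{\max}$. Let $A\ge 1$ and $\omega>0$ be real, and let $\mathcal O_{DSteiner}$ be an oracle that, for all positive edge lengths on the graph of $\mathcal N$, all source nodes $s$ and all sets of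 nodes reachable from $s$, returns in time at most $T_{DSteiner}$ a set of edges that contains a directed path from $s$ to each node of the given set and whose total length is at most $A$ times the minimum. Assume $T_{DSteiner}\ge|\epsilon|$ (the oracle has to read the edge lengths). Then there is a $(1+\omega)A$-approximation algorithm for the linear program: one fixed program, for a random access machine that performs exact real arithmetic (addition, subtraction, multiplication, division, comparison) at unit cost and can call the oracle, which on input $\mathcal N,\hat q,\omega,A$ halts with a feasible point $(x,\lambda)$ of the linear program (with $x$ written as a list of weighted trees) such that $\lambda_{\max}\le(1+\omega)A\,\lambda$, and which runs in time $$O\bigl(\max(1,\omega^{-2})\,(|\mu|\log(A|\mu|)+|\epsilon|)\,A\,\log|\epsilon|\cdot T_{DSteiner}\bigr),$$ where each oracle call is charged its running time, and where the constant in $O(\cdot)$ is absolute. In particular, the running time is $O(\omega^{-2}(|\mu|\log(A|\mu|)+|\epsilon|)A\log|\epsilon|\cdot T_{DSteiner})$ for $0<\omega\le 1$. -/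

import Mathlib

open scoped BigOperators

namespace Routing

/-! ### Directed multigraphs, the minimum-cost directed Steiner tree problem -/

/-- A finite directed multigraph with numbered nodes and numbered edges (parallel edges allowed). -/
structure MultiDigraph where
  numNodes : ℕ
  numEdges : ℕ
  tail : Fin numEdges → Fin numNodes
  head : Fin numEdges → Fin numNodes

namespace MultiDigraph

variable (G : MultiDigraph)

/-- `u → v` along some edge of the edge set `F`. -/
def Step (F : Finset (Fin G.numEdges)) (u v : Fin G.numNodes) : Prop :=
  ∃ e ∈ F, G.tail e = u ∧ G.head e = v

/-- There is a directed path (possibly of length `0`) from `u` to `v` that uses edges of `F` only. -/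
def Reach (F : Finset (Fin G.numEdges)) (u v : Fin G.numNodes) : Prop :=
  Relation.ReflTransGen (G.Step F) u v

/-- No directed cycle. -/
def Acyclic : Prop :=
  ∀ v, ¬ Relation.TransGen (G.Step Finset.univ) v v

/-- The edge set `F` contains a directed path from `s` to every node of `R`. -/
def Connects (F : Finset (Fin G.numEdges)) (s : Fin G.numNodes)
    (R : Finset (Fin G.numNodes)) : Prop :=
  ∀ v ∈ R, G.Reach F s v

/-- The edge set `F` is a directed Steiner tree with root `s` and terminals `R`: an out-arborescence
rooted at `s` (every edge starts at a node reached from `s` inside `F`, no edge enters `s`, no two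
edges enter the same node) that contains all nodes of `R`. -/
def IsSteinerTree (s : Fin G.numNodes) (R : Finset (Fin G.numNodes))
    (F : Finset (Fin G.numEdges)) : Prop :=
  (∀ e ∈ F, G.Reach F s (G.tail e)) ∧
  (∀ e ∈ F, G.head e ≠ s) ∧
  (∀ e ∈ F, ∀ e' ∈ F, G.head e = G.head e' → e = e') ∧
  G.Connects F s R

end MultiDigraph

/-- The data of a minimum-cost directed Steiner tree problem on the graph `G`. -/
structure SteinerInstance (G : MultiDigraph) where
  len : Fin G.numEdges → ℝ
  source : Fin G.numNodes
  terminals : Finset (Fin G.numNodes)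

namespace SteinerInstance

variable {G : MultiDigraph} (I : SteinerInstance G)

/-- The graph is acyclic, the lengths are positive, and the problem has a solution. -/
def Valid : Prop :=
  G.Acyclic ∧ (∀ e, 0 < I.len e) ∧ G.Connects Finset.univ I.source I.terminals

/-- The cost of an edge set. -/
def cost (F : Finset (Fin G.numEdges)) : ℝ := ∑ e ∈ F, I.len e

end SteinerInstance

/-- A black box for the minimum-cost directed Steiner tree problem: to each instance it
returns an edge set, and it takes a certain number of steps to do so. -/
structure SteinerOracle where
  answer : (G : MultiDigraph) → SteinerInstance G → Finset (Fin G.numEdges)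
  time : (G : MultiDigraph) → SteinerInstance G → ℕ

/-- On all valid instances on the graph `G` the oracle returns a feasible edge set whose cost is at
most `A` times the cost of every feasible edge set. -/
def SteinerOracle.HasGuarantee (O : SteinerOracle) (G : MultiDigraph) (A : ℝ) : Prop :=
  ∀ I : SteinerInstance G, I.Valid →
    G.Connects (O.answer G I) I.source I.terminals ∧
    ∀ F, G.Connects F I.source I.terminals → I.cost (O.answer G I) ≤ A * I.cost F

/-! ### Networks and the linear program -/

/-- A non-degenerate acyclic multiple multicast network: every message has one source node and a
nonempty set of receiver nodes that does not contain the source; each receiver can be reached from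
the source; the edge capacities are positive integers. -/
structure Network where
  graph : MultiDigraph
  acyclic : graph.Acyclic
  cap : Fin graph.numEdges → ℕ
  cap_pos : ∀ e, 0 < cap e
  numMessages : ℕ
  source : Fin numMessages → Fin graph.numNodes
  receivers : Fin numMessages → Finset (Fin graph.numNodes)
  receivers_nonempty : ∀ i, (receivers i).Nonempty
  source_notMem : ∀ i, source i ∉ receivers i
  reachable : ∀ i, graph.Connects Finset.univ (source i) (receivers i)

namespace Network

variable (N : Network)

open Classical in
/-- The Steiner trees of message `i`. -/
noncomputable def trees (i : Fin N.numMessages) : Finset (Finset (Fin N.graph.numEdges)) :=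
  Finset.univ.filter (fun F => N.graph.IsSteinerTree (N.source i) (N.receivers i) F)

/-- `(x, lam)` is a feasible point of the linear program for the ray spanned by `q`. The variable
`x i F` is the amount of message `i` that is routed along the Steiner tree `F` of message `i`. -/
structure Feasible (q : Fin N.numMessages → ℝ)
    (x : Fin N.numMessages → Finset (Fin N.graph.numEdges) → ℝ) (lam : ℝ) : Prop where
  supported : ∀ i, ∀ F, F ∉ N.trees i → x i F = 0
  nonneg : ∀ i F, 0 ≤ x i F
  lam_nonneg : 0 ≤ lam
  capacity : ∀ e, (∑ i, ∑ F ∈ N.trees i, (if e ∈ F then 1 else 0) * x i F) ≤ (N.cap e : ℝ)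
  demand : ∀ i, lam * q i ≤ ∑ F ∈ N.trees i, x i F

/-- `(x, lam)` is feasible, and its value `lam` is within the factor `ρ` of the optimal value. -/
def IsApproxSolution (q : Fin N.numMessages → ℝ) (ρ : ℝ)
    (x : Fin N.numMessages → Finset (Fin N.graph.numEdges) → ℝ) (lam : ℝ) : Prop :=
  N.Feasible q x lam ∧ ∀ x' lam', N.Feasible q x' lam' → lam' ≤ ρ * lam

end Network

/-! ### The machine model: structured programs for a real RAM with an oracle

The memory consists of arrays of natural numbers (for indices) and arrays of real numbers.
Arithmetic is exact and has unit cost: addition, truncated subtraction and comparison for natural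
numbers, the field operations and comparison for real numbers. There is no rounding of real numbers,
and the only literals are natural numbers. -/

/-- The memory: `nat a j` and `real a j` are the contents of cell `j` of the array number `a`. -/
structure State where
  nat : ℕ → ℕ → ℕ
  real : ℕ → ℕ → ℝ

/-- Natural-number expressions. -/
inductive NExp where
  | lit (n : ℕ)
  | get (a : ℕ) (j : NExp)
  | add (x y : NExp)
  | sub (x y : NExp)

def NExp.eval (s : State) : NExp → ℕ
  | .lit n => n
  | .get a j => s.nat a (j.eval s)
  | .add x y => x.eval s + y.eval s
  | .sub x y => x.eval s - y.eval s

/-- Real-number expressions. -/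
inductive RExp where
  | ofNat (n : NExp)
  | get (a : ℕ) (j : NExp)
  | add (x y : RExp)
  | sub (x y : RExp)
  | mul (x y : RExp)
  | div (x y : RExp)

noncomputable def RExp.eval (s : State) : RExp → ℝ
  | .ofNat n => (n.eval s : ℝ)
  | .get a j => s.real a (j.eval s)
  | .add x y => x.eval s + y.eval s
  | .sub x y => x.eval s - y.eval s
  | .mul x y => x.eval s * y.eval s
  | .div x y => x.eval s / y.eval s

/-- Tests. -/
inductive Test where
  | natLt (x y : NExp)
  | realLt (x y : RExp)
  | neg (b : Test)
  | conj (b c : Test)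

def Test.Holds (s : State) : Test → Prop
  | .natLt x y => x.eval s < y.eval s
  | .realLt x y => x.eval s < y.eval s
  | .neg b => ¬ b.Holds s
  | .conj b c => b.Holds s ∧ c.Holds s

/-- The arguments of an oracle call: numbers of nodes and edges, the names of the arrays that
hold the tails, heads and lengths of the edges, the source node, the name of an array whose cells
`lo, …, hi - 1` hold the terminals, and the name of the array for the answer. -/
structure Query where
  numNodes : NExp
  numEdges : NExp
  tail : ℕ
  head : ℕ
  len : ℕ
  source : NExp
  terminals : ℕ
  lo : NExp
  hi : NExp
  answer : ℕ

/-- The memory `s` holds the instance `I` on the graph `G` at the places given by the query. -/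
structure Query.Encodes (Q : Query) (s : State) (G : MultiDigraph) (I : SteinerInstance G) :
    Prop where
  numNodes : Q.numNodes.eval s = G.numNodes
  numEdges : Q.numEdges.eval s = G.numEdges
  tail : ∀ e : Fin G.numEdges, s.nat Q.tail e = (G.tail e : ℕ)
  head : ∀ e : Fin G.numEdges, s.nat Q.head e = (G.head e : ℕ)
  len : ∀ e : Fin G.numEdges, s.real Q.len e = I.len e
  source : Q.source.eval s = (I.source : ℕ)
  terminals : ∀ v : ℕ, (∃ j, Q.lo.eval s ≤ j ∧ j < Q.hi.eval s ∧ s.nat Q.terminals j = v) ↔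
    ∃ t ∈ I.terminals, (t : ℕ) = v

/-- Programs. -/
inductive Prog where
  | skip
  | setNat (a : ℕ) (j : NExp) (x : NExp)
  | setReal (a : ℕ) (j : NExp) (x : RExp)
  | seq (p p' : Prog)
  | ite (b : Test) (p p' : Prog)
  | while (b : Test) (p : Prog)
  | call (Q : Query)

/-- Write `x` into cell `j` of the array `a` of natural numbers. -/
def State.writeNat (s : State) (a j x : ℕ) : State :=
  { s with nat := Function.update s.nat a (Function.update (s.nat a) j x) }

/-- Write `x` into cell `j` of the array `a` of real numbers. -/
noncomputable def State.writeReal (s : State) (a j : ℕ) (x : ℝ) : State :=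
  { s with real := Function.update s.real a (Function.update (s.real a) j x) }

/-- Write the incidence vector of the edge set `F` into the cells `0, …, m - 1` of the array `a`. -/
def State.writeEdges (s : State) (a : ℕ) {m : ℕ} (F : Finset (Fin m)) : State :=
  ⟨Function.update s.nat a (fun j =>
    if h : j < m then (if (⟨j, h⟩ : Fin m) ∈ F then 1 else 0) else s.nat a j), s.real⟩

/-- `Exec O p s s' t`: with the oracle `O`, the program `p` started on the memory `s` halts with
memory `s'` after `t` steps. Assignments and tests take one step; an oracle call takes one step plus
the time of the oracle on the instance that is asked. -/
inductive Exec (O : SteinerOracle) : Prog → State → State → ℕ → Prop where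
  | skip (s : State) : Exec O .skip s s 0
  | setNat (s : State) (a : ℕ) (j x : NExp) :
      Exec O (.setNat a j x) s (s.writeNat a (j.eval s) (x.eval s)) 1
  | setReal (s : State) (a : ℕ) (j : NExp) (x : RExp) :
      Exec O (.setReal a j x) s (s.writeReal a (j.eval s) (x.eval s)) 1
  | seq {p p' : Prog} {s s' s'' : State} {t t' : ℕ} :
      Exec O p s s' t → Exec O p' s' s'' t' → Exec O (.seq p p') s s'' (t + t')
  | ite_true {b : Test} {p p' : Prog} {s s' : State} {t : ℕ} :
      b.Holds s → Exec O p s s' t → Exec O (.ite b p p') s s' (t + 1)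
  | ite_false {b : Test} {p p' : Prog} {s s' : State} {t : ℕ} :
      ¬ b.Holds s → Exec O p' s s' t → Exec O (.ite b p p') s s' (t + 1)
  | while_true {b : Test} {p : Prog} {s s' s'' : State} {t t' : ℕ} :
      b.Holds s → Exec O p s s' t → Exec O (.while b p) s' s'' t' →
      Exec O (.while b p) s s'' (t + t' + 1)
  | while_false {b : Test} {p : Prog} {s : State} :
      ¬ b.Holds s → Exec O (.while b p) s s 1
  | call {Q : Query} {s : State} {G : MultiDigraph} {I : SteinerInstance G} :
      Q.Encodes s G I →
      Exec O (.call Q) s (s.writeEdges Q.answer (O.answer G I)) (O.time G I + 1)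

/-! ### Input and output format -/

namespace Network

variable (N : Network)

/-- The receivers of all messages, message by message. -/
def receiverList : List (Fin N.graph.numNodes) :=
  (List.finRange N.numMessages).flatMap (fun i => (N.receivers i).sort (· ≤ ·))

/-- The list `l` as the contents of an array (all further cells are `0`). -/
def arrayOf {α : Type*} [Zero α] (l : List α) : ℕ → α := fun j => l.getD j 0

/-- The input. Arrays of natural numbers: `0` holds the numbers of nodes, edges and messages;
`1`, `2`, `3` the tails, heads and capacities of the edges; `4` the sources of the messages;
`6` the concatenated lists of receivers, where those of message `i` start at the cell whose number
is in cell `i` of array `5` and end before the cell whose number is in cell `i + 1` of array `5`.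
Arrays of real numbers: `0` holds `ω` and `A`; `1` the vector `q`.
All other memory is `0`. -/
noncomputable def input (q : Fin N.numMessages → ℝ) (ω A : ℝ) : State where
  nat a := match a with
    | 0 => arrayOf [N.graph.numNodes, N.graph.numEdges, N.numMessages]
    | 1 => arrayOf (List.ofFn fun e => (N.graph.tail e : ℕ))
    | 2 => arrayOf (List.ofFn fun e => (N.graph.head e : ℕ))
    | 3 => arrayOf (List.ofFn N.cap)
    | 4 => arrayOf (List.ofFn fun i => (N.source i : ℕ))
    | 5 => arrayOf ((List.range (N.numMessages + 1)).map fun j =>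
        ∑ i : Fin N.numMessages, if (i : ℕ) < j then (N.receivers i).card else 0)
    | 6 => arrayOf (N.receiverList.map fun v => (v : ℕ))
    | _ => fun _ => 0
  real a := match a with
    | 0 => arrayOf [ω, A]
    | 1 => arrayOf (List.ofFn q)
    | _ => fun _ => 0

/-- The output value `lam`: cell `0` of the real array `2`. -/
def outputValue (s : State) : ℝ := s.real 2 0

/-- The edge set of the `p`-th output tree: its incidence vector is the `p`-th block of `|ε|` cells
of the array `9` of natural numbers. -/
def outputTree (s : State) (p : ℕ) : Finset (Fin N.graph.numEdges) :=
  Finset.univ.filter fun e => s.nat 9 (p * N.graph.numEdges + e) = 1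

/-- The output vector `x`, as a list of weighted trees: cell `0` of the array `7` of natural numbers
is the length of the list; the `p`-th entry is a tree of the message whose number is in cell `p` of
the array `8` of natural numbers, with the weight in cell `p` of the real array `3`. -/
noncomputable def outputVector (s : State) (i : Fin N.numMessages)
    (F : Finset (Fin N.graph.numEdges)) : ℝ :=
  ∑ p ∈ Finset.range (s.nat 7 0),
    if s.nat 8 p = (i : ℕ) ∧ N.outputTree s p = F then s.real 3 p else 0

end Network

end Routing

/-! The algorithm is a multiplicative-weights scheme of Garg–Könemann type. Write m for the number
of edges, k for the number of messages, eps = min(ω,1)/10, and L for the rounded-up binary logarithm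
of m divided by eps². Every edge carries a length, initially 1/c(e). An amount u of the current
message, at most the smallest capacity on the tree, is sent along a tree that is shortest up to the
factor A, and each edge of the tree has its length multiplied by 1 + eps·u/c(e). The process stops
once some edge carries at least L·c(e).

Quality. No edge ever carries more than (L+1)·c(e), so the flow divided by L+1 is feasible
(`Inv.feasible`). The volume Σ c(e)·len(e) is squeezed from two sides. It is at least exponential in
the congestion of each edge. By weak duality (`opt_mul_le`) the cheapest way to route the demands
costs at most vol/opt, so the volume is at most exponential in A times the routed multiple of q over
opt (`Inv.vol_le_exp`). Comparing both bounds at the stop yields the approximation ratio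
(`Inv.opt_le`).

Speed. A phase routes eta·W·q_i of every message i, after which W grows by the factor 1 + eta; thus
W - W₀ is the multiple of q routed in the finished phases. One round of oracle calls gives an
estimate of the optimum that is right up to the factor m·A, and the geometric growth of W covers
this gap in O(L·A·log(mA)) phases. Each augmentation either completes a message of the phase or
sends a full capacity through some edge, and the latter happens at most m(L+1) times
(`Inv.steps_le`). Finally `mul_log_le` trades k·log m for k·log k + m.

Implementation. An oracle answer need not be a tree; scanning its edges in a topological order
extracts one in linear time (`IsTopOrder.isSteinerTree_scan`). `Rep` ties the machine memory to the
abstract `FlowState`, `body_runs` simulates one step, and `program_runs` adds up the times. All work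
outside the oracle is absorbed because T ≥ m. -/

namespace Routing
namespace Network

variable (N : Network)

/-! ### Linear programming duality -/

open Classical in
/-- The edge sets that connect the source of message `i` with its receivers. -/
noncomputable def connecting (i : Fin N.numMessages) : Finset (Finset (Fin N.graph.numEdges)) :=
  Finset.univ.filter fun F => N.graph.Connects F (N.source i) (N.receivers i)

theorem mem_connecting {i : Fin N.numMessages} {F : Finset (Fin N.graph.numEdges)} :
    F ∈ N.connecting i ↔ N.graph.Connects F (N.source i) (N.receivers i) := by
  simp [connecting]

theorem mem_trees {i : Fin N.numMessages} {F : Finset (Fin N.graph.numEdges)} :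
    F ∈ N.trees i ↔ N.graph.IsSteinerTree (N.source i) (N.receivers i) F := by
  simp [trees]

theorem univ_mem_connecting (i : Fin N.numMessages) : Finset.univ ∈ N.connecting i :=
  N.mem_connecting.2 (N.reachable i)

/-- A receiver differs from the source, so a path to it has a first edge. Hence `minCost` is
positive for positive lengths, and one may divide by the weighted sum of the costs. -/
theorem nonempty_of_mem_connecting {i : Fin N.numMessages} {F : Finset (Fin N.graph.numEdges)}
    (hF : F ∈ N.connecting i) : F.Nonempty := by
  rw [mem_connecting] at hF
  obtain ⟨r, hr⟩ := N.receivers_nonempty i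
  have h := hF r hr
  rcases Relation.ReflTransGen.cases_head h with h | ⟨c, ⟨e, he, -⟩, -⟩
  · exact absurd (h ▸ hr) (N.source_notMem i)
  · exact ⟨e, he⟩

theorem trees_subset_connecting (i : Fin N.numMessages) : N.trees i ⊆ N.connecting i :=
  fun _ hF => N.mem_connecting.2 (N.mem_trees.1 hF).2.2.2

theorem connecting_nonempty (i : Fin N.numMessages) : (N.connecting i).Nonempty :=
  ⟨_, N.univ_mem_connecting i⟩

/-- The minimum cost of connecting the source of message `i` with its receivers. -/
noncomputable def minCost (i : Fin N.numMessages) (l : Fin N.graph.numEdges → ℝ) : ℝ :=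
  (N.connecting i).inf' (N.connecting_nonempty i) fun F => ∑ e ∈ F, l e

variable {N}

theorem minCost_le {i : Fin N.numMessages} (l : Fin N.graph.numEdges → ℝ)
    {F : Finset (Fin N.graph.numEdges)} (hF : F ∈ N.connecting i) :
    N.minCost i l ≤ ∑ e ∈ F, l e :=
  Finset.inf'_le _ hF

/-- The minimum over the finite family is attained. The family consists of all connecting sets, not
just trees, since these are what the oracle is compared with. -/
theorem le_mul_minCost {i : Fin N.numMessages} {l : Fin N.graph.numEdges → ℝ} {A c : ℝ}
    (h : ∀ F ∈ N.connecting i, c ≤ A * ∑ e ∈ F, l e) : c ≤ A * N.minCost i l := by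
  obtain ⟨F, hF, h'⟩ := Finset.exists_mem_eq_inf' (N.connecting_nonempty i)
    (fun F => ∑ e ∈ F, l e)
  rw [minCost, h']
  exact h F hF

theorem minCost_mono (i : Fin N.numMessages) {l l' : Fin N.graph.numEdges → ℝ}
    (h : ∀ e, l e ≤ l' e) : N.minCost i l ≤ N.minCost i l' :=
  Finset.le_inf' _ _ fun _ hF => (minCost_le l hF).trans (Finset.sum_le_sum fun e _ => h e)

theorem minCost_pos (i : Fin N.numMessages) {l : Fin N.graph.numEdges → ℝ}
    (h : ∀ e, 0 < l e) : 0 < N.minCost i l := by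
  rw [minCost, Finset.lt_inf'_iff]
  exact fun F hF => Finset.sum_pos (fun e _ => h e) (N.nonempty_of_mem_connecting hF)

/-- The volume of the network for given edge lengths. -/
noncomputable def vol (l : Fin N.graph.numEdges → ℝ) : ℝ := ∑ e, (N.cap e : ℝ) * l e

/-- The amount of flow through an edge. -/
noncomputable def load (x : Fin N.numMessages → Finset (Fin N.graph.numEdges) → ℝ)
    (e : Fin N.graph.numEdges) : ℝ :=
  ∑ i, ∑ F ∈ N.trees i, (if e ∈ F then 1 else 0) * x i F

/-- Double counting of flow times length: summed over trees it is at least the routed amounts times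
the minimum costs; summed over edges it is at most capacity times length. -/
theorem weak_duality {q : Fin N.numMessages → ℝ}
    {x : Fin N.numMessages → Finset (Fin N.graph.numEdges) → ℝ} {lam : ℝ}
    (h : N.Feasible q x lam) {l : Fin N.graph.numEdges → ℝ} (hl : ∀ e, 0 < l e) :
    lam * ∑ i, q i * N.minCost i l ≤ vol l := by
  calc lam * ∑ i, q i * N.minCost i l = ∑ i, (lam * q i) * N.minCost i l := by
        rw [Finset.mul_sum]; simp only [mul_assoc]
    _ ≤ ∑ i, (∑ F ∈ N.trees i, x i F) * N.minCost i l :=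
        Finset.sum_le_sum fun i _ =>
          mul_le_mul_of_nonneg_right (h.demand i) (minCost_pos i hl).le
    _ ≤ ∑ i, ∑ F ∈ N.trees i, x i F * ∑ e ∈ F, l e := by
        refine Finset.sum_le_sum fun i _ => ?_
        rw [Finset.sum_mul]
        exact Finset.sum_le_sum fun F hF =>
          mul_le_mul_of_nonneg_left (minCost_le l (N.trees_subset_connecting i hF)) (h.nonneg i F)
    _ = ∑ i, ∑ F ∈ N.trees i, ∑ e, ((if e ∈ F then 1 else 0) * x i F) * l e := by
        refine Finset.sum_congr rfl fun i _ => Finset.sum_congr rfl fun F _ => ?_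
        rw [Finset.mul_sum, ← Finset.sum_filter_add_sum_filter_not Finset.univ (· ∈ F)]
        rw [Finset.sum_eq_zero (s := Finset.univ.filter (¬ · ∈ F)), add_zero]
        · simp only [Finset.filter_univ_mem]
          exact Finset.sum_congr rfl fun e he => by simp [he]
        · intro e he
          simp [(Finset.mem_filter.1 he).2]
    _ = ∑ e, (∑ i, ∑ F ∈ N.trees i, (if e ∈ F then 1 else 0) * x i F) * l e := by
        simp only [Finset.sum_mul]
        rw [Finset.sum_comm]
        rw [Finset.sum_congr rfl fun i _ => Finset.sum_comm, Finset.sum_comm]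
    _ ≤ vol l := Finset.sum_le_sum fun e _ =>
        mul_le_mul_of_nonneg_right (h.capacity e) (hl e).le

variable (N) in
/-- The optimal value of the linear program. -/
noncomputable def opt (q : Fin N.numMessages → ℝ) : ℝ := sSup {lam | ∃ x, N.Feasible q x lam}

theorem sum_mul_minCost_pos {q : Fin N.numMessages → ℝ} (hq : ∀ i, 0 ≤ q i) (hq0 : q ≠ 0)
    {l : Fin N.graph.numEdges → ℝ} (hl : ∀ e, 0 < l e) : 0 < ∑ i, q i * N.minCost i l := by
  obtain ⟨i, hi⟩ := Function.ne_iff.1 hq0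
  exact Finset.sum_pos' (fun j _ => mul_nonneg (hq j) (minCost_pos j hl).le)
    ⟨i, Finset.mem_univ _, mul_pos (lt_of_le_of_ne (hq i) (Ne.symm hi)) (minCost_pos i hl)⟩

theorem le_opt {q : Fin N.numMessages → ℝ} (hq : ∀ i, 0 ≤ q i) (hq0 : q ≠ 0)
    {x : Fin N.numMessages → Finset (Fin N.graph.numEdges) → ℝ} {lam : ℝ}
    (h : N.Feasible q x lam) : lam ≤ N.opt q := by
  -- Any positive lengths give an upper bound by duality; unit lengths serve to show that the
  -- supremum is finite.
  refine le_csSup ⟨vol (N := N) (fun _ => 1) / ∑ i, q i * N.minCost i (fun _ => 1), ?_⟩ ⟨x, h⟩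
  rintro lam ⟨x, h⟩
  rw [le_div_iff₀ (sum_mul_minCost_pos hq hq0 fun _ => one_pos)]
  exact weak_duality h fun _ => one_pos

/-- This is how `opt` enters the volume estimates. Duality holds for every feasible value and passes
to the supremum, so attainment of the optimum is never needed. -/
theorem opt_mul_le {q : Fin N.numMessages → ℝ} (hq : ∀ i, 0 ≤ q i) (hq0 : q ≠ 0)
    {l : Fin N.graph.numEdges → ℝ} (hl : ∀ e, 0 < l e) :
    N.opt q * ∑ i, q i * N.minCost i l ≤ vol l := by
  rw [← le_div_iff₀ (sum_mul_minCost_pos hq hq0 hl)]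
  refine csSup_le ⟨0, 0, ?_⟩ ?_
  · constructor <;> simp
  · rintro lam ⟨x, h⟩
    rw [le_div_iff₀ (sum_mul_minCost_pos hq hq0 hl)]
    exact weak_duality h hl

/-- Route the additional amount `u` of message `i` along the tree `F`. -/
def addTree (x : Fin N.numMessages → Finset (Fin N.graph.numEdges) → ℝ) (i : Fin N.numMessages)
    (F : Finset (Fin N.graph.numEdges)) (u : ℝ) :
    Fin N.numMessages → Finset (Fin N.graph.numEdges) → ℝ :=
  fun j F' => x j F' + if j = i ∧ F' = F then u else 0

theorem sum_addTree (x : Fin N.numMessages → Finset (Fin N.graph.numEdges) → ℝ)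
    {i : Fin N.numMessages} {F : Finset (Fin N.graph.numEdges)} (hF : F ∈ N.trees i) (u : ℝ)
    (j : Fin N.numMessages) :
    ∑ F' ∈ N.trees j, addTree x i F u j F' =
      (∑ F' ∈ N.trees j, x j F') + if j = i then u else 0 := by
  simp only [addTree, Finset.sum_add_distrib]
  congr 1
  by_cases h : j = i
  · subst h; simp [hF]
  · simp [h]

theorem load_addTree (x : Fin N.numMessages → Finset (Fin N.graph.numEdges) → ℝ)
    {i : Fin N.numMessages} {F : Finset (Fin N.graph.numEdges)} (hF : F ∈ N.trees i) (u : ℝ)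
    (e : Fin N.graph.numEdges) :
    load (addTree x i F u) e = load x e + if e ∈ F then u else 0 := by
  simp only [load, addTree, mul_add, Finset.sum_add_distrib]
  congr 1
  rw [Finset.sum_eq_single i, Finset.sum_eq_single F]
  · simp
  · intro F' _ h; simp [h]
  · intro h; exact absurd hF h
  · intro j _ h; simp [h]
  · simp

/-- Routing every message on one tree bounds the optimal value from below. -/
theorem inv_le_opt {q : Fin N.numMessages → ℝ} (hq : ∀ i, 0 ≤ q i) (hq0 : q ≠ 0)
    (T : Fin N.numMessages → Finset (Fin N.graph.numEdges)) (hT : ∀ i, T i ∈ N.trees i)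
    {a : ℝ} (ha : 0 < a) (h : ∑ i, q i * ∑ e ∈ T i, (1 / (N.cap e : ℝ)) ≤ a) :
    1 / a ≤ N.opt q := by
  refine le_opt hq hq0 (x := fun i F => if F = T i then q i / a else 0) ?_
  constructor
  · intro i F hF
    rw [if_neg]; rintro rfl; exact hF (hT i)
  · intro i F
    split_ifs
    · exact div_nonneg (hq i) ha.le
    · rfl
  · positivity
  · intro e
    have hc : (0 : ℝ) < N.cap e := by exact_mod_cast N.cap_pos e
    -- A tree through `e` has length at least 1/c(e), so its load q_i/a is at most c(e)/a times q_i
    -- times that length.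
    have h1 : ∀ i, (∑ F ∈ N.trees i, (if e ∈ F then 1 else 0) * (if F = T i then q i / a else 0))
        ≤ N.cap e / a * (q i * ∑ e ∈ T i, (1 / (N.cap e : ℝ))) := by
      intro i
      rw [Finset.sum_eq_single (T i) (fun F _ h => by simp [h]) (fun h => absurd (hT i) h)]
      by_cases he : e ∈ T i
      · have := Finset.single_le_sum (f := fun e => 1 / (N.cap e : ℝ))
          (fun e _ => by positivity) he
        have h2 : N.cap e / a * (q i * (1 / (N.cap e : ℝ))) ≤
            N.cap e / a * (q i * ∑ e ∈ T i, (1 / (N.cap e : ℝ))) := by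
          have := hq i
          gcongr
        refine le_trans (le_of_eq ?_) h2
        simp [he]; field_simp
      · simp only [he, if_false, zero_mul]
        have := hq i
        positivity
    calc _ ≤ ∑ i, N.cap e / a * (q i * ∑ e ∈ T i, (1 / (N.cap e : ℝ))) :=
          Finset.sum_le_sum fun i _ => h1 i
      _ = N.cap e / a * ∑ i, q i * ∑ e ∈ T i, (1 / (N.cap e : ℝ)) := by rw [Finset.mul_sum]
      _ ≤ N.cap e / a * a := by gcongr
      _ = N.cap e := by field_simp
  · intro i
    rw [Finset.sum_eq_single (T i) (fun F _ h => by simp [h]) (fun h => absurd (hT i) h)]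
    simp [div_eq_inv_mul]

/-! ### The multiplicative weights algorithm -/

/-- The parameters of the algorithm: `eps` is the step size, `L` the congestion at which it stops,
`A` the guarantee of the oracle, and `1 / a` the first estimate for the optimal value. -/
structure Params (N : Network) (q : Fin N.numMessages → ℝ) where
  eps : ℝ
  A : ℝ
  L : ℝ
  a : ℝ
  q_nonneg : ∀ i, 0 ≤ q i
  q_ne : q ≠ 0
  eps_pos : 0 < eps
  eps_le : eps ≤ 1 / 10
  one_le_A : 1 ≤ A
  log_le : Real.log N.graph.numEdges ≤ eps ^ 2 * L
  one_le_L : 1 ≤ eps ^ 2 * L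
  edges_pos : 0 < N.graph.numEdges
  a_pos : 0 < a
  inv_le_opt : 1 / a ≤ N.opt q
  opt_mul_le : N.opt q * a ≤ N.graph.numEdges * A

namespace Params

variable {q : Fin N.numMessages → ℝ} (P : Params N q)

theorem L_pos : 0 < P.L := by
  have := P.one_le_L
  by_contra h
  nlinarith [sq_nonneg P.eps]

/-- The growth rate of the demands from phase to phase. -/
noncomputable def eta : ℝ := 1 / (2 * (P.L + 1) * P.A)

/-- The initial scale of the demands. -/
noncomputable def W₀ : ℝ := (P.L + 1) / P.a

theorem A_pos : 0 < P.A := one_pos.trans_le P.one_le_A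

theorem eta_pos : 0 < P.eta := by
  have := P.L_pos; have := P.A_pos
  unfold eta; positivity

theorem W₀_pos : 0 < P.W₀ := by
  have := P.L_pos; have := P.a_pos
  unfold W₀; positivity

theorem opt_pos (P : Params N q) : 0 < N.opt q :=
  lt_of_lt_of_le (one_div_pos.2 P.a_pos) P.inv_le_opt

/-- Together with `Inv.W_sub_le` this keeps W below 2(L+1)·opt at all times, the bound to which
`eta` is tuned. -/
theorem W₀_le : P.W₀ ≤ (P.L + 1) * N.opt q := by
  have := P.L_pos
  have := mul_le_mul_of_nonneg_left P.inv_le_opt (by positivity : 0 ≤ P.L + 1)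
  rwa [mul_one_div] at this

end Params

/-- The state of the algorithm: edge lengths, flow through the edges, flow along the trees, scale
of the demands, current message and the amount of it that is still to be routed. -/
structure FlowState (N : Network) where
  len : Fin N.graph.numEdges → ℝ
  flow : Fin N.graph.numEdges → ℝ
  x : Fin N.numMessages → Finset (Fin N.graph.numEdges) → ℝ
  W : ℝ
  rem : ℝ
  i : Fin N.numMessages

variable {q : Fin N.numMessages → ℝ} (P : Params N q)

/-- Route the amount `u` of the current message along the tree `F`. -/
noncomputable def FlowState.augment (st : FlowState N) (eps : ℝ) (F : Finset (Fin N.graph.numEdges))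
    (u : ℝ) : FlowState N where
  len e := if e ∈ F then st.len e * (1 + eps * u / N.cap e) else st.len e
  flow e := if e ∈ F then st.flow e + u else st.flow e
  x := addTree st.x st.i F u
  W := st.W
  rem := st.rem - u
  i := st.i

/-- Go on to the next message, and to the next phase after the last message. -/
noncomputable def FlowState.switch (st : FlowState N) (q : Fin N.numMessages → ℝ) (eta : ℝ) :
    FlowState N :=
  if h : (st.i : ℕ) + 1 < N.numMessages then
    { st with i := ⟨st.i + 1, h⟩, rem := eta * st.W * q ⟨st.i + 1, h⟩ }
  else
    { st with
      W := st.W * (1 + eta)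
      i := ⟨0, st.i.pos⟩
      rem := eta * (st.W * (1 + eta)) * q ⟨0, st.i.pos⟩ }

/-- The edges on which the flow is far below the bound. -/
def FlowState.Active (st : FlowState N) (L : ℝ) : Prop := ∀ e, st.flow e < L * N.cap e

/-- The amount of message `j` that was routed in the current phase. -/
noncomputable def FlowState.phaseRouted (st : FlowState N) (q : Fin N.numMessages → ℝ) (eta : ℝ)
    (j : Fin N.numMessages) : ℝ :=
  if j < st.i then eta * st.W * q j else if j = st.i then eta * st.W * q j - st.rem else 0

/-- The invariant of the algorithm after `n` steps, in phase `p`. -/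
structure FlowState.Inv (st : FlowState N) (n p : ℕ) : Prop where
  len_pos : ∀ e, 0 < st.len e
  exp_le : ∀ e, Real.exp (P.eps * (1 - P.eps) * (st.flow e / N.cap e)) ≤ N.cap e * st.len e
  load_eq : ∀ e, load st.x e = st.flow e
  supported : ∀ i, ∀ F, F ∉ N.trees i → st.x i F = 0
  nonneg : ∀ i F, 0 ≤ st.x i F
  rem_nonneg : 0 ≤ st.rem
  rem_le : st.rem ≤ P.eta * st.W * q st.i
  W_eq : st.W = P.W₀ * (1 + P.eta) ^ p
  routed : ∀ j, ∑ F ∈ N.trees j, st.x j F = (st.W - P.W₀) * q j + st.phaseRouted q P.eta j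
  vol_le : ∃ D, D ≤ N.graph.numEdges *
      Real.exp (P.eps * P.A * (st.W - P.W₀) / (N.opt q * (1 - P.eps))) ∧
    vol st.len ≤ D + P.eps * P.A * ∑ j, st.phaseRouted q P.eta j * N.minCost j st.len
  count : (n : ℝ) ≤ 2 * (N.numMessages * p + st.i) + (if st.rem = 0 then 1 else 0) +
    ∑ e, st.flow e / N.cap e
  flow_le : ∀ e, st.flow e ≤ (P.L + 1) * N.cap e

end Network
end Routing

/-! ### Preservation and consequences of the invariant -/

namespace Routing
namespace Network

variable {N : Network} {q : Fin N.numMessages → ℝ} {P : Params N q}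

theorem Params.eta_mul (P : Params N q) : P.eta * (2 * (P.L + 1) * P.A) = 1 := by
  have := P.L_pos; have := P.A_pos
  unfold Params.eta; field_simp

theorem Params.eta_le_one (P : Params N q) : P.eta ≤ 1 := by
  have h1 := P.L_pos
  have h2 := P.one_le_A
  rw [Params.eta, div_le_one (by positivity)]
  nlinarith

theorem cap_pos' (e : Fin N.graph.numEdges) : (0 : ℝ) < N.cap e := by
  exact_mod_cast N.cap_pos e

namespace FlowState

/-- The increment eps·u/c(e) is weighted by c(e), so capacities cancel and the volume grows by eps·u
times the length of the tree. -/
theorem vol_augment (st : FlowState N) (eps : ℝ) (F : Finset (Fin N.graph.numEdges)) (u : ℝ) :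
    vol (st.augment eps F u).len = vol st.len + eps * u * ∑ e ∈ F, st.len e := by
  have h : ∀ e, (N.cap e : ℝ) * (st.augment eps F u).len e =
      N.cap e * st.len e + if e ∈ F then eps * u * st.len e else 0 := by
    intro e
    have := cap_pos' e
    simp only [augment]
    split_ifs
    · field_simp
    · simp
  simp only [vol, h, Finset.sum_add_distrib, Finset.mul_sum]
  congr 1
  rw [← Finset.sum_filter, Finset.filter_univ_mem]

namespace Inv

variable {st : FlowState N} {n p : ℕ}

theorem W_pos (h : st.Inv P n p) : 0 < st.W := by
  have := P.W₀_pos; have := P.eta_pos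
  rw [h.W_eq]; positivity

theorem W₀_le (h : st.Inv P n p) : P.W₀ ≤ st.W := by
  rw [h.W_eq]
  exact le_mul_of_one_le_right P.W₀_pos.le (one_le_pow₀ (by linarith [P.eta_pos]))

theorem phaseRouted_nonneg (h : st.Inv P n p) (j : Fin N.numMessages) :
    0 ≤ st.phaseRouted q P.eta j := by
  have h1 := mul_nonneg (mul_nonneg P.eta_pos.le h.W_pos.le) (P.q_nonneg j)
  unfold phaseRouted
  split_ifs with h2 h3
  · exact h1
  · subst h3; linarith [h.rem_le]
  · rfl

theorem phaseRouted_le (h : st.Inv P n p) (j : Fin N.numMessages) :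
    st.phaseRouted q P.eta j ≤ P.eta * st.W * q j := by
  have h1 := mul_nonneg (mul_nonneg P.eta_pos.le h.W_pos.le) (P.q_nonneg j)
  unfold phaseRouted
  split_ifs with h2 h3
  · rfl
  · linarith [h.rem_nonneg]
  · exact h1

/-- The flow of the finished phases, scaled down, is feasible. -/
theorem feasible (h : st.Inv P n p) :
    N.Feasible q (fun i F => st.x i F / (P.L + 1)) ((st.W - P.W₀) / (P.L + 1)) := by
  have hL := P.L_pos
  constructor
  · intro i F hF; simp [h.supported i F hF]
  · intro i F; exact div_nonneg (h.nonneg i F) (by positivity)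
  · exact div_nonneg (by linarith [h.W₀_le]) (by positivity)
  · intro e
    have := h.load_eq e
    have h2 := h.flow_le e
    rw [← this] at h2
    simp only [mul_div_assoc', ← Finset.sum_div]
    rw [div_le_iff₀ (by positivity)]
    rw [mul_comm]
    exact h2
  · intro i
    rw [← Finset.sum_div, h.routed i, div_mul_eq_mul_div]
    gcongr
    linarith [h.phaseRouted_nonneg i]

theorem W_sub_le (h : st.Inv P n p) : st.W - P.W₀ ≤ (P.L + 1) * N.opt q := by
  have hL := P.L_pos
  have := le_opt P.q_nonneg P.q_ne h.feasible
  rwa [div_le_iff₀ (by positivity), mul_comm] at this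

/-- The choice eta = 1/(2(L+1)A) makes the demand of a single phase at most opt/A, so one phase can
raise the volume only by a factor close to 1. -/
theorem scale_le (h : st.Inv P n p) : P.A * (P.eta * st.W) ≤ N.opt q := by
  have h1 := h.W_sub_le
  have h2 := P.W₀_le
  have h3 := P.eta_mul
  have h4 := mul_pos P.eta_pos P.A_pos
  have : P.eta * P.A * st.W ≤ P.eta * P.A * (2 * (P.L + 1) * N.opt q) :=
    mul_le_mul_of_nonneg_left (by linarith) h4.le
  calc _ = P.eta * P.A * st.W := by ring
    _ ≤ _ := this
    _ = (P.eta * (2 * (P.L + 1) * P.A)) * N.opt q := by ring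
    _ = _ := by rw [h3, one_mul]

/-- The volume never exceeds the bound for the end of the current phase. -/
theorem vol_le_exp (h : st.Inv P n p) :
    vol st.len ≤ N.graph.numEdges *
      Real.exp (P.eps * P.A * (st.W + P.eta * st.W - P.W₀) / (N.opt q * (1 - P.eps))) := by
  obtain ⟨D, hD, hv⟩ := h.vol_le
  have he := P.eps_pos
  have he' := P.eps_le
  have hA := P.A_pos
  have hZ := P.opt_pos
  have hs := h.scale_le
  have hW := h.W_pos
  have heta := P.eta_pos
  -- By duality at the current lengths, what the phase has added to the volume is at most `x` times
  -- the volume.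
  set x : ℝ := P.eps * P.A * (P.eta * st.W) / N.opt q with hx
  have hx0 : 0 ≤ x := by positivity
  have hx1 : x ≤ P.eps := by
    rw [hx, div_le_iff₀ hZ, mul_assoc]; gcongr
  have h1 : ∑ j, st.phaseRouted q P.eta j * N.minCost j st.len ≤
      P.eta * st.W * ∑ j, q j * N.minCost j st.len := by
    rw [Finset.mul_sum]
    refine Finset.sum_le_sum fun j _ => ?_
    rw [← mul_assoc]
    exact mul_le_mul_of_nonneg_right (h.phaseRouted_le j) (minCost_pos j h.len_pos).le
  have h2 := Network.opt_mul_le P.q_nonneg P.q_ne h.len_pos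
  have h3 : vol st.len ≤ D + x * vol st.len := by
    refine hv.trans ?_
    have : P.eps * P.A * ∑ j, st.phaseRouted q P.eta j * N.minCost j st.len ≤
        P.eps * P.A * (P.eta * st.W * ∑ j, q j * N.minCost j st.len) := by gcongr
    have h4 : x * (N.opt q * ∑ i, q i * N.minCost i st.len) ≤ x * vol st.len := by gcongr
    have h5 : x * (N.opt q * ∑ i, q i * N.minCost i st.len) =
        P.eps * P.A * (P.eta * st.W * ∑ j, q j * N.minCost j st.len) := by
      rw [hx]; field_simp
    linarith
  have h4 : vol st.len * (1 - x) ≤ D := by linarith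
  -- From log t ≥ 1 - 1/t at t = 1 - x, with x ≤ eps used to weaken the denominator. Dividing by 1 -
  -- x thus costs at most the factor exp(x/(1 - eps)).
  have h5 : Real.exp (-(x / (1 - P.eps))) ≤ 1 - x := by
    have hlog := Real.one_sub_inv_le_log_of_pos (by linarith : 0 < 1 - x)
    have : -(x / (1 - P.eps)) ≤ 1 - (1 - x)⁻¹ := by
      have h6 : 1 - (1 - x)⁻¹ = -(x / (1 - x)) := by
        have : 1 - x ≠ 0 := by linarith
        field_simp; ring
      rw [h6, neg_le_neg_iff]
      exact div_le_div_of_nonneg_left hx0 (by linarith) (by linarith)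
    calc _ ≤ Real.exp (Real.log (1 - x)) := Real.exp_le_exp.2 (this.trans hlog)
      _ = 1 - x := Real.exp_log (by linarith)
  have h6 : 0 ≤ vol st.len :=
    Finset.sum_nonneg fun e _ => mul_nonneg (cap_pos' e).le (h.len_pos e).le
  have h7 : vol st.len * Real.exp (-(x / (1 - P.eps))) ≤ D :=
    (mul_le_mul_of_nonneg_left h5 h6).trans h4
  calc vol st.len = vol st.len * Real.exp (-(x / (1 - P.eps))) * Real.exp (x / (1 - P.eps)) := by
        rw [mul_assoc, ← Real.exp_add]; simp
    _ ≤ (N.graph.numEdges *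
          Real.exp (P.eps * P.A * (st.W - P.W₀) / (N.opt q * (1 - P.eps)))) *
          Real.exp (x / (1 - P.eps)) := by
        exact mul_le_mul_of_nonneg_right (h7.trans hD) (Real.exp_pos _).le
    _ = _ := by
        rw [mul_assoc, ← Real.exp_add]
        congr 2
        rw [hx]
        have : 1 - P.eps ≠ 0 := by linarith
        field_simp; ring

theorem switch (h : st.Inv P n p) (hr : st.rem = 0) :
    ∃ p', (st.switch q P.eta).Inv P (n + 1) p' := by
  have hW := h.W_pos
  have heta := P.eta_pos
  have hm : 0 < N.numMessages := st.i.pos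
  by_cases hi : (st.i : ℕ) + 1 < N.numMessages
  -- The old message has nothing left to route and the new one has nothing routed yet, so the
  -- bookkeeping of the phase is unchanged.
  · have hpr : (st.switch q P.eta).phaseRouted q P.eta = st.phaseRouted q P.eta := by
      funext j
      simp only [FlowState.switch, hi, dif_pos, phaseRouted, hr, Fin.lt_def, Fin.ext_iff]
      split_ifs with h1 h2 h3 h4 <;> first | rfl | (exfalso; omega) | (simp) | skip
      have : j = ⟨st.i + 1, hi⟩ := Fin.ext (by assumption)
      rw [this, sub_self]
    have hs : st.switch q P.eta = { st with
        i := ⟨st.i + 1, hi⟩, rem := P.eta * st.W * q ⟨st.i + 1, hi⟩ } := dif_pos hi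
    rw [hs] at hpr ⊢
    refine ⟨p, h.len_pos, h.exp_le, h.load_eq, h.supported, h.nonneg, ?_, le_rfl, h.W_eq,
      ?_, ?_, ?_, h.flow_le⟩
    · exact mul_nonneg (mul_nonneg heta.le hW.le) (P.q_nonneg _)
    · intro j; rw [hpr]; exact h.routed j
    · rw [hpr]; exact h.vol_le
    -- Each switch is credited 2: one unit for the switch itself, one for the indicator of `rem =
    -- 0`, which may drop from 1 to 0.
    · have := h.count
      rw [if_pos hr] at this
      push_cast
      have h0 : (0 : ℝ) ≤ if P.eta * st.W * q ⟨st.i + 1, hi⟩ = 0 then 1 else 0 := by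
        split_ifs <;> norm_num
      linarith
  · have hs : st.switch q P.eta = { st with
        W := st.W * (1 + P.eta)
        i := ⟨0, hm⟩
        rem := P.eta * (st.W * (1 + P.eta)) * q ⟨0, hm⟩ } := dif_neg hi
    have hpr : (st.switch q P.eta).phaseRouted q P.eta = 0 := by
      funext j
      rw [hs]
      simp only [phaseRouted, Fin.lt_def, Fin.ext_iff]
      split_ifs with h1 h2
      · simp at h1
      · have : j = ⟨0, hm⟩ := Fin.ext h2
        simp [this]
      · rfl
    -- After the last message the phase is complete: every message has received its full share
    -- eta·W·q_j.
    have hpr' : st.phaseRouted q P.eta = fun j => P.eta * st.W * q j := by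
      funext j
      simp only [phaseRouted, hr, Fin.lt_def, Fin.ext_iff]
      split_ifs <;> first | rfl | simp
      exfalso; have := j.2; omega
    have hvol := h.vol_le_exp
    rw [hs] at hpr ⊢
    refine ⟨p + 1, h.len_pos, h.exp_le, h.load_eq, h.supported, h.nonneg, ?_, le_rfl, ?_,
      ?_, ?_, ?_, h.flow_le⟩
    · exact mul_nonneg (by positivity) (P.q_nonneg _)
    · simp only [h.W_eq]; ring
    · intro j; rw [hpr]
      have := h.routed j
      rw [hpr'] at this
      simp only [this, Pi.zero_apply]; ring
    · rw [hpr]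
      -- The bound for the end of the old phase becomes the base value `D` of the new one, in which
      -- nothing has been routed yet.
      refine ⟨_, le_rfl, ?_⟩
      simp only [Pi.zero_apply, zero_mul, Finset.sum_const_zero, mul_zero, add_zero]
      refine hvol.trans (le_of_eq ?_)
      congr 3; ring
    · have := h.count
      rw [if_pos hr] at this
      have h0 : (0 : ℝ) ≤ if P.eta * (st.W * (1 + P.eta)) * q ⟨0, hm⟩ = 0 then 1 else 0 := by
        split_ifs <;> norm_num
      have h1 : ((st.i : ℕ) : ℝ) + 1 = N.numMessages := by
        have := st.i.2
        exact_mod_cast (by omega : (st.i : ℕ) + 1 = N.numMessages)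
      push_cast
      have h2 : (N.numMessages : ℝ) * (p + 1) = N.numMessages * p + st.i + 1 := by
        rw [mul_add, mul_one]; linarith
      rw [h2]
      simp only [add_zero]
      linarith

/-- The volume increase is paid at the old lengths. As minimum costs only grow with the lengths, it
may be charged at the new ones, and so may all earlier increases of the phase. This is why the
volume clause can always refer to the current lengths. -/
theorem augment (h : st.Inv P n p) (hact : st.Active P.L) (hr : 0 < st.rem)
    {F : Finset (Fin N.graph.numEdges)} {u : ℝ} (hF : F ∈ N.trees st.i)
    (hcost : ∑ e ∈ F, st.len e ≤ P.A * N.minCost st.i st.len)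
    (hu : 0 < u) (hur : u ≤ st.rem) (huc : ∀ e ∈ F, u ≤ N.cap e)
    (hue : u = st.rem ∨ ∃ e ∈ F, u = N.cap e) :
    (st.augment P.eps F u).Inv P (n + 1) p := by
  have he := P.eps_pos
  have he' := P.eps_le
  have hA := P.A_pos
  have hpr : ∀ j, (st.augment P.eps F u).phaseRouted q P.eta j =
      st.phaseRouted q P.eta j + if j = st.i then u else 0 := by
    intro j
    simp only [phaseRouted, FlowState.augment]
    by_cases h1 : j = st.i
    · subst h1; simp; ring
    · simp [h1]
  have hlen : ∀ e, st.len e ≤ (st.augment P.eps F u).len e := by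
    intro e
    have := cap_pos' e
    have h1 := h.len_pos e
    simp only [FlowState.augment]
    split_ifs
    · exact le_mul_of_one_le_right h1.le (by have : 0 ≤ P.eps * u / N.cap e := by positivity
                                             linarith)
    · rfl
  constructor
  · exact fun e => (h.len_pos e).trans_le (hlen e)
  · intro e
    have hc := cap_pos' e
    simp only [FlowState.augment]
    split_ifs with heF
    · set y := P.eps * u / N.cap e with hy
      have hy0 : 0 ≤ y := by positivity
      have hy1 : y ≤ P.eps := by
        rw [hy, div_le_iff₀ hc]
        exact mul_le_mul_of_nonneg_left (huc e heF) he.le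
      -- From log(1+y) ≥ y/(1+y), and (1 - eps)(1 + y) ≤ 1 - eps² ≤ 1 because y ≤ eps.
      have h1 : Real.exp (y * (1 - P.eps)) ≤ 1 + y := by
        have hlog := Real.one_sub_inv_le_log_of_pos (by linarith : 0 < 1 + y)
        have h2 : y * (1 - P.eps) ≤ 1 - (1 + y)⁻¹ := by
          have h6 : 1 - (1 + y)⁻¹ = y / (1 + y) := by
            have : 1 + y ≠ 0 := by linarith
            field_simp; ring
          rw [h6, le_div_iff₀ (by linarith), mul_assoc]
          exact mul_le_of_le_one_right hy0 (by nlinarith)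
        calc _ ≤ Real.exp (Real.log (1 + y)) := Real.exp_le_exp.2 (h2.trans hlog)
          _ = 1 + y := Real.exp_log (by linarith)
      have h3 : P.eps * (1 - P.eps) * ((st.flow e + u) / N.cap e) =
          P.eps * (1 - P.eps) * (st.flow e / N.cap e) + y * (1 - P.eps) := by
        rw [hy]; field_simp
      rw [h3, Real.exp_add, ← mul_assoc]
      exact mul_le_mul (h.exp_le e) h1 (Real.exp_pos _).le (mul_pos hc (h.len_pos e)).le
    · exact h.exp_le e
  · intro e
    simp only [FlowState.augment]
    rw [load_addTree _ hF, h.load_eq e]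
    split_ifs <;> simp
  · intro j F' hF'
    simp only [FlowState.augment, addTree]
    rw [h.supported j F' hF', if_neg, add_zero]
    rintro ⟨rfl, rfl⟩
    exact hF' hF
  · intro j F'
    simp only [FlowState.augment, addTree]
    have := h.nonneg j F'
    split_ifs <;> linarith
  · simp only [FlowState.augment]; linarith
  · simp only [FlowState.augment]; linarith [h.rem_le]
  · exact h.W_eq
  · intro j
    rw [hpr, ← add_assoc]
    simp only [FlowState.augment]
    rw [sum_addTree _ hF, h.routed j]
  · obtain ⟨D, hD, hv⟩ := h.vol_le
    refine ⟨D, hD, ?_⟩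
    rw [vol_augment]
    have h1 : P.eps * u * ∑ e ∈ F, st.len e ≤
        P.eps * u * (P.A * N.minCost st.i (st.augment P.eps F u).len) := by
      have h2 := minCost_mono st.i hlen
      gcongr
      exact hcost.trans (by gcongr)
    have h3 : ∑ j, st.phaseRouted q P.eta j * N.minCost j st.len ≤
        ∑ j, st.phaseRouted q P.eta j * N.minCost j (st.augment P.eps F u).len :=
      Finset.sum_le_sum fun j _ =>
        mul_le_mul_of_nonneg_left (minCost_mono j hlen) (h.phaseRouted_nonneg j)
    have h4 : ∑ j, (st.augment P.eps F u).phaseRouted q P.eta j *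
          N.minCost j (st.augment P.eps F u).len =
        (∑ j, st.phaseRouted q P.eta j * N.minCost j (st.augment P.eps F u).len) +
          u * N.minCost st.i (st.augment P.eps F u).len := by
      simp only [hpr, add_mul, Finset.sum_add_distrib]
      congr 1
      simp
    rw [h4]
    have h5 := mul_le_mul_of_nonneg_left h3 (by positivity : 0 ≤ P.eps * P.A)
    linarith
  · have h1 := h.count
    rw [if_neg hr.ne'] at h1
    have hdiff : ∀ e, (st.augment P.eps F u).flow e / N.cap e =
        st.flow e / N.cap e + if e ∈ F then u / N.cap e else 0 := by
      intro e
      simp only [FlowState.augment]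
      split_ifs <;> simp [add_div]
    simp only [hdiff, Finset.sum_add_distrib]
    have hnn : ∀ e ∈ Finset.univ, (0 : ℝ) ≤ if e ∈ F then u / N.cap e else 0 := by
      intro e _
      have := cap_pos' e
      split_ifs <;> positivity
    have hi : (st.augment P.eps F u).i = st.i := rfl
    have hrem : (st.augment P.eps F u).rem = st.rem - u := rfl
    rw [hi, hrem]
    push_cast
    -- The new step is paid for by the indicator going from 0 to 1 if the message is finished, and
    -- otherwise by the bottleneck edge, whose relative flow rises by exactly 1.
    rcases hue with h2 | ⟨e, heF, h2⟩
    · rw [if_pos (by linarith)]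
      have := Finset.sum_nonneg hnn
      linarith
    · have h3 := Finset.single_le_sum hnn (Finset.mem_univ e)
      have hc := cap_pos' e
      rw [if_pos heF, h2, div_self hc.ne'] at h3
      have h0 : (0 : ℝ) ≤ if st.rem - u = 0 then 1 else 0 := by split_ifs <;> norm_num
      rw [h2] at h0 ⊢
      linarith
  · intro e
    have h1 := hact e
    have h2 := h.flow_le e
    simp only [FlowState.augment]
    split_ifs with heF
    · linarith [huc e heF]
    · exact h2

/-- When the flow is large on some edge, the scaled flow is nearly optimal. -/
theorem opt_le (h : st.Inv P n p) (hact : ¬ st.Active P.L) {w : ℝ} (hw : 0 < w) (hw1 : w ≤ 1)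
    (heps : P.eps = w / 10) :
    N.opt q ≤ (1 + w) * P.A * ((st.W - P.W₀) / (P.L + 1)) := by
  have he := P.eps_pos
  have he' := P.eps_le
  have hA := P.A_pos
  have hZ := P.opt_pos
  have hL := P.L_pos
  have hm : (0 : ℝ) < N.graph.numEdges := by exact_mod_cast P.edges_pos
  simp only [Active, not_forall, not_lt] at hact
  obtain ⟨e, hf⟩ := hact
  have hc := cap_pos' e
  have h1 : N.cap e * st.len e ≤ vol st.len :=
    Finset.single_le_sum (f := fun e => (N.cap e : ℝ) * st.len e)
      (fun e _ => mul_nonneg (cap_pos' e).le (h.len_pos e).le) (Finset.mem_univ e)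
  -- The length of the congested edge alone bounds the volume from below.
  have h2 : Real.exp (P.eps * (1 - P.eps) * P.L) ≤
      Real.exp (Real.log N.graph.numEdges + P.eps * P.A * (st.W + P.eta * st.W - P.W₀) /
        (N.opt q * (1 - P.eps))) := by
    rw [Real.exp_add, Real.exp_log hm]
    refine le_trans ?_ ((h.exp_le e).trans (h1.trans h.vol_le_exp))
    apply Real.exp_le_exp.2
    apply mul_le_mul_of_nonneg_left
    · rwa [le_div_iff₀ hc]
    · exact mul_nonneg he.le (by linarith)
  have h3 := Real.exp_le_exp.1 h2
  have hs := h.scale_le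
  set S := st.W - P.W₀ with hS
  set Z := N.opt q
  have h4 : P.eps * P.A * (st.W + P.eta * st.W - P.W₀) / (Z * (1 - P.eps)) ≤
      (P.eps * P.A * S + P.eps * Z) / (Z * (1 - P.eps)) := by
    apply div_le_div_of_nonneg_right
    · have := mul_le_mul_of_nonneg_left hs he.le
      have : P.eps * P.A * (st.W + P.eta * st.W - P.W₀) =
        P.eps * P.A * S + P.eps * (P.A * (P.eta * st.W)) := by rw [hS]; ring
      linarith
    · exact mul_nonneg hZ.le (by linarith)
  -- The initial volume m enters only through log m, and L is chosen so that log m ≤ eps²·L.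
  have h5 : P.eps * (1 - P.eps) * P.L - P.eps ^ 2 * P.L ≤
      (P.eps * P.A * S + P.eps * Z) / (Z * (1 - P.eps)) := by
    linarith [P.log_le]
  rw [le_div_iff₀ (mul_pos hZ (by linarith))] at h5
  have h6 : P.L * Z * (1 - 2 * P.eps) * (1 - P.eps) ≤ P.A * S + Z := by
    have : P.eps * (P.L * Z * (1 - 2 * P.eps) * (1 - P.eps)) ≤ P.eps * (P.A * S + Z) := by
      linarith
    exact le_of_mul_le_mul_left this he
  have h7 : (1 : ℝ) ≤ P.eps * P.L := by
    have := P.one_le_L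
    nlinarith
  have h8 : Z ≤ P.eps * P.L * Z := le_mul_of_one_le_left hZ.le h7
  have hLZ : 0 < P.L * Z := mul_pos hL hZ
  -- The lone term Z is at most eps·L·Z, and (1 - 2·eps)(1 - eps) - eps ≥ 1 - 4·eps.
  have h9 : P.L * Z * (1 - 4 * P.eps) ≤ P.A * S := by
    nlinarith [mul_pos hLZ (pow_pos he 2)]
  rw [mul_div_assoc', le_div_iff₀ (by positivity)]
  -- Replacing L by L+1 costs another factor 1 + eps. With eps = w/10 and w ≤ 1, all losses fit into
  -- 1 + w.
  have h10 : Z * (P.L + 1) ≤ (1 + w) * (P.L * Z * (1 - 4 * P.eps)) := by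
    have : (1 + P.eps) ≤ (1 + w) * (1 - 4 * P.eps) := by
      rw [heps]; nlinarith
    have := mul_le_mul_of_nonneg_left this hLZ.le
    nlinarith
  calc _ ≤ _ := h10
    _ ≤ (1 + w) * (P.A * S) := by gcongr
    _ = _ := by ring

/-- A bound for the number of steps. -/
theorem steps_le (h : st.Inv P n p) :
    (n : ℝ) ≤ 2 * N.numMessages *
        (4 * (P.L + 1) * P.A * Real.log (2 * N.graph.numEdges * P.A) + 1) + 1 +
      N.graph.numEdges * (P.L + 1) := by
  have hL := P.L_pos
  have hA := P.A_pos
  have heta := P.eta_pos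
  have hm : (0 : ℝ) < N.graph.numEdges := by exact_mod_cast P.edges_pos
  -- The scale starts at (L+1)/a and never exceeds 2(L+1)·opt, so it grows at most by the factor
  -- 2·opt·a ≤ 2mA.
  have h1 : (1 + P.eta) ^ p ≤ 2 * N.graph.numEdges * P.A := by
    have h2 : st.W ≤ 2 * (P.L + 1) * N.opt q := by linarith [h.W_sub_le, P.W₀_le]
    rw [h.W_eq, Params.W₀, div_mul_eq_mul_div, div_le_iff₀ P.a_pos] at h2
    have h3 : (P.L + 1) * (1 + P.eta) ^ p ≤ (P.L + 1) * (2 * (N.opt q * P.a)) := by linarith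
    have h4 := le_of_mul_le_mul_left h3 (by positivity)
    linarith [P.opt_mul_le]
  -- Here log(1 + eta) ≥ eta/(1 + eta) ≥ eta/2, since eta ≤ 1.
  have h2 : P.eta / 2 * p ≤ Real.log (2 * N.graph.numEdges * P.A) := by
    have h3 := Real.log_le_log (by positivity) h1
    rw [Real.log_pow] at h3
    refine le_trans ?_ h3
    rw [mul_comm]
    gcongr
    have h4 := Real.one_sub_inv_le_log_of_pos (by linarith : 0 < 1 + P.eta)
    refine le_trans ?_ h4
    have h6 : 1 - (1 + P.eta)⁻¹ = P.eta / (1 + P.eta) := by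
      have : 1 + P.eta ≠ 0 := by linarith
      field_simp; ring
    rw [h6]
    exact div_le_div_of_nonneg_left heta.le (by linarith) (by linarith [P.eta_le_one])
  have h3 : (p : ℝ) ≤ 4 * (P.L + 1) * P.A * Real.log (2 * N.graph.numEdges * P.A) := by
    have h4 := mul_le_mul_of_nonneg_left h2 (by positivity : 0 ≤ 4 * (P.L + 1) * P.A)
    have h5 : 4 * (P.L + 1) * P.A * (P.eta / 2 * p) = p := by
      rw [show 4 * (P.L + 1) * P.A * (P.eta / 2 * p) = (P.eta * (2 * (P.L + 1) * P.A)) * p by ring,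
        P.eta_mul, one_mul]
    linarith
  have h4 : ∑ e, st.flow e / N.cap e ≤ N.graph.numEdges * (P.L + 1) := by
    calc _ ≤ ∑ _e : Fin N.graph.numEdges, (P.L + 1) := by
          refine Finset.sum_le_sum fun e _ => ?_
          rw [div_le_iff₀ (cap_pos' e)]
          exact h.flow_le e
      _ = _ := by simp [mul_add]
  have h5 : ((st.i : ℕ) : ℝ) ≤ N.numMessages := by exact_mod_cast st.i.2.le
  have h6 : (if st.rem = 0 then 1 else 0 : ℝ) ≤ 1 := by split_ifs <;> norm_num
  have h7 : (N.numMessages : ℝ) * p ≤ N.numMessages *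
    (4 * (P.L + 1) * P.A * Real.log (2 * N.graph.numEdges * P.A)) := by gcongr
  have := h.count
  linarith

end Inv

variable (P) in
/-- The initial state. -/
noncomputable def init (hm : 0 < N.numMessages) : FlowState N where
  len e := 1 / N.cap e
  flow _ := 0
  x _ _ := 0
  W := P.W₀
  rem := P.eta * P.W₀ * q ⟨0, hm⟩
  i := ⟨0, hm⟩

/-- With lengths 1/c(e) every edge contributes 1 to the volume, which is therefore m: the base value
`D` at W = W₀. -/
theorem init_inv (hm : 0 < N.numMessages) : (init P hm).Inv P 0 0 := by
  have hpr : (init P hm).phaseRouted q P.eta = 0 := by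
    funext j
    simp only [phaseRouted, init, Fin.lt_def, Fin.ext_iff]
    split_ifs with h1 h2
    · simp at h1
    · have : j = ⟨0, hm⟩ := Fin.ext h2
      simp [this]
    · rfl
  have h0 := P.L_pos
  constructor
  · intro e; exact one_div_pos.2 (cap_pos' e)
  · intro e; have := cap_pos' e; simp [init, this.ne']
  · intro e; simp [init, load]
  · simp [init]
  · simp [init]
  · exact mul_nonneg (mul_nonneg P.eta_pos.le P.W₀_pos.le) (P.q_nonneg _)
  · exact le_rfl
  · simp [init]
  · intro j; rw [hpr]; simp [init]
  · refine ⟨_, le_rfl, ?_⟩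
    rw [hpr]
    simp only [init, vol, sub_self, mul_zero, zero_div, Real.exp_zero, mul_one, Pi.zero_apply,
      zero_mul, Finset.sum_const_zero, add_zero]
    rw [Finset.sum_congr rfl fun e _ => mul_one_div_cancel (cap_pos' e).ne']
    simp
  · norm_num [init]
    split_ifs <;> norm_num
  · intro e; have := cap_pos' e; simp only [init]; positivity

end FlowState
end Network
end Routing

namespace Routing
namespace MultiDigraph

variable {G : MultiDigraph}

theorem Reach.mono {F F' : Finset (Fin G.numEdges)} (h : F ⊆ F') {u v : Fin G.numNodes}
    (huv : G.Reach F u v) : G.Reach F' u v := by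
  have hle : G.Step F ≤ G.Step F' := fun _ _ ⟨e, he, h'⟩ => ⟨e, h he, h'⟩
  exact Relation.ReflTransGen.mono hle _ _ huv

/-! ### Topological orders and the extraction of Steiner trees -/

/-- The edges `ord 0, ord 1, …` are listed such that no edge starts where a later one ends. -/
structure IsTopOrder (G : MultiDigraph) (ord : ℕ → Fin G.numEdges) : Prop where
  surj : ∀ e, ∃ j < G.numEdges, ord j = e
  tail_ne : ∀ j < G.numEdges, ∀ j' ≤ j, G.tail (ord j') ≠ G.head (ord j)

/-- Scan the edges of `F` in the order `ord`, keeping each edge that starts at a node reached before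
and enters a new node. The result after `j` edges: the nodes reached and the edges kept. -/
def scan (ord : ℕ → Fin G.numEdges) (s : Fin G.numNodes) (F : Finset (Fin G.numEdges)) :
    ℕ → Finset (Fin G.numNodes) × Finset (Fin G.numEdges)
  | 0 => ({s}, ∅)
  | j + 1 =>
    if ord j ∈ F ∧ G.tail (ord j) ∈ (scan ord s F j).1 ∧ G.head (ord j) ∉ (scan ord s F j).1 then
      (insert (G.head (ord j)) (scan ord s F j).1, insert (ord j) (scan ord s F j).2)
    else scan ord s F j

/-- `closed` makes the greedy scan complete: no edge of `F` scanned so far leaves `V`. That heads of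
kept edges lie in `V` is what forbids a second edge into the same node. -/
structure ScanInv (ord : ℕ → Fin G.numEdges) (s : Fin G.numNodes) (F : Finset (Fin G.numEdges))
    (j : ℕ) (V : Finset (Fin G.numNodes)) (K : Finset (Fin G.numEdges)) : Prop where
  source : s ∈ V
  reach : ∀ v ∈ V, G.Reach K s v
  subset : ∀ e ∈ K, e ∈ F ∧ G.tail e ∈ V ∧ G.head e ∈ V ∧ G.head e ≠ s
  inj : ∀ e ∈ K, ∀ e' ∈ K, G.head e = G.head e' → e = e'
  closed : ∀ j' < j, ord j' ∈ F → G.tail (ord j') ∈ V → G.head (ord j') ∈ V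

theorem IsTopOrder.scan_inv {ord : ℕ → Fin G.numEdges} (ho : G.IsTopOrder ord)
    (s : Fin G.numNodes) (F : Finset (Fin G.numEdges)) {j : ℕ} (hj : j ≤ G.numEdges) :
    ScanInv ord s F j (scan ord s F j).1 (scan ord s F j).2 := by
  induction j with
  | zero =>
    constructor <;> simp [scan, Reach]
    exact Relation.ReflTransGen.refl
  | succ j ih =>
    have ih := ih (by omega)
    rw [scan]
    split_ifs with h
    · obtain ⟨h1, h2, h3⟩ := h
      refine ⟨Finset.mem_insert_of_mem ih.source, ?_, ?_, ?_, ?_⟩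
      · intro v hv
        rcases Finset.mem_insert.1 hv with rfl | hv
        · exact ((ih.reach _ h2).mono (Finset.subset_insert _ _)).tail
            ⟨_, Finset.mem_insert_self _ _, rfl, rfl⟩
        · exact (ih.reach v hv).mono (Finset.subset_insert _ _)
      · intro e he
        rcases Finset.mem_insert.1 he with rfl | he
        · refine ⟨h1, Finset.mem_insert_of_mem h2, Finset.mem_insert_self _ _, ?_⟩
          intro h4
          exact h3 (h4 ▸ ih.source)
        · obtain ⟨h4, h5, h6, h7⟩ := ih.subset e he
          exact ⟨h4, Finset.mem_insert_of_mem h5, Finset.mem_insert_of_mem h6, h7⟩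
      · intro e he e' he' hee
        rcases Finset.mem_insert.1 he with rfl | he <;> rcases Finset.mem_insert.1 he' with rfl | he'
        · rfl
        · exact absurd (hee ▸ (ih.subset e' he').2.2.1) h3
        · exact absurd (hee ▸ (ih.subset e he).2.2.1) h3
        · exact ih.inj e he e' he' hee
      · intro j' hj' hF ht
        rcases Nat.lt_succ_iff_lt_or_eq.1 hj' with hj' | rfl
        · rcases Finset.mem_insert.1 ht with ht | ht
          -- The only use of the topological order: an edge scanned earlier cannot start at the
          -- newly reached node, so no rejected edge has to be reconsidered.
          · exact absurd ht (ho.tail_ne j (by omega) j' hj'.le)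
          · exact Finset.mem_insert_of_mem (ih.closed j' hj' hF ht)
        · exact Finset.mem_insert_self _ _
    · refine ⟨ih.source, ih.reach, ih.subset, ih.inj, ?_⟩
      intro j' hj' hF ht
      rcases Nat.lt_succ_iff_lt_or_eq.1 hj' with hj' | rfl
      · exact ih.closed j' hj' hF ht
      · by_contra h'
        exact h ⟨hF, ht, h'⟩

theorem scan_snd_subset (ord : ℕ → Fin G.numEdges) (s : Fin G.numNodes)
    (F : Finset (Fin G.numEdges)) (j : ℕ) : (scan ord s F j).2 ⊆ F := by
  induction j with
  | zero => simp [scan]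
  | succ j ih =>
    rw [scan]
    split_ifs with h
    · exact Finset.insert_subset h.1 ih
    · exact ih

/-- After the full scan `V` is closed under the edges of `F`, hence contains everything reachable in
`F`, in particular the terminals. -/
theorem IsTopOrder.isSteinerTree_scan {ord : ℕ → Fin G.numEdges} (ho : G.IsTopOrder ord)
    {s : Fin G.numNodes} {R : Finset (Fin G.numNodes)} {F : Finset (Fin G.numEdges)}
    (hF : G.Connects F s R) : G.IsSteinerTree s R (scan ord s F G.numEdges).2 := by
  have h := ho.scan_inv s F le_rfl
  refine ⟨fun e he => h.reach _ (h.subset e he).2.1, fun e he => (h.subset e he).2.2.2, h.inj, ?_⟩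
  have key : ∀ v, G.Reach F s v → v ∈ (scan ord s F G.numEdges).1 := by
    intro v hv
    induction hv with
    | refl => exact h.source
    | tail _ h2 ih =>
      obtain ⟨e, he, rfl, rfl⟩ := h2
      obtain ⟨j, hj, rfl⟩ := ho.surj e
      exact h.closed j hj he ih
  exact fun v hv => h.reach _ (key v (hF v hv))

/-! ### Levels -/

theorem Acyclic.wellFounded (hG : G.Acyclic) : WellFounded (G.Step Finset.univ) := by
  have : Std.Irrefl (Relation.TransGen (G.Step Finset.univ)) := ⟨hG⟩
  have h : WellFounded (Relation.TransGen (G.Step Finset.univ)) :=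
    Finite.wellFounded_of_trans_of_irrefl _
  exact Subrelation.wf (fun h => Relation.TransGen.single h) h

/-- The length of a longest path to a node. -/
noncomputable def level (hG : G.Acyclic) : Fin G.numNodes → ℕ :=
  hG.wellFounded.fix fun v ih => Finset.univ.sup fun e =>
    if h : G.head e = v then ih (G.tail e) ⟨e, Finset.mem_univ _, rfl, h⟩ + 1 else 0

theorem level_eq (hG : G.Acyclic) (v : Fin G.numNodes) :
    level hG v = Finset.univ.sup fun e => if G.head e = v then level hG (G.tail e) + 1 else 0 := by
  rw [level, WellFounded.fix_eq]
  rfl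

theorem level_tail_lt (hG : G.Acyclic) (e : Fin G.numEdges) :
    level hG (G.tail e) < level hG (G.head e) := by
  rw [level_eq hG (G.head e)]
  have := Finset.le_sup (f := fun e' => if G.head e' = G.head e then level hG (G.tail e') + 1 else 0)
    (Finset.mem_univ e)
  simp only [if_true] at this
  omega

theorem exists_edge_of_level_pos (hG : G.Acyclic) {v : Fin G.numNodes} (h : 0 < level hG v) :
    ∃ e, G.head e = v ∧ level hG v = level hG (G.tail e) + 1 := by
  have h1 := level_eq hG v
  have hne : (Finset.univ : Finset (Fin G.numEdges)).Nonempty := by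
    by_contra h2
    rw [Finset.not_nonempty_iff_eq_empty] at h2
    rw [h2] at h1
    simp at h1
    omega
  obtain ⟨e, -, he⟩ := Finset.exists_mem_eq_sup _ hne
    (fun e => if G.head e = v then level hG (G.tail e) + 1 else 0)
  rw [he] at h1
  by_cases h3 : G.head e = v
  · exact ⟨e, h3, by simpa [h3] using h1⟩
  · rw [if_neg h3] at h1; omega

/-- Walking backwards along a longest path lowers the level by one per edge, so every intermediate
level occurs at the head of an edge. -/
theorem exists_level_head_eq (hG : G.Acyclic) (v : Fin G.numNodes) {j : ℕ} (hj : 0 < j)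
    (hjv : j ≤ level hG v) : ∃ e, level hG (G.head e) = j := by
  obtain ⟨n, hn⟩ : ∃ n, level hG v = n := ⟨_, rfl⟩
  induction n generalizing v with
  | zero => omega
  | succ n ih =>
    obtain ⟨e, he, h⟩ := exists_edge_of_level_pos hG (v := v) (by omega)
    rcases hjv.eq_or_lt with h1 | h1
    · exact ⟨e, by rw [he, h1]⟩
    · exact ih (G.tail e) (by omega) (by omega)

/-- The levels 1, …, `level v` are attained at heads of edges. So a number of rounds equal to the
number of edges suffices, however many isolated nodes there are. -/
theorem level_le (hG : G.Acyclic) (v : Fin G.numNodes) : level hG v ≤ G.numEdges := by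
  have h : Finset.Icc 1 (level hG v) ⊆ Finset.univ.image fun e => level hG (G.head e) := by
    intro j hj
    obtain ⟨h1, h2⟩ := Finset.mem_Icc.1 hj
    obtain ⟨e, he⟩ := exists_level_head_eq hG v h1 h2
    exact Finset.mem_image.2 ⟨e, Finset.mem_univ _, he⟩
  have := (Finset.card_le_card h).trans Finset.card_image_le
  simpa using this

/-- The array `lv` holds lower bounds for the levels, after `r` rounds and `n` further edges. -/
structure LevelInv (hG : G.Acyclic) (lv : ℕ → ℕ) (r n : ℕ) : Prop where
  le : ∀ v : Fin G.numNodes, lv v ≤ level hG v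
  ge : ∀ v : Fin G.numNodes, min (level hG v) r ≤ lv v
  done : ∀ e : Fin G.numEdges, (e : ℕ) < n → min (level hG (G.tail e) + 1) (r + 1) ≤ lv (G.head e)

theorem LevelInv.zero (hG : G.Acyclic) : LevelInv hG (fun _ => 0) 0 0 := by
  constructor <;> simp

/-- A node of positive level has an entering edge that realises its level, and the finished round
has relaxed this edge. -/
theorem LevelInv.next {hG : G.Acyclic} {lv : ℕ → ℕ} {r : ℕ} (h : LevelInv hG lv r G.numEdges) :
    LevelInv hG lv (r + 1) 0 := by
  refine ⟨h.le, ?_, by simp⟩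
  intro v
  rcases Nat.eq_zero_or_pos (level hG v) with h0 | h0
  · omega
  · obtain ⟨e, rfl, he⟩ := exists_edge_of_level_pos hG h0
    have := h.done e e.2
    omega

theorem LevelInv.keep {hG : G.Acyclic} {lv : ℕ → ℕ} {r : ℕ} {e : Fin G.numEdges}
    (h : LevelInv hG lv r e) (hlv : ¬ lv (G.head e) < lv (G.tail e) + 1) :
    LevelInv hG lv r (e + 1) := by
  refine ⟨h.le, h.ge, ?_⟩
  intro e' he'
  rcases Nat.lt_succ_iff_lt_or_eq.1 he' with h1 | h1
  · exact h.done e' h1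
  · have : e' = e := Fin.ext h1
    subst this
    have := h.ge (G.tail e')
    omega

/-- Values only increase, so the lower bounds survive. They never pass the true level, because
levels increase strictly along edges. -/
theorem LevelInv.relax {hG : G.Acyclic} {lv : ℕ → ℕ} {r : ℕ} {e : Fin G.numEdges}
    (h : LevelInv hG lv r e) (hlv : lv (G.head e) < lv (G.tail e) + 1) :
    LevelInv hG (Function.update lv (G.head e) (lv (G.tail e) + 1)) r (e + 1) := by
  have hge : ∀ v : Fin G.numNodes,
      lv v ≤ Function.update lv (G.head e : ℕ) (lv (G.tail e) + 1) v := by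
    intro v
    by_cases hv : (v : ℕ) = G.head e
    · rw [hv, Function.update_self]; omega
    · rw [Function.update_of_ne hv]
  refine ⟨?_, fun v => (h.ge v).trans (hge v), ?_⟩
  · intro v
    by_cases hv : (v : ℕ) = G.head e
    · have hv' : v = G.head e := Fin.ext hv
      rw [hv', Function.update_self]
      have := level_tail_lt hG e
      have := h.le (G.tail e)
      omega
    · rw [Function.update_of_ne hv]; exact h.le v
  · intro e' he'
    rcases Nat.lt_succ_iff_lt_or_eq.1 he' with h1 | h1
    · exact (h.done e' h1).trans (hge _)
    · have : e' = e := Fin.ext h1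
      subst this
      have := h.ge (G.tail e')
      rw [Function.update_self]
      omega

theorem LevelInv.eq_level {hG : G.Acyclic} {lv : ℕ → ℕ} {n : ℕ}
    (h : LevelInv hG lv G.numEdges n) (v : Fin G.numNodes) : lv v = level hG v := by
  have h1 := h.le v
  have h2 := h.ge v
  have h3 := level_le hG v
  omega

/-! ### Sorting the edges by level -/

/-- The key by which the edges are sorted. -/
noncomputable def key (hG : G.Acyclic) (e : Fin G.numEdges) : ℕ :=
  level hG (G.tail e) * G.numEdges + e

/-- The first `cnt` cells of `ord` hold the edges with keys less than `K`, sorted by their keys. -/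
structure OrderInv (hG : G.Acyclic) (ord : ℕ → ℕ) (cnt K : ℕ) : Prop where
  mem : ∀ j < cnt, ∃ e : Fin G.numEdges, ord j = e ∧ key hG e < K
  sorted : ∀ j' < cnt, ∀ j < j', ∀ e e' : Fin G.numEdges, ord j = e → ord j' = e' →
    key hG e < key hG e'
  surj : ∀ e : Fin G.numEdges, key hG e < K → ∃ j < cnt, ord j = e

theorem OrderInv.zero (hG : G.Acyclic) (ord : ℕ → ℕ) : OrderInv hG ord 0 0 := by
  constructor <;> simp

/-- A key is a two-digit number in base m with the edge as its last digit; remainder and quotient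
recover edge and level. -/
theorem level_eq_of_key_eq {hG : G.Acyclic} {r : ℕ} {e e' : Fin G.numEdges}
    (h : key hG e' = r * G.numEdges + e) : e' = e ∧ level hG (G.tail e') = r := by
  have h1 := congrArg (· % G.numEdges) h
  have h2 := congrArg (· / G.numEdges) h
  have hpos : 0 < G.numEdges := e.pos
  simp only [key] at h1 h2
  rw [Nat.mul_add_mod_self_right, Nat.mul_add_mod_self_right, Nat.mod_eq_of_lt e.2,
    Nat.mod_eq_of_lt e'.2] at h1
  rw [mul_comm, Nat.mul_add_div hpos, mul_comm, Nat.mul_add_div hpos, Nat.div_eq_of_lt e.2,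
    Nat.div_eq_of_lt e'.2] at h2
  exact ⟨Fin.ext h1, by omega⟩

theorem OrderInv.skip {hG : G.Acyclic} {ord : ℕ → ℕ} {cnt r : ℕ} {e : Fin G.numEdges}
    (h : OrderInv hG ord cnt (r * G.numEdges + e)) (he : level hG (G.tail e) ≠ r) :
    OrderInv hG ord cnt (r * G.numEdges + (e + 1)) := by
  refine ⟨?_, h.sorted, ?_⟩
  · intro j hj
    obtain ⟨e', h1, h2⟩ := h.mem j hj
    exact ⟨e', h1, by omega⟩
  · intro e' he'
    refine h.surj e' (lt_of_le_of_ne (by omega) fun h1 => ?_)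
    obtain ⟨rfl, h2⟩ := level_eq_of_key_eq h1
    exact he h2

theorem OrderInv.push {hG : G.Acyclic} {ord : ℕ → ℕ} {cnt r : ℕ} {e : Fin G.numEdges}
    (h : OrderInv hG ord cnt (r * G.numEdges + e)) (he : level hG (G.tail e) = r) :
    OrderInv hG (Function.update ord cnt e) (cnt + 1) (r * G.numEdges + (e + 1)) := by
  have hk : key hG e = r * G.numEdges + e := by rw [key, he]
  refine ⟨?_, ?_, ?_⟩
  · intro j hj
    rcases Nat.lt_succ_iff_lt_or_eq.1 hj with hj | rfl
    · obtain ⟨e', h1, h2⟩ := h.mem j hj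
      exact ⟨e', by rwa [Function.update_of_ne hj.ne], by omega⟩
    · exact ⟨e, Function.update_self .., by omega⟩
  · intro j' hj' j hj e₁ e₂ h1 h2
    rw [Function.update_of_ne (by omega)] at h1
    rcases Nat.lt_succ_iff_lt_or_eq.1 hj' with hj' | rfl
    · rw [Function.update_of_ne hj'.ne] at h2
      exact h.sorted j' hj' j hj e₁ e₂ h1 h2
    · rw [Function.update_self] at h2
      have : e₂ = e := Fin.ext h2.symm
      subst this
      obtain ⟨e', h3, h4⟩ := h.mem j hj
      have : e₁ = e' := Fin.ext (h1.symm.trans h3)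
      subst this
      omega
  · intro e' he'
    rcases Nat.lt_or_ge (key hG e') (r * G.numEdges + e) with h1 | h1
    · obtain ⟨j, hj, h2⟩ := h.surj e' h1
      exact ⟨j, by omega, by rwa [Function.update_of_ne hj.ne]⟩
    · obtain ⟨rfl, -⟩ := level_eq_of_key_eq (hG := hG) (e := e) (e' := e') (r := r) (by omega)
      exact ⟨cnt, by omega, Function.update_self ..⟩

/-- All keys are below m², so every edge is listed, and strict sorting excludes repetitions; hence
exactly m cells are filled. An edge listed no later than another has a tail of no larger level,
which is below the level of the other edge's head. -/
theorem OrderInv.exists_topOrder {hG : G.Acyclic} {ord : ℕ → ℕ} {cnt : ℕ} (hm : 0 < G.numEdges)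
    (h : OrderInv hG ord cnt (G.numEdges * G.numEdges)) :
    ∃ o : ℕ → Fin G.numEdges, G.IsTopOrder o ∧ ∀ j < G.numEdges, ord j = o j := by
  have hkey : ∀ e, key hG e < G.numEdges * G.numEdges := by
    intro e
    have h1 := level_tail_lt hG e
    have h2 := level_le hG (G.head e)
    have h3 : level hG (G.tail e) + 1 ≤ G.numEdges := by omega
    have h4 := Nat.mul_le_mul_right G.numEdges h3
    have := e.2
    rw [key]
    rw [add_mul, one_mul] at h4
    omega
  choose f hf using h.mem
  have hbij : Function.Bijective (fun j : Fin cnt => f j j.2) := by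
    constructor
    · intro j j' hjj
      by_contra hne
      have hjj : f j j.2 = f j' j'.2 := hjj
      have h1 := (hf j j.2).1
      have h2 := (hf j' j'.2).1
      rcases lt_or_gt_of_ne (fun h => hne (Fin.ext h) : (j : ℕ) ≠ j') with h3 | h3
      · have := h.sorted j' j'.2 j h3 _ _ h1 h2
        rw [hjj] at this; omega
      · have := h.sorted j j.2 j' h3 _ _ h2 h1
        rw [hjj] at this; omega
    · intro e
      obtain ⟨j, hj, h1⟩ := h.surj e (hkey e)
      exact ⟨⟨j, hj⟩, Fin.ext ((hf j hj).1.symm.trans h1)⟩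
  have hcnt : cnt = G.numEdges := by
    simpa using Fintype.card_of_bijective hbij
  subst hcnt
  refine ⟨fun j => if hj : j < G.numEdges then f j hj else ⟨0, hm⟩, ⟨?_, ?_⟩, ?_⟩
  · intro e
    obtain ⟨j, hj⟩ := hbij.2 e
    exact ⟨j, j.2, by simpa using hj⟩
  · intro j hj j' hj'
    have hj'' : j' < G.numEdges := by omega
    simp only [hj, hj'', dif_pos]
    intro heq
    have h1 := level_tail_lt hG (f j hj)
    rw [← heq] at h1
    have h2 : key hG (f j' hj'') ≤ key hG (f j hj) := by
      rcases hj'.eq_or_lt with rfl | hlt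
      · rfl
      · exact (h.sorted j hj j' hlt _ _ (hf j' hj'').1 (hf j hj).1).le
    simp only [key] at h2
    have h3 := Nat.mul_le_mul_right G.numEdges h1
    have h4 := (f j hj).2
    have h5 : (level hG (G.tail (f j hj)) + 1) * G.numEdges =
      level hG (G.tail (f j hj)) * G.numEdges + G.numEdges := by ring
    have h6 := h5 ▸ h3
    omega
  · intro j hj
    simp only [hj, dif_pos]
    exact (hf j hj).1

end MultiDigraph
end Routing

namespace Routing

/-! ### Total correctness with time bounds -/

/-- The program `p`, started on `s`, halts after at most `t` steps on a memory that satisfies `Q`. -/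
def Runs (O : SteinerOracle) (p : Prog) (s : State) (t : ℕ) (Q : State → Prop) : Prop :=
  ∃ s' t', Exec O p s s' t' ∧ t' ≤ t ∧ Q s'

namespace Runs

variable {O : SteinerOracle} {s : State} {Q : State → Prop}

theorem mono {p : Prog} {t t' : ℕ} {R : State → Prop} (h : Runs O p s t R) (ht : t ≤ t')
    (hQ : ∀ s', R s' → Q s') : Runs O p s t' Q := by
  obtain ⟨s', u, h1, h2, h3⟩ := h
  exact ⟨s', u, h1, h2.trans ht, hQ s' h3⟩

theorem skip {t : ℕ} (h : Q s) : Runs O .skip s t Q :=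
  ⟨s, 0, .skip s, Nat.zero_le _, h⟩

theorem setNat {a : ℕ} {j x : NExp} {t : ℕ} (h : Q (s.writeNat a (j.eval s) (x.eval s))) :
    Runs O (.setNat a j x) s (t + 1) Q :=
  ⟨_, 1, .setNat s a j x, by omega, h⟩

theorem setReal {a : ℕ} {j : NExp} {x : RExp} {t : ℕ}
    (h : Q (s.writeReal a (j.eval s) (x.eval s))) : Runs O (.setReal a j x) s (t + 1) Q :=
  ⟨_, 1, .setReal s a j x, by omega, h⟩

theorem seq {p p' : Prog} {t₁ t₂ : ℕ} {R : State → Prop} (h : Runs O p s t₁ R)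
    (h' : ∀ s', R s' → Runs O p' s' t₂ Q) : Runs O (.seq p p') s (t₁ + t₂) Q := by
  obtain ⟨s', u, h1, h2, h3⟩ := h
  obtain ⟨s'', u', h4, h5, h6⟩ := h' s' h3
  exact ⟨s'', u + u', .seq h1 h4, by omega, h6⟩

theorem setNat_seq {a : ℕ} {j x : NExp} {p : Prog} {t : ℕ}
    (h : Runs O p (s.writeNat a (j.eval s) (x.eval s)) t Q) :
    Runs O (.seq (.setNat a j x) p) s (t + 1) Q := by
  obtain ⟨s', u, h1, h2, h3⟩ := h
  exact ⟨s', 1 + u, .seq (.setNat s a j x) h1, by omega, h3⟩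

theorem setReal_seq {a : ℕ} {j : NExp} {x : RExp} {p : Prog} {t : ℕ}
    (h : Runs O p (s.writeReal a (j.eval s) (x.eval s)) t Q) :
    Runs O (.seq (.setReal a j x) p) s (t + 1) Q := by
  obtain ⟨s', u, h1, h2, h3⟩ := h
  exact ⟨s', 1 + u, .seq (.setReal s a j x) h1, by omega, h3⟩

theorem ite {b : Test} {p p' : Prog} {t : ℕ} (h : b.Holds s → Runs O p s t Q)
    (h' : ¬ b.Holds s → Runs O p' s t Q) : Runs O (.ite b p p') s (t + 1) Q := by
  by_cases hb : b.Holds s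
  · obtain ⟨s', u, h1, h2, h3⟩ := h hb
    exact ⟨s', u + 1, .ite_true hb h1, by omega, h3⟩
  · obtain ⟨s', u, h1, h2, h3⟩ := h' hb
    exact ⟨s', u + 1, .ite_false hb h1, by omega, h3⟩

/-- A loop that does not run more than `B` times. -/
theorem while_le {b : Test} {p : Prog} {tb : ℕ} (B : ℕ) (I : ℕ → State → Prop)
    (hB : ∀ n s, I n s → n ≤ B)
    (hstep : ∀ n s, I n s → b.Holds s → Runs O p s tb (I (n + 1))) {n : ℕ} (h : I n s) :
    Runs O (.while b p) s ((B - n + 1) * (tb + 1)) fun s' => ∃ n, I n s' ∧ ¬ b.Holds s' := by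
  obtain ⟨d, hd⟩ : ∃ d, B - n = d := ⟨_, rfl⟩
  induction d generalizing n s with
  | zero =>
    -- Here n = B, so another iteration would produce the invariant at B + 1, against `hB`.
    by_cases hb : b.Holds s
    · obtain ⟨s', u, h1, h2, h3⟩ := hstep n s h hb
      have := hB _ _ h
      have := hB _ _ h3
      omega
    · exact ⟨s, 1, .while_false hb, by rw [hd]; omega, n, h, hb⟩
  | succ d ih =>
    by_cases hb : b.Holds s
    · obtain ⟨s', u, h1, h2, h3⟩ := hstep n s h hb
      obtain ⟨s'', u', h4, h5, h6⟩ := ih h3 (by omega)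
      refine ⟨s'', u + u' + 1, .while_true hb h1 h4, ?_, h6⟩
      rw [show B - (n + 1) = d by omega] at h5
      rw [hd, add_mul (d + 1)]
      omega
    · refine ⟨s, 1, .while_false hb, ?_, n, h, hb⟩
      exact Nat.mul_pos (Nat.succ_pos _) (Nat.succ_pos _)

/-- A loop that runs `m` times. -/
theorem while_count {b : Test} {p : Prog} {tb : ℕ} (m : ℕ) (I : ℕ → State → Prop)
    (hstep : ∀ n s, n < m → I n s → b.Holds s ∧ Runs O p s tb (I (n + 1)))
    (hend : ∀ s, I m s → ¬ b.Holds s) (h : I 0 s) :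
    Runs O (.while b p) s (m * (tb + 1) + 1) (I m) := by
  suffices H : ∀ d n s, n + d = m → I n s →
      Runs O (.while b p) s (d * (tb + 1) + 1) (I m) from H m 0 s (by omega) h
  intro d
  induction d with
  | zero =>
    intro n s hn h
    obtain rfl : n = m := by omega
    exact ⟨s, 1, .while_false (hend s h), by omega, h⟩
  | succ d ih =>
    intro n s hn h
    obtain ⟨hb, s', u, h1, h2, h3⟩ := hstep n s (by omega) h
    obtain ⟨s'', u', h4, h5, h6⟩ := ih (n + 1) s' (by omega) h3
    refine ⟨s'', u + u' + 1, .while_true hb h1 h4, ?_, h6⟩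
    rw [add_mul d]
    omega

end Runs

/-! ### Reading the memory -/

theorem State.writeNat_nat (s : State) (a j x b : ℕ) :
    (s.writeNat a j x).nat b = if b = a then Function.update (s.nat a) j x else s.nat b := by
  split_ifs with h
  · subst h; simp [writeNat]
  · simp [writeNat, h]

theorem State.writeNat_real (s : State) (a j x : ℕ) : (s.writeNat a j x).real = s.real := rfl

theorem State.writeReal_real (s : State) (a j : ℕ) (x : ℝ) (b : ℕ) :
    (s.writeReal a j x).real b = if b = a then Function.update (s.real a) j x else s.real b := by
  split_ifs with h
  · subst h; simp [writeReal]
  · simp [writeReal, h]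

theorem State.writeReal_nat (s : State) (a j : ℕ) (x : ℝ) : (s.writeReal a j x).nat = s.nat := rfl

/-- The memories `s` and `s'` differ only in the arrays of natural numbers in the list `l` and in
the arrays of real numbers in the list `l'`. -/
structure SameExcept (l l' : List ℕ) (s s' : State) : Prop where
  nat : ∀ a, a ∉ l → s'.nat a = s.nat a
  real : ∀ a, a ∉ l' → s'.real a = s.real a

namespace SameExcept

variable {l l' : List ℕ} {s s' s'' : State}

theorem refl (l l' : List ℕ) (s : State) : SameExcept l l' s s := ⟨fun _ _ => rfl, fun _ _ => rfl⟩

theorem trans (h : SameExcept l l' s s') (h' : SameExcept l l' s' s'') : SameExcept l l' s s'' :=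
  ⟨fun a ha => (h'.nat a ha).trans (h.nat a ha), fun a ha => (h'.real a ha).trans (h.real a ha)⟩

theorem mono {k k' : List ℕ} (h : SameExcept l l' s s') (hl : ∀ a ∈ l, a ∈ k)
    (hl' : ∀ a ∈ l', a ∈ k') : SameExcept k k' s s' :=
  ⟨fun a ha => h.nat a fun h => ha (hl a h), fun a ha => h.real a fun h => ha (hl' a h)⟩

theorem writeNat (h : SameExcept l l' s s') {a : ℕ} (ha : a ∈ l) (j x : ℕ) :
    SameExcept l l' s (s'.writeNat a j x) := by
  refine ⟨fun b hb => ?_, h.real⟩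
  rw [State.writeNat_nat, if_neg fun (hba : b = a) => hb (hba ▸ ha), h.nat b hb]

theorem writeReal (h : SameExcept l l' s s') {a : ℕ} (ha : a ∈ l') (j : ℕ) (x : ℝ) :
    SameExcept l l' s (s'.writeReal a j x) := by
  refine ⟨h.nat, fun b hb => ?_⟩
  rw [State.writeReal_real, if_neg fun (hba : b = a) => hb (hba ▸ ha), h.real b hb]

theorem writeEdges (h : SameExcept l l' s s') {a : ℕ} (ha : a ∈ l) {m : ℕ} (F : Finset (Fin m)) :
    SameExcept l l' s (s'.writeEdges a F) := by
  refine ⟨fun b hb => ?_, h.real⟩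
  have : b ≠ a := fun h => hb (h ▸ ha)
  simp only [State.writeEdges, Function.update_of_ne this]
  exact h.nat b hb

end SameExcept

/-! ### Counting loops -/

/-- The scalar variable kept in cell `0` of an array of natural numbers. -/
abbrev NExp.var (a : ℕ) : NExp := .get a (.lit 0)

/-- The scalar variable kept in cell `0` of an array of real numbers. -/
abbrev RExp.var (a : ℕ) : RExp := .get a (.lit 0)

/-- Run `p` with the values `0, …, n - 1` of the variable `c`, where `n` is the value of `x`. -/
def Prog.forLoop (c : ℕ) (x : NExp) (p : Prog) : Prog :=
  .seq (.setNat c (.lit 0) (.lit 0))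
    (.while (.natLt (.var c) x) (.seq p (.setNat c (.lit 0) (.add (.var c) (.lit 1)))))

/-- Each iteration costs two extra steps, for the test and the increment; two more pay for the
initialisation and the failing test. The body must leave the counter as it found it, and the
invariant is required after the increment. -/
theorem Runs.forLoop {O : SteinerOracle} {s : State} {c : ℕ} {x : NExp} {p : Prog} {tb : ℕ} (m : ℕ)
    (I : ℕ → State → Prop) (hx : ∀ n s, I n s → x.eval s = m)
    (hstep : ∀ n s, n < m → s.nat c 0 = n → I n s →
      Runs O p s tb fun s' => s'.nat c 0 = n ∧ I (n + 1) (s'.writeNat c 0 (n + 1)))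
    (h : I 0 (s.writeNat c 0 0)) :
    Runs O (.forLoop c x p) s (m * (tb + 2) + 2) (I m) := by
  apply Runs.setNat_seq
  refine (Runs.while_count (tb := tb + 1) m (fun n s => s.nat c 0 = n ∧ I n s) ?_ ?_ ?_).mono le_rfl
    fun s' h => h.2
  · rintro n s hn ⟨hc, hI⟩
    refine ⟨?_, ?_⟩
    · simp only [Test.Holds, NExp.eval, hx n s hI, hc, hn]
    · refine Runs.seq (hstep n s hn hc hI) fun s' h' => Runs.setNat (t := 0) ?_
      simp only [NExp.eval, h'.1]
      exact ⟨by simp [State.writeNat_nat], h'.2⟩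
  · rintro s ⟨hc, hI⟩
    simp [Test.Holds, NExp.eval, hx m s hI, hc]
  · simp only [NExp.eval]
    exact ⟨by simp [State.writeNat_nat], h⟩

/-! ### The input -/

/-- The input arrays of the memory hold the network, the demands and the parameters. -/
structure HasInput (N : Network) (q : Fin N.numMessages → ℝ) (ω A : ℝ) (s : State) : Prop where
  numNodes : s.nat 0 0 = N.graph.numNodes
  numEdges : s.nat 0 1 = N.graph.numEdges
  numMessages : s.nat 0 2 = N.numMessages
  tail : ∀ e : Fin N.graph.numEdges, s.nat 1 e = N.graph.tail e
  head : ∀ e : Fin N.graph.numEdges, s.nat 2 e = N.graph.head e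
  cap : ∀ e : Fin N.graph.numEdges, s.nat 3 e = N.cap e
  source : ∀ i : Fin N.numMessages, s.nat 4 i = N.source i
  terminals : ∀ (i : Fin N.numMessages) (v : ℕ),
    (∃ j, s.nat 5 i ≤ j ∧ j < s.nat 5 (i + 1) ∧ s.nat 6 j = v) ↔ ∃ t ∈ N.receivers i, (t : ℕ) = v
  omega : s.real 0 0 = ω
  guarantee : s.real 0 1 = A
  demand : ∀ i : Fin N.numMessages, s.real 1 i = q i

/-- The input occupies the natural arrays below 7 and the real arrays below 2; the working arrays
lie above. -/
theorem HasInput.of_same {N : Network} {q : Fin N.numMessages → ℝ} {ω A : ℝ} {s s' : State}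
    {l l' : List ℕ} (h : HasInput N q ω A s) (hs : SameExcept l l' s s')
    (hl : ∀ a ∈ l, 7 ≤ a) (hl' : ∀ a ∈ l', 2 ≤ a) : HasInput N q ω A s' := by
  have hn : ∀ a, a < 7 → s'.nat a = s.nat a := fun a ha => hs.nat a fun h => by
    have := hl a h; omega
  have hr : ∀ a, a < 2 → s'.real a = s.real a := fun a ha => hs.real a fun h => by
    have := hl' a h; omega
  constructor <;> simp only [hn, hr, Nat.reduceLT]
  exacts [h.numNodes, h.numEdges, h.numMessages, h.tail, h.head, h.cap, h.source, h.terminals,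
    h.omega, h.guarantee, h.demand]

theorem getD_ofFn {α : Type*} [Zero α] {n : ℕ} (f : Fin n → α) (i : Fin n) :
    Network.arrayOf (List.ofFn f) i = f i := by
  simp [Network.arrayOf, List.getD_eq_getElem?_getD]

/-- In a concatenation of lists, the members of one of them are found between two partial sums of
the lengths. -/
theorem exists_getElem_flatMap_finRange {α : Type*} {n : ℕ} (f : Fin n → List α) (i : Fin n)
    (P : α → Prop) :
    (∃ j, (∑ i' : Fin n, if (i' : ℕ) < i then (f i').length else 0) ≤ j ∧
      j < (∑ i' : Fin n, if (i' : ℕ) < i + 1 then (f i').length else 0) ∧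
      ∃ h : j < ((List.finRange n).flatMap f).length, P ((List.finRange n).flatMap f)[j]) ↔
    ∃ t ∈ f i, P t := by
  induction n with
  | zero => exact i.elim0
  | succ n ih =>
    simp only [List.finRange_succ, List.flatMap_cons, List.flatMap_map, Fin.sum_univ_succ,
      Fin.val_zero, Fin.val_succ]
    rcases Fin.eq_zero_or_eq_succ i with rfl | ⟨i, rfl⟩
    · simp only [Fin.val_zero]
      constructor
      · rintro ⟨j, -, h1, h2, h3⟩
        have h1 : j < (f 0).length := by simpa using h1
        rw [List.getElem_append_left h1] at h3
        exact ⟨_, List.getElem_mem h1, h3⟩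
      · rintro ⟨t, ht, hP⟩
        obtain ⟨j, hj, rfl⟩ := List.getElem_of_mem ht
        refine ⟨j, by simp, by simpa using hj, by simp; omega, ?_⟩
        rwa [List.getElem_append_left hj]
    · have ih := ih (fun i => f i.succ) i
      rw [← ih]
      simp only [Fin.val_succ, Nat.succ_lt_succ_iff, Nat.zero_lt_succ, if_true]
      constructor
      · rintro ⟨j, h1, h2, h3, h4⟩
        rw [List.getElem_append_right (by omega)] at h4
        rw [List.length_append] at h3
        exact ⟨j - (f 0).length, by omega, by omega, by omega, h4⟩
      · rintro ⟨j, h1, h2, h3, h4⟩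
        refine ⟨(f 0).length + j, by omega, by omega, by rw [List.length_append]; omega, ?_⟩
        rw [List.getElem_append_right (by omega)]
        simpa using h4

theorem hasInput_input (N : Network) (q : Fin N.numMessages → ℝ) (ω A : ℝ) :
    HasInput N q ω A (N.input q ω A) := by
  constructor
  · simp [Network.input, Network.arrayOf]
  · simp [Network.input, Network.arrayOf]
  · simp [Network.input, Network.arrayOf]
  · exact getD_ofFn _
  · exact getD_ofFn _
  · exact getD_ofFn _
  · exact getD_ofFn _
  · intro i v
    have h := exists_getElem_flatMap_finRange (fun i => (N.receivers i).sort (· ≤ ·)) i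
      (fun t => (t : ℕ) = v)
    simp only [Finset.mem_sort, Finset.length_sort] at h
    rw [← h]
    have h5 : ∀ j ≤ N.numMessages, (N.input q ω A).nat 5 j =
        ∑ i : Fin N.numMessages, if (i : ℕ) < j then (N.receivers i).card else 0 := by
      intro j hj
      simp [Network.input, Network.arrayOf, List.getD_eq_getElem?_getD, Nat.lt_succ_of_le hj]
    have h6 : ∀ j, (N.input q ω A).nat 6 j =
        if h : j < N.receiverList.length then (N.receiverList[j] : ℕ) else 0 := by
      intro j
      simp only [Network.input, Network.arrayOf, List.getD_eq_getElem?_getD]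
      split_ifs with hj
      -- The receivers enter `input` through the monadic coercion of lists, which is an ordinary
      -- map.
      · have hm : (do let a ← N.receiverList; pure (a : ℕ)) =
            List.map (fun v : Fin N.graph.numNodes => (v : ℕ)) N.receiverList := List.map_eq_flatMap.symm
        rw [hm]
        simp [hj]
      · simp [not_lt.1 hj]
    have hlen : N.receiverList.length = ∑ i : Fin N.numMessages, (N.receivers i).card := by
      simp [Network.receiverList, List.length_flatMap, Fin.sum_univ_def]
    rw [h5 _ i.2.le, h5 _ i.2]
    refine exists_congr fun j => and_congr_right fun _ => and_congr_right fun hj => ?_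
    have hj' : j < N.receiverList.length := by
      rw [hlen]
      refine hj.trans_le (Finset.sum_le_sum fun i' _ => ?_)
      split_ifs <;> omega
    rw [h6, dif_pos hj']
    constructor
    · exact fun h => ⟨hj', h⟩
    · exact fun h => h.2
  · simp [Network.input, Network.arrayOf]
  · simp [Network.input, Network.arrayOf]
  · exact getD_ofFn _

end Routing

namespace Routing

/-! ### The preparatory parts of the program

Variables: `10`, `11` loop counters; `12` levels of the nodes; `13` the edges in topological order,
`14` their number; `15` the answers of the oracle; `16` the last tree by which a node was reached;
`17` the current message; `18`, `19` a logarithm and the corresponding power; `20` the stop flag;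
`21` the offset of the next output tree. Real variables: `10` the edge lengths; `11` the flow;
`12` the estimate; `13`, `14` the initial and the current scale of the demands; `15` what remains to
be routed of the current message; `16` the step size; `17` the stopping congestion; `18` the amount
that is routed along a tree. -/

namespace Algorithm

/-- Compute the step size and the stopping congestion. -/
def setup : Prog :=
  .seq (.ite (.realLt (.var 0) (.ofNat (.lit 1)))
    (.setReal 16 (.lit 0) (.div (.var 0) (.ofNat (.lit 10))))
    (.setReal 16 (.lit 0) (.div (.ofNat (.lit 1)) (.ofNat (.lit 10)))))
  (.seq (.setNat 19 (.lit 0) (.lit 1))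
  (.seq (.while (.natLt (.var 19) (.get 0 (.lit 1)))
    (.seq (.setNat 19 (.lit 0) (.add (.var 19) (.var 19)))
      (.setNat 18 (.lit 0) (.add (.var 18) (.lit 1)))))
  (.setReal 17 (.lit 0) (.div (.ofNat (.var 18)) (.mul (.var 16) (.var 16))))))

/-- Compute the levels of the nodes. -/
def levels : Prog :=
  .forLoop 11 (.get 0 (.lit 1)) (.forLoop 10 (.get 0 (.lit 1))
    (.ite (.natLt (.get 12 (.get 2 (.var 10))) (.add (.get 12 (.get 1 (.var 10))) (.lit 1)))
      (.setNat 12 (.get 2 (.var 10)) (.add (.get 12 (.get 1 (.var 10))) (.lit 1)))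
      .skip))

/-- Sort the edges by the levels of their tails. -/
def order : Prog :=
  .forLoop 11 (.get 0 (.lit 1)) (.forLoop 10 (.get 0 (.lit 1))
    (.ite (.conj (.neg (.natLt (.get 12 (.get 1 (.var 10))) (.var 11)))
        (.neg (.natLt (.var 11) (.get 12 (.get 1 (.var 10))))))
      (.seq (.setNat 13 (.var 14) (.var 10)) (.setNat 14 (.lit 0) (.add (.var 14) (.lit 1))))
      .skip))

/-- Set the initial edge lengths. -/
def lengths : Prog :=
  .forLoop 10 (.get 0 (.lit 1))
    (.setReal 10 (.var 10) (.div (.ofNat (.lit 1)) (.ofNat (.get 3 (.var 10)))))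

/-- The query for the message whose number is held by the variable `c`. -/
def query (c : ℕ) : Query where
  numNodes := .get 0 (.lit 0)
  numEdges := .get 0 (.lit 1)
  tail := 1
  head := 2
  len := 10
  source := .get 4 (.var c)
  terminals := 6
  lo := .get 5 (.var c)
  hi := .get 5 (.add (.var c) (.lit 1))
  answer := 15

/-- Compute the weighted cost of trees for all messages. -/
def estimate : Prog :=
  .forLoop 11 (.get 0 (.lit 2)) (.seq (.call (query 11)) (.forLoop 10 (.get 0 (.lit 1))
    (.ite (.natLt (.lit 0) (.get 15 (.var 10)))
      (.setReal 12 (.lit 0)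
        (.add (.var 12) (.mul (.get 1 (.var 11)) (.get 10 (.var 10)))))
      .skip)))

variable {N : Network} {q : Fin N.numMessages → ℝ} {ω A : ℝ} {O : SteinerOracle} {s : State}

/-- The machine has no logarithm, so the rounded-up binary logarithm is found by repeated doubling.
-/
theorem setup_runs (hin : HasInput N q ω A s) (h0 : s.nat 18 0 = 0) :
    Runs O setup s (3 * Nat.clog 2 N.graph.numEdges + 5) fun s' =>
      SameExcept [18, 19] [16, 17] s s' ∧ s'.real 16 0 = min ω 1 / 10 ∧
      s'.real 17 0 = Nat.clog 2 N.graph.numEdges / (min ω 1 / 10 * (min ω 1 / 10)) := by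
  have h1 : Runs O (.ite (.realLt (.var 0) (.ofNat (.lit 1)))
      (.setReal 16 (.lit 0) (.div (.var 0) (.ofNat (.lit 10))))
      (.setReal 16 (.lit 0) (.div (.ofNat (.lit 1)) (.ofNat (.lit 10))))) s 2
      fun s' => SameExcept [18, 19] [16, 17] s s' ∧ s'.real 16 0 = min ω 1 / 10 ∧
        s'.nat 18 0 = 0 := by
    apply Runs.ite
    · intro h
      apply Runs.setReal
      refine ⟨(SameExcept.refl _ _ _).writeReal (by simp) _ _, ?_, by rwa [State.writeReal_nat]⟩
      simp only [Test.Holds, RExp.eval, NExp.eval, hin.omega, Nat.cast_one] at h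
      simp [RExp.eval, NExp.eval, State.writeReal_real, hin.omega, min_eq_left h.le]
    · intro h
      apply Runs.setReal
      refine ⟨(SameExcept.refl _ _ _).writeReal (by simp) _ _, ?_, by rwa [State.writeReal_nat]⟩
      simp only [Test.Holds, RExp.eval, NExp.eval, hin.omega, Nat.cast_one, not_lt] at h
      simp [RExp.eval, NExp.eval, State.writeReal_real, min_eq_right h]
  refine (Runs.seq (t₂ := 3 * Nat.clog 2 N.graph.numEdges + 3) h1 ?_).mono (by omega) fun _ h => h
  rintro s1 ⟨hs1, he1, hb1⟩
  have hin1 := hin.of_same hs1 (by simp) (by simp)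
  apply Runs.setNat_seq
  refine (Runs.seq (Runs.while_count (tb := 2) (Nat.clog 2 N.graph.numEdges)
    (fun n s' => SameExcept [18, 19] [16, 17] s s' ∧ s'.real 16 0 = min ω 1 / 10 ∧
      s'.nat 18 0 = n ∧ s'.nat 19 0 = 2 ^ n) ?_ ?_ ?_) (t₂ := 1) ?_).mono (by omega) fun _ h => h
  · rintro n s2 hn ⟨hs2, he2, hb2, hp2⟩
    have hin2 := hin.of_same hs2 (by simp) (by simp)
    refine ⟨?_, ?_⟩
    · simp only [Test.Holds, NExp.eval, hin2.numEdges, hp2]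
      exact Nat.pow_lt_of_lt_clog hn
    · apply Runs.setNat_seq
      apply Runs.setNat
      refine ⟨(hs2.writeNat (by simp) _ _).writeNat (by simp) _ _, he2, ?_, ?_⟩
      · simp [NExp.eval, State.writeNat_nat, hb2]
      · simp [NExp.eval, State.writeNat_nat, hp2, pow_succ, mul_two]
  · rintro s2 ⟨hs2, he2, hb2, hp2⟩
    have hin2 := hin.of_same hs2 (by simp) (by simp)
    simp only [Test.Holds, NExp.eval, hin2.numEdges, hp2, not_lt]
    exact Nat.le_pow_clog (by norm_num) _
  · refine ⟨hs1.writeNat (by simp) _ _, he1, ?_, ?_⟩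
    · simp [NExp.eval, State.writeNat_nat, hb1]
    · simp [NExp.eval, State.writeNat_nat]
  · rintro s2 ⟨hs2, he2, hb2, hp2⟩
    apply Runs.setReal
    refine ⟨hs2.writeReal (by simp) _ _, ?_, ?_⟩
    · simp [State.writeReal_real, he2]
    · simp [RExp.eval, NExp.eval, State.writeReal_real, he2, hb2]

theorem levels_runs (hin : HasInput N q ω A s) (h0 : s.nat 12 = fun _ => 0) :
    Runs O levels s (N.graph.numEdges * (N.graph.numEdges * 4 + 4) + 2) fun s' =>
      SameExcept [10, 11, 12] [] s s' ∧
      ∀ v : Fin N.graph.numNodes, s'.nat 12 v = MultiDigraph.level N.acyclic v := by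
  refine (Runs.forLoop N.graph.numEdges (tb := N.graph.numEdges * 4 + 2) (fun r s' =>
    SameExcept [10, 11, 12] [] s s' ∧ MultiDigraph.LevelInv N.acyclic (s'.nat 12) r 0)
    ?_ ?_ ?_).mono le_rfl ?_
  · rintro r s1 ⟨hs1, -⟩
    exact (hin.of_same hs1 (by simp) (by simp)).numEdges
  · rintro r s1 hr hr1 ⟨hs1, hl1⟩
    -- The inner frame does not contain array `11`, so the outer counter survives the round.
    refine (Runs.forLoop N.graph.numEdges (tb := 2) (fun n s' =>
      SameExcept [10, 12] [] s1 s' ∧ MultiDigraph.LevelInv N.acyclic (s'.nat 12) r n)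
      ?_ ?_ ?_).mono le_rfl ?_
    · rintro n s2 ⟨hs2, -⟩
      exact ((hin.of_same hs1 (by simp) (by simp)).of_same hs2 (by simp) (by simp)).numEdges
    · rintro n s2 hn hn2 ⟨hs2, hl2⟩
      have hin2 := (hin.of_same hs1 (by simp) (by simp)).of_same hs2 (by simp) (by simp)
      have ht := hin2.tail ⟨n, hn⟩
      have hh := hin2.head ⟨n, hn⟩
      apply Runs.ite
      · intro hb
        simp only [Test.Holds, NExp.eval, hn2, ht, hh] at hb
        apply Runs.setNat
        simp only [NExp.eval, hn2, ht, hh]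
        refine ⟨by simp [State.writeNat_nat, hn2],
          (hs2.writeNat (by simp) _ _).writeNat (by simp) _ _, ?_⟩
        have := hl2.relax (e := ⟨n, hn⟩) hb
        simpa [State.writeNat_nat] using this
      · intro hb
        simp only [Test.Holds, NExp.eval, hn2, ht, hh] at hb
        refine Runs.skip ⟨hn2, hs2.writeNat (by simp) _ _, ?_⟩
        have := hl2.keep (e := ⟨n, hn⟩) hb
        simpa [State.writeNat_nat] using this
    · exact ⟨(SameExcept.refl _ _ _).writeNat (by simp) _ _, by simpa [State.writeNat_nat] using hl1⟩
    · rintro s2 ⟨hs2, hl2⟩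
      refine ⟨by rw [hs2.nat 11 (by simp), hr1],
        (hs1.trans (hs2.mono (by simp) (by simp))).writeNat (by simp) _ _, ?_⟩
      simpa [State.writeNat_nat] using hl2.next
  · refine ⟨(SameExcept.refl _ _ _).writeNat (by simp) _ _, ?_⟩
    simpa [State.writeNat_nat, h0] using MultiDigraph.LevelInv.zero N.acyclic
  · rintro s1 ⟨hs1, hl1⟩
    exact ⟨hs1, hl1.eq_level⟩

theorem order_runs (hin : HasInput N q ω A s) (hm : 0 < N.graph.numEdges)
    (hl : ∀ v : Fin N.graph.numNodes, s.nat 12 v = MultiDigraph.level N.acyclic v)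
    (h0 : s.nat 14 0 = 0) :
    Runs O order s (N.graph.numEdges * (N.graph.numEdges * 5 + 4) + 2) fun s' =>
      SameExcept [10, 11, 13, 14] [] s s' ∧
      ∃ o, N.graph.IsTopOrder o ∧ ∀ j < N.graph.numEdges, s'.nat 13 j = o j := by
  set m := N.graph.numEdges with hm'
  refine (Runs.forLoop m (tb := m * 5 + 2) (fun r s' =>
    SameExcept [10, 11, 13, 14] [] s s' ∧
      MultiDigraph.OrderInv N.acyclic (s'.nat 13) (s'.nat 14 0) (r * m))
    ?_ ?_ ?_).mono le_rfl ?_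
  · rintro r s1 ⟨hs1, -⟩
    exact (hin.of_same hs1 (by simp) (by simp)).numEdges
  · rintro r s1 hr hr1 ⟨hs1, hl1⟩
    refine (Runs.forLoop m (tb := 3) (fun n s' =>
      SameExcept [10, 13, 14] [] s1 s' ∧
        MultiDigraph.OrderInv N.acyclic (s'.nat 13) (s'.nat 14 0) (r * m + n))
      ?_ ?_ ?_).mono le_rfl ?_
    · rintro n s2 ⟨hs2, -⟩
      exact ((hin.of_same hs1 (by simp) (by simp)).of_same hs2 (by simp) (by simp)).numEdges
    · rintro n s2 hn hn2 ⟨hs2, hl2⟩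
      have hin2 := (hin.of_same hs1 (by simp) (by simp)).of_same hs2 (by simp) (by simp)
      have ht := hin2.tail ⟨n, hn⟩
      have hr2 : s2.nat 11 0 = r := by rw [hs2.nat 11 (by simp), hr1]
      have hlv : s2.nat 12 (N.graph.tail ⟨n, hn⟩) =
          MultiDigraph.level N.acyclic (N.graph.tail ⟨n, hn⟩) := by
        rw [hs2.nat 12 (by simp), hs1.nat 12 (by simp), hl]
      apply Runs.ite
      · intro hb
        simp only [Test.Holds, NExp.eval, hn2, ht, hr2, hlv] at hb
        apply Runs.setNat_seq
        apply Runs.setNat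
        simp only [NExp.eval, hn2]
        refine ⟨by simp [State.writeNat_nat, hn2],
          ((hs2.writeNat (by simp) _ _).writeNat (by simp) _ _).writeNat (by simp) _ _, ?_⟩
        have := hl2.push (e := ⟨n, hn⟩) (by omega)
        simpa [State.writeNat_nat] using this
      · intro hb
        simp only [Test.Holds, NExp.eval, hn2, ht, hr2, hlv] at hb
        refine Runs.skip ⟨hn2, hs2.writeNat (by simp) _ _, ?_⟩
        have := hl2.skip (e := ⟨n, hn⟩) (by omega)
        simpa [State.writeNat_nat] using this
    · exact ⟨(SameExcept.refl _ _ _).writeNat (by simp) _ _, by simpa [State.writeNat_nat] using hl1⟩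
    · rintro s2 ⟨hs2, hl2⟩
      refine ⟨by rw [hs2.nat 11 (by simp), hr1],
        (hs1.trans (hs2.mono (by simp) (by simp))).writeNat (by simp) _ _, ?_⟩
      rw [add_mul, one_mul]
      simpa [State.writeNat_nat] using hl2
  · refine ⟨(SameExcept.refl _ _ _).writeNat (by simp) _ _, ?_⟩
    have := MultiDigraph.OrderInv.zero N.acyclic (s.nat 13)
    simpa [State.writeNat_nat, h0] using this
  · rintro s1 ⟨hs1, hl1⟩
    exact ⟨hs1, hl1.exists_topOrder hm⟩

theorem lengths_runs (hin : HasInput N q ω A s) :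
    Runs O lengths s (N.graph.numEdges * 3 + 2) fun s' =>
      SameExcept [10] [10] s s' ∧
      ∀ e : Fin N.graph.numEdges, s'.real 10 e = 1 / N.cap e := by
  refine (Runs.forLoop N.graph.numEdges (tb := 1) (fun n s' =>
    SameExcept [10] [10] s s' ∧
      ∀ e : Fin N.graph.numEdges, (e : ℕ) < n → s'.real 10 e = 1 / N.cap e)
    ?_ ?_ ?_).mono le_rfl ?_
  · rintro r s1 ⟨hs1, -⟩
    exact (hin.of_same hs1 (by simp) (by simp)).numEdges
  · rintro n s1 hn hn1 ⟨hs1, hl1⟩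
    have hin1 := hin.of_same hs1 (by simp) (by simp)
    have hc := hin1.cap ⟨n, hn⟩
    apply Runs.setReal
    simp only [NExp.eval, RExp.eval, hn1, hc]
    refine ⟨by simp [State.writeReal_nat, hn1],
      (hs1.writeReal (by simp) _ _).writeNat (by simp) _ _, ?_⟩
    intro e he
    rw [State.writeNat_real, State.writeReal_real, if_pos rfl]
    rcases Nat.lt_succ_iff_lt_or_eq.1 he with he | he
    · rw [Function.update_of_ne he.ne, hl1 e he]
    · have : e = ⟨n, hn⟩ := Fin.ext he
      subst this
      simp
  · exact ⟨(SameExcept.refl _ _ _).writeNat (by simp) _ _, by simp⟩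
  · rintro s1 ⟨hs1, hl1⟩
    exact ⟨hs1, fun e => hl1 e e.2⟩

/-- The instance of the Steiner tree problem for message `i` and given edge lengths. -/
def steinerInstance (N : Network) (l : Fin N.graph.numEdges → ℝ) (i : Fin N.numMessages) :
    SteinerInstance N.graph where
  len := l
  source := N.source i
  terminals := N.receivers i

theorem query_encodes (hin : HasInput N q ω A s) {c : ℕ} {i : Fin N.numMessages}
    (hc : s.nat c 0 = i) {l : Fin N.graph.numEdges → ℝ} (hl : ∀ e : Fin _, s.real 10 e = l e) :
    (query c).Encodes s N.graph (steinerInstance N l i) where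
  numNodes := hin.numNodes
  numEdges := hin.numEdges
  tail := hin.tail
  head := hin.head
  len := hl
  source := by simpa [query, NExp.eval, hc, steinerInstance] using hin.source i
  terminals v := by simpa [query, NExp.eval, hc, steinerInstance] using hin.terminals i v

/-- The oracle is good and fast on the graph of the network. -/
structure GoodOracle (O : SteinerOracle) (N : Network) (A : ℝ) (T : ℕ) : Prop where
  guarantee : O.HasGuarantee N.graph A
  time_le : ∀ I : SteinerInstance N.graph, I.Valid → O.time N.graph I ≤ T

theorem call_runs {T : ℕ} (hO : GoodOracle O N A T) (hin : HasInput N q ω A s) {c : ℕ}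
    {i : Fin N.numMessages}
    (hc : s.nat c 0 = i) {l : Fin N.graph.numEdges → ℝ} (hl : ∀ e : Fin _, s.real 10 e = l e)
    (hpos : ∀ e, 0 < l e) :
    Runs O (.call (query c)) s (T + 1) fun s' => SameExcept [15] [] s s' ∧
      ∃ F ∈ N.connecting i, ∑ e ∈ F, l e ≤ A * N.minCost i l ∧
        ∀ e : Fin N.graph.numEdges, s'.nat 15 e = if e ∈ F then 1 else 0 := by
  have hv : (steinerInstance N l i).Valid := ⟨N.acyclic, hpos, N.reachable i⟩
  obtain ⟨h1, h2⟩ := hO.guarantee _ hv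
  refine ⟨_, _, .call (query_encodes hin hc hl), Nat.add_le_add_right (hO.time_le _ hv) 1,
    (SameExcept.refl _ _ _).writeEdges (by simp [query]) _,
    O.answer N.graph (steinerInstance N l i), N.mem_connecting.2 h1, ?_, ?_⟩
  · exact Network.le_mul_minCost fun F hF => h2 F (N.mem_connecting.1 hF)
  · intro e
    simp [State.writeEdges, query]

/-- The raw oracle answers suffice for the cost estimate; passing to trees inside them, which cannot
cost more, is left to the analysis. -/
theorem estimate_runs {T : ℕ} (hO : GoodOracle O N A T) (hin : HasInput N q ω A s)
    {l : Fin N.graph.numEdges → ℝ} (hl : ∀ e : Fin _, s.real 10 e = l e)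
    (hpos : ∀ e, 0 < l e) (h0 : s.real 12 0 = 0) :
    Runs O estimate s (N.numMessages * (T + N.graph.numEdges * 4 + 5) + 2) fun s' =>
      SameExcept [10, 11, 15] [12] s s' ∧
      ∃ F : Fin N.numMessages → Finset (Fin N.graph.numEdges),
        (∀ i, F i ∈ N.connecting i ∧ ∑ e ∈ F i, l e ≤ A * N.minCost i l) ∧
        s'.real 12 0 = ∑ i, q i * ∑ e ∈ F i, l e := by
  refine (Runs.forLoop N.numMessages (tb := T + N.graph.numEdges * 4 + 3) (fun r s' =>
    SameExcept [10, 11, 15] [12] s s' ∧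
      ∃ F : Fin N.numMessages → Finset (Fin N.graph.numEdges),
        (∀ i : Fin N.numMessages, (i : ℕ) < r → F i ∈ N.connecting i ∧ ∑ e ∈ F i, l e ≤ A * N.minCost i l) ∧
        s'.real 12 0 = ∑ i : Fin N.numMessages, if (i : ℕ) < r then q i * ∑ e ∈ F i, l e else 0)
    ?_ ?_ ?_).mono le_rfl ?_
  · rintro r s1 ⟨hs1, -⟩
    exact (hin.of_same hs1 (by simp) (by simp)).numMessages
  · rintro r s1 hr hr1 ⟨hs1, F, hF, ha⟩
    have hin1 := hin.of_same hs1 (by simp) (by simp)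
    have hl1 : ∀ e : Fin N.graph.numEdges, s1.real 10 e = l e := by
      intro e; rw [hs1.real 10 (by simp), hl]
    refine (Runs.seq (call_runs hO hin1 (i := ⟨r, hr⟩) hr1 hl1 hpos)
      (t₂ := N.graph.numEdges * 4 + 2) ?_).mono (by omega) fun _ h => h
    rintro s2 ⟨hs2, F', hF', hcost, hans⟩
    have hin2 := hin1.of_same hs2 (by simp) (by simp)
    refine (Runs.forLoop N.graph.numEdges (tb := 2) (fun n s' =>
      SameExcept [10] [12] s2 s' ∧
        s'.real 12 0 = s2.real 12 0 +
          ∑ e ∈ F', if (e : ℕ) < n then q ⟨r, hr⟩ * l e else 0)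
      ?_ ?_ ?_).mono le_rfl ?_
    · rintro n s3 ⟨hs3, -⟩
      exact (hin2.of_same hs3 (by simp) (by simp)).numEdges
    · rintro n s3 hn hn3 ⟨hs3, ha3⟩
      have hin3 := hin2.of_same hs3 (by simp) (by simp)
      have hans3 : s3.nat 15 n = if (⟨n, hn⟩ : Fin _) ∈ F' then 1 else 0 := by
        rw [hs3.nat 15 (by simp)]; exact hans ⟨n, hn⟩
      have hr3 : s3.nat 11 0 = r := by rw [hs3.nat 11 (by simp), hs2.nat 11 (by simp), hr1]
      have hl3 : s3.real 10 n = l ⟨n, hn⟩ := by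
        rw [hs3.real 10 (by simp), hs2.real 10 (by simp)]; exact hl1 ⟨n, hn⟩
      have hq3 : s3.real 1 r = q ⟨r, hr⟩ := hin3.demand ⟨r, hr⟩
      have hsum : (∑ e ∈ F', if (e : ℕ) < n + 1 then q ⟨r, hr⟩ * l e else 0) =
          (∑ e ∈ F', if (e : ℕ) < n then q ⟨r, hr⟩ * l e else 0) +
            if (⟨n, hn⟩ : Fin _) ∈ F' then q ⟨r, hr⟩ * l ⟨n, hn⟩ else 0 := by
        rw [← Finset.sum_ite_eq' F' (⟨n, hn⟩ : Fin N.graph.numEdges) fun e => q ⟨r, hr⟩ * l e,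
          ← Finset.sum_add_distrib]
        refine Finset.sum_congr rfl fun e _ => ?_
        simp only [Fin.ext_iff]
        split_ifs <;> first | omega | simp
      apply Runs.ite
      · intro hb
        simp only [Test.Holds, NExp.eval, hn3, hans3] at hb
        have hmem : (⟨n, hn⟩ : Fin _) ∈ F' := by
          by_contra h; simp [h] at hb
        apply Runs.setReal
        refine ⟨by simp [State.writeReal_nat, hn3],
          (hs3.writeReal (by simp) _ _).writeNat (by simp) _ _, ?_⟩
        rw [hsum, if_pos hmem]
        simp [State.writeNat_real, State.writeReal_real, RExp.eval, NExp.eval, ha3, hr3, hq3, hn3,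
          hl3, add_assoc]
      · intro hb
        simp only [Test.Holds, NExp.eval, hn3, hans3] at hb
        have hmem : (⟨n, hn⟩ : Fin _) ∉ F' := by
          intro h; simp [h] at hb
        refine Runs.skip ⟨hn3, hs3.writeNat (by simp) _ _, ?_⟩
        rw [hsum, if_neg hmem, add_zero]
        exact ha3
    · exact ⟨(SameExcept.refl _ _ _).writeNat (by simp) _ _, by simp [State.writeNat_real]⟩
    · rintro s3 ⟨hs3, ha3⟩
      refine ⟨by rw [hs3.nat 11 (by simp), hs2.nat 11 (by simp), hr1],
        ((hs1.trans (hs2.mono (by simp) (by simp))).trans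
          (hs3.mono (by simp) (by simp))).writeNat (by simp) _ _,
        Function.update F ⟨r, hr⟩ F', ?_, ?_⟩
      · intro i hi
        rcases Nat.lt_succ_iff_lt_or_eq.1 hi with hi | hi
        · rw [Function.update_of_ne (fun h => hi.ne (congrArg Fin.val h))]
          exact hF i hi
        · have : i = ⟨r, hr⟩ := Fin.ext hi
          subst this
          rw [Function.update_self]
          exact ⟨hF', hcost⟩
      · rw [State.writeNat_real, ha3, hs2.real 12 (by simp), ha]
        have h1 : (∑ e ∈ F', if (e : ℕ) < N.graph.numEdges then q ⟨r, hr⟩ * l e else 0) =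
            q ⟨r, hr⟩ * ∑ e ∈ F', l e := by
          rw [Finset.mul_sum]
          exact Finset.sum_congr rfl fun e _ => if_pos e.2
        have h2 : q ⟨r, hr⟩ * ∑ e ∈ F', l e =
            ∑ i : Fin N.numMessages, if i = ⟨r, hr⟩ then q i * ∑ e ∈ F', l e else 0 := by simp
        rw [h1, h2, ← Finset.sum_add_distrib]
        refine Finset.sum_congr rfl fun i _ => ?_
        by_cases hi : i = ⟨r, hr⟩
        · subst hi; simp
        · have hi' : (i : ℕ) ≠ r := fun h => hi (Fin.ext h)
          rw [Function.update_of_ne hi]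
          simp only [hi, if_false, add_zero]
          split_ifs <;> first | rfl | omega
  · refine ⟨(SameExcept.refl _ _ _).writeNat (by simp) _ _, fun _ => ∅, by simp, ?_⟩
    simp [State.writeNat_real, h0]
  · rintro s1 ⟨hs1, F, hF, ha⟩
    exact ⟨hs1, F, fun i => hF i i.2, by rw [ha]; exact Finset.sum_congr rfl fun i _ => if_pos i.2⟩

end Algorithm
end Routing

namespace Routing
namespace Algorithm

/-! ### The main loop -/

/-- Extract a tree from the answer of the oracle, and compute the amount to be routed along it. -/
def extract : Prog :=
  .forLoop 10 (.get 0 (.lit 1))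
    (.ite (.conj (.natLt (.lit 0) (.get 15 (.get 13 (.var 10))))
        (.conj (.natLt (.var 7) (.get 16 (.get 1 (.get 13 (.var 10)))))
          (.neg (.natLt (.var 7) (.get 16 (.get 2 (.get 13 (.var 10))))))))
      (.seq (.setNat 16 (.get 2 (.get 13 (.var 10))) (.add (.var 7) (.lit 1)))
        (.seq (.setNat 9 (.add (.var 21) (.get 13 (.var 10))) (.lit 1))
          (.ite (.realLt (.ofNat (.get 3 (.get 13 (.var 10)))) (.var 18))
            (.setReal 18 (.lit 0) (.ofNat (.get 3 (.get 13 (.var 10)))))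
            .skip)))
      .skip)

/-- Route flow along the new tree. -/
def update : Prog :=
  .forLoop 10 (.get 0 (.lit 1))
    (.ite (.natLt (.lit 0) (.get 9 (.add (.var 21) (.var 10))))
      (.seq (.setReal 10 (.var 10) (.mul (.get 10 (.var 10)) (.add (.ofNat (.lit 1))
          (.div (.mul (.var 16) (.var 18)) (.ofNat (.get 3 (.var 10)))))))
        (.seq (.setReal 11 (.var 10) (.add (.get 11 (.var 10)) (.var 18)))
          (.ite (.realLt (.get 11 (.var 10)) (.mul (.var 17) (.ofNat (.get 3 (.var 10)))))
            .skip
            (.setNat 20 (.lit 0) (.lit 1)))))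
      .skip)

/-- Ask for a tree for the current message and route flow along it. -/
def augment : Prog :=
  .seq (.call (query 17))
  (.seq (.setNat 16 (.get 4 (.var 17)) (.add (.var 7) (.lit 1)))
  (.seq (.setReal 18 (.lit 0) (.var 15))
  (.seq extract
  (.seq update
  (.seq (.setNat 8 (.var 7) (.var 17))
  (.seq (.setReal 3 (.var 7) (.div (.var 18) (.add (.var 17) (.ofNat (.lit 1)))))
  (.seq (.setNat 21 (.lit 0) (.add (.var 21) (.get 0 (.lit 1))))
  (.seq (.setNat 7 (.lit 0) (.add (.var 7) (.lit 1)))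
  (.setReal 15 (.lit 0) (.sub (.var 15) (.var 18)))))))))))

/-- The growth rate of the demands. -/
def etaExp : RExp :=
  .div (.ofNat (.lit 1))
    (.mul (.mul (.ofNat (.lit 2)) (.add (.var 17) (.ofNat (.lit 1)))) (.get 0 (.lit 1)))

/-- Go on to the next message. -/
def switch : Prog :=
  .seq (.ite (.natLt (.add (.var 17) (.lit 1)) (.get 0 (.lit 2)))
      (.setNat 17 (.lit 0) (.add (.var 17) (.lit 1)))
      (.seq (.setReal 14 (.lit 0) (.mul (.var 14) (.add (.ofNat (.lit 1)) etaExp)))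
        (.setNat 17 (.lit 0) (.lit 0))))
    (.setReal 15 (.lit 0) (.mul (.mul etaExp (.var 14)) (.get 1 (.var 17))))

/-- One step of the algorithm. -/
def body : Prog := .ite (.realLt (.ofNat (.lit 0)) (.var 15)) augment switch

variable {N : Network} {q : Fin N.numMessages → ℝ} {ω A : ℝ} {O : SteinerOracle} {s : State}

/-- The memory holds the state of the algorithm. -/
structure Rep (P : Network.Params N q) (ω : ℝ) (ord : ℕ → Fin N.graph.numEdges) (s : State)
    (st : Network.FlowState N) : Prop where
  input : HasInput N q ω P.A s
  ord_eq : ∀ j < N.graph.numEdges, s.nat 13 j = ord j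
  eps : s.real 16 0 = P.eps
  L : s.real 17 0 = P.L
  W₀ : s.real 13 0 = P.W₀
  len : ∀ e : Fin N.graph.numEdges, s.real 10 e = st.len e
  flow : ∀ e : Fin N.graph.numEdges, s.real 11 e = st.flow e
  W : s.real 14 0 = st.W
  rem : s.real 15 0 = st.rem
  i : s.nat 17 0 = st.i
  offset : s.nat 21 0 = s.nat 7 0 * N.graph.numEdges
  stamp : ∀ v, s.nat 16 v ≤ s.nat 7 0
  fresh : ∀ c, s.nat 21 0 ≤ c → s.nat 9 c = 0
  x : ∀ i F, N.outputVector s i F = st.x i F / (P.L + 1)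
  flag : s.nat 20 0 < 1 ↔ st.Active P.L

theorem outputVector_congr {s s' : State} (h7 : s'.nat 7 0 = s.nat 7 0) (h8 : s'.nat 8 = s.nat 8)
    (h9 : s'.nat 9 = s.nat 9) (h3 : s'.real 3 = s.real 3) :
    N.outputVector s' = N.outputVector s := by
  funext i F
  have ht : ∀ p, N.outputTree s' p = N.outputTree s p := by
    intro p; simp only [Network.outputTree, h9]
  simp only [Network.outputVector, ht, h7, h8, h3]

theorem etaExp_eval {P : Network.Params N q} (hL : s.real 17 0 = P.L) (hA : s.real 0 1 = P.A) :
    etaExp.eval s = P.eta := by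
  simp [etaExp, RExp.eval, NExp.eval, hL, hA, Network.Params.eta]

theorem switch_runs {P : Network.Params N q} {ord : ℕ → Fin N.graph.numEdges}
    {st : Network.FlowState N} (h : Rep P ω ord s st) :
    Runs O switch s 4 fun s' => Rep P ω ord s' (st.switch q P.eta) := by
  have hL := P.L_pos
  -- Both branches change only the current message, the scale and the remainder; the other clauses
  -- are checked once for both.
  have key : ∀ s' : State, SameExcept [17] [14, 15] s s' → s'.nat 17 0 = (st.switch q P.eta).i →
      s'.real 14 0 = (st.switch q P.eta).W → s'.real 15 0 = (st.switch q P.eta).rem →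
      Rep P ω ord s' (st.switch q P.eta) := by
    intro s' hs hi hW hr
    have hlen : (st.switch q P.eta).len = st.len := by
      unfold Network.FlowState.switch; split_ifs <;> rfl
    have hflow : (st.switch q P.eta).flow = st.flow := by
      unfold Network.FlowState.switch; split_ifs <;> rfl
    have hx : (st.switch q P.eta).x = st.x := by
      unfold Network.FlowState.switch; split_ifs <;> rfl
    refine ⟨h.input.of_same hs (by simp) (by simp), ?_, ?_, ?_, ?_, ?_, ?_, hW, hr, hi,
      ?_, ?_, ?_, ?_, ?_⟩
    · rw [hs.nat 13 (by simp)]; exact h.ord_eq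
    · rw [hs.real 16 (by simp)]; exact h.eps
    · rw [hs.real 17 (by simp)]; exact h.L
    · rw [hs.real 13 (by simp)]; exact h.W₀
    · rw [hs.real 10 (by simp), hlen]; exact h.len
    · rw [hs.real 11 (by simp), hflow]; exact h.flow
    · rw [hs.nat 21 (by simp), hs.nat 7 (by simp)]; exact h.offset
    · rw [hs.nat 16 (by simp), hs.nat 7 (by simp)]; exact h.stamp
    · rw [hs.nat 21 (by simp), hs.nat 9 (by simp)]; exact h.fresh
    · rw [outputVector_congr (by rw [hs.nat 7 (by simp)]) (hs.nat 8 (by simp)) (hs.nat 9 (by simp))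
        (hs.real 3 (by simp)), hx]
      exact h.x
    · rw [hs.nat 20 (by simp), Network.FlowState.Active, hflow]; exact h.flag
  have heta : etaExp.eval s = P.eta := etaExp_eval h.L h.input.guarantee
  refine (Runs.seq (t₂ := 1) (R := fun s' => SameExcept [17] [14, 15] s s' ∧
    s'.nat 17 0 = (st.switch q P.eta).i ∧ s'.real 14 0 = (st.switch q P.eta).W) ?_ ?_).mono
    le_rfl fun _ h => h
  · apply Runs.ite (t := 2)
    · intro hb
      simp only [Test.Holds, NExp.eval, h.i, h.input.numMessages] at hb
      apply Runs.setNat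
      refine ⟨(SameExcept.refl _ _ _).writeNat (by simp) _ _, ?_, ?_⟩
      · simp [State.writeNat_nat, NExp.eval, h.i, Network.FlowState.switch, hb]
      · simp [State.writeNat_real, Network.FlowState.switch, hb, h.W]
    · intro hb
      simp only [Test.Holds, NExp.eval, h.i, h.input.numMessages] at hb
      apply Runs.setReal_seq
      apply Runs.setNat
      refine ⟨((SameExcept.refl _ _ _).writeReal (by simp) _ _).writeNat (by simp) _ _, ?_, ?_⟩
      · simp [State.writeNat_nat, NExp.eval, Network.FlowState.switch, hb]
      · simp [State.writeNat_real, State.writeReal_real, Network.FlowState.switch, hb, h.W,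
          RExp.eval, NExp.eval, heta]
  · rintro s1 ⟨hs1, hi1, hW1⟩
    apply Runs.setReal
    have heta1 : etaExp.eval s1 = P.eta :=
      etaExp_eval (by rw [hs1.real 17 (by simp), h.L]) (by rw [hs1.real 0 (by simp),
        h.input.guarantee])
    have hq : s1.real 1 (st.switch q P.eta).i = q (st.switch q P.eta).i := by
      rw [hs1.real 1 (by simp)]; exact h.input.demand _
    refine key _ (hs1.writeReal (by simp) _ _) hi1 ?_ ?_
    · simp [State.writeReal_real, hW1]
    · simp only [State.writeReal_real, if_true, RExp.eval, NExp.eval, Function.update_self, heta1,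
        hW1, hi1, hq]
      unfold Network.FlowState.switch
      split_ifs <;> rfl

/-- The amount `u` that can be routed along a set of edges, when `r` remains to be routed. -/
structure Amount (N : Network) (r : ℝ) (K : Finset (Fin N.graph.numEdges)) (u : ℝ) : Prop where
  pos : 0 < u
  le : u ≤ r
  le_cap : ∀ e ∈ K, u ≤ N.cap e
  eq : u = r ∨ ∃ e ∈ K, u = N.cap e

theorem Amount.insert {r u : ℝ} {K : Finset (Fin N.graph.numEdges)} (h : Amount N r K u)
    (e : Fin N.graph.numEdges) : Amount N r (insert e K) (min u (N.cap e)) := by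
  refine ⟨lt_min h.pos (Network.cap_pos' e), (min_le_left _ _).trans h.le, ?_, ?_⟩
  · intro e' he'
    rcases Finset.mem_insert.1 he' with rfl | he'
    · exact min_le_right _ _
    · exact (min_le_left _ _).trans (h.le_cap e' he')
  · rcases min_choice u (N.cap e) with h1 | h1
    · rw [h1]
      rcases h.eq with h2 | ⟨e', he', h2⟩
      · exact .inl h2
      · exact .inr ⟨e', Finset.mem_insert_of_mem he', h2⟩
    · exact .inr ⟨e, Finset.mem_insert_self _ _, h1⟩

/-- What is known in the course of the extraction of a tree, when `V` are the nodes reached and `K`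
the edges kept. -/
structure ExtractInv (r : ℝ) (s₀ s : State) (V : Finset (Fin N.graph.numNodes))
    (K : Finset (Fin N.graph.numEdges)) : Prop where
  same : SameExcept [9, 10, 16] [18] s₀ s
  stamp : ∀ v : Fin N.graph.numNodes, s.nat 7 0 < s.nat 16 v ↔ v ∈ V
  stamp_le : ∀ v, s.nat 16 v ≤ s.nat 7 0 + 1
  old : ∀ c, c < s.nat 21 0 → s.nat 9 c = s₀.nat 9 c
  new : ∀ e : Fin N.graph.numEdges, s.nat 9 (s.nat 21 0 + e) = if e ∈ K then 1 else 0
  fresh : ∀ c, s.nat 21 0 + N.graph.numEdges ≤ c → s.nat 9 c = 0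
  amount : Amount N r K (s.real 18 0)

theorem ExtractInv.writeNat {r : ℝ} {s₀ s : State} {V : Finset (Fin N.graph.numNodes)}
    {K : Finset (Fin N.graph.numEdges)} (h : ExtractInv r s₀ s V K) (x : ℕ) :
    ExtractInv r s₀ (s.writeNat 10 0 x) V K := by
  constructor
  · exact h.same.writeNat (by simp) _ _
  · simpa [State.writeNat_nat] using h.stamp
  · simpa [State.writeNat_nat] using h.stamp_le
  · simpa [State.writeNat_nat] using h.old
  · simpa [State.writeNat_nat] using h.new
  · simpa [State.writeNat_nat] using h.fresh
  · simpa [State.writeNat_real] using h.amount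

/-- A node belongs to the current tree exactly if its stamp exceeds the number of finished trees.
Stamps of earlier trees are automatically stale, so nothing is cleared and the cost does not depend
on the number of nodes. -/
theorem extract_runs {ord : ℕ → Fin N.graph.numEdges} (hin : HasInput N q ω A s)
    (hord : ∀ j < N.graph.numEdges, s.nat 13 j = ord j) {F : Finset (Fin N.graph.numEdges)}
    (hans : ∀ e : Fin N.graph.numEdges, s.nat 15 e = if e ∈ F then 1 else 0)
    {r : ℝ} {v : Fin N.graph.numNodes} (h0 : ExtractInv (N := N) r s s {v} ∅) :
    Runs O extract s (N.graph.numEdges * 7 + 2) fun s' =>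
      ExtractInv r s s' (MultiDigraph.scan ord v F N.graph.numEdges).1
        (MultiDigraph.scan ord v F N.graph.numEdges).2 := by
  refine (Runs.forLoop N.graph.numEdges (tb := 5) (fun n s' => ExtractInv r s s'
    (MultiDigraph.scan ord v F n).1 (MultiDigraph.scan ord v F n).2) ?_ ?_ ?_).mono le_rfl
      fun _ h => h
  · intro n s1 h1
    exact (hin.of_same h1.same (by simp) (by simp)).numEdges
  · intro n s1 hn hn1 h1
    have hin1 := hin.of_same h1.same (by simp) (by simp)
    have ho : s1.nat 13 n = ord n := by rw [h1.same.nat 13 (by simp), hord n hn]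
    have hans1 : s1.nat 15 (ord n) = if ord n ∈ F then 1 else 0 := by
      rw [h1.same.nat 15 (by simp), hans]
    have ht := hin1.tail (ord n)
    have hh := hin1.head (ord n)
    have hc := hin1.cap (ord n)
    have hiff : (Test.conj (.natLt (.lit 0) (.get 15 (.get 13 (.var 10))))
        (.conj (.natLt (.var 7) (.get 16 (.get 1 (.get 13 (.var 10)))))
          (.neg (.natLt (.var 7) (.get 16 (.get 2 (.get 13 (.var 10)))))))).Holds s1 ↔
        ord n ∈ F ∧ N.graph.tail (ord n) ∈ (MultiDigraph.scan ord v F n).1 ∧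
          N.graph.head (ord n) ∉ (MultiDigraph.scan ord v F n).1 := by
      simp only [Test.Holds, NExp.eval, hn1, ho, hans1, ht, hh, h1.stamp]
      refine and_congr ?_ Iff.rfl
      split_ifs <;> simp [*]
    apply Runs.ite
    · intro hb
      rw [hiff] at hb
      apply Runs.setNat_seq
      apply Runs.setNat_seq
      simp only [NExp.eval, hn1, ho, hh]
      set s2 := (s1.writeNat 16 (N.graph.head (ord n)) (s1.nat 7 0 + 1)) with hs2
      have hs2n : s2.nat 10 = s1.nat 10 ∧ s2.nat 13 = s1.nat 13 ∧ s2.nat 21 = s1.nat 21 := by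
        simp [hs2, State.writeNat_nat]
      simp only [hs2n, hn1, ho]
      set s3 := (s2.writeNat 9 (s1.nat 21 0 + ord n) 1) with hs3
      have hs3n : s3.nat 10 = s1.nat 10 ∧ s3.nat 13 = s1.nat 13 ∧ s3.nat 3 = s1.nat 3 ∧
          s3.nat 7 = s1.nat 7 ∧ s3.nat 21 = s1.nat 21 := by
        simp [hs3, hs2, State.writeNat_nat]
      have hs3r : s3.real = s1.real := rfl
      have h16 : s3.nat 16 = Function.update (s1.nat 16) (N.graph.head (ord n)) (s1.nat 7 0 + 1) := by
        simp [hs3, hs2, State.writeNat_nat]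
      have h9 : s3.nat 9 = Function.update (s1.nat 9) (s1.nat 21 0 + ord n) 1 := by
        simp [hs3, hs2, State.writeNat_nat]
      have hscan : MultiDigraph.scan ord v F (n + 1) =
          (insert (N.graph.head (ord n)) (MultiDigraph.scan ord v F n).1,
            insert (ord n) (MultiDigraph.scan ord v F n).2) := by
        rw [MultiDigraph.scan, if_pos hb]
      rw [hscan]
      have key : ∀ s4 : State, s4.nat = s3.nat → SameExcept [9, 10, 16] [18] s s4 →
          s4.real 18 0 = min (s1.real 18 0) (N.cap (ord n)) →
          s4.nat 10 0 = n ∧ ExtractInv r s (s4.writeNat 10 0 (n + 1))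
            (insert (N.graph.head (ord n)) (MultiDigraph.scan ord v F n).1)
            (insert (ord n) (MultiDigraph.scan ord v F n).2) := by
        intro s4 h4 hsame h18
        refine ⟨by rw [h4, hs3n.1, hn1], ExtractInv.writeNat ?_ _⟩
        constructor
        · exact hsame
        · intro w
          rw [h4, hs3n.2.2.2.1, h16, Finset.mem_insert, ← h1.stamp]
          by_cases hw : w = N.graph.head (ord n)
          · subst hw; simp
          · rw [Function.update_of_ne (fun h => hw (Fin.ext h))]
            simp [hw]
        · intro w
          rw [h4, hs3n.2.2.2.1, h16]
          by_cases hw : w = N.graph.head (ord n)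
          · subst hw; simp
          · rw [Function.update_of_ne hw]
            exact h1.stamp_le w
        · intro c
          rw [h4, hs3n.2.2.2.2, h9]
          intro hc
          rw [Function.update_of_ne (by omega)]
          exact h1.old c hc
        · intro e
          rw [h4, hs3n.2.2.2.2, h9]
          by_cases he : e = ord n
          · subst he; simp
          · have : (e : ℕ) ≠ ord n := fun h => he (Fin.ext h)
            rw [Function.update_of_ne (by omega), h1.new]
            simp [he]
        · intro c
          rw [h4, hs3n.2.2.2.2, h9]
          intro hc
          have := (ord n).2
          rw [Function.update_of_ne (by omega)]
          exact h1.fresh c hc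
        · rw [h18]; exact h1.amount.insert _
      have hsame3 : SameExcept [9, 10, 16] [18] s s3 :=
        (h1.same.writeNat (by simp) _ _).writeNat (by simp) _ _
      apply Runs.ite (t := 1)
      · intro hb'
        simp only [Test.Holds, RExp.eval, NExp.eval, hs3n, hn1, ho, hc, hs3r] at hb'
        apply Runs.setReal
        refine key _ rfl (hsame3.writeReal (by simp) _ _) ?_
        simp [State.writeReal_real, RExp.eval, NExp.eval, hs3n, hn1, ho, hc, min_eq_right hb'.le]
      · intro hb'
        simp only [Test.Holds, RExp.eval, NExp.eval, hs3n, hn1, ho, hc, hs3r, not_lt] at hb'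
        exact Runs.skip (key _ rfl hsame3 (by rw [hs3r, min_eq_left hb']))
    · intro hb
      rw [hiff] at hb
      refine Runs.skip ⟨hn1, ?_⟩
      rw [MultiDigraph.scan, if_neg hb]
      exact h1.writeNat _
  · exact h0.writeNat _

theorem update_runs {K : Finset (Fin N.graph.numEdges)} {st : Network.FlowState N} {eps L u : ℝ}
    (hin : HasInput N q ω A s) (heps : s.real 16 0 = eps) (hL : s.real 17 0 = L)
    (hu : s.real 18 0 = u) (hlen : ∀ e : Fin N.graph.numEdges, s.real 10 e = st.len e)
    (hflow : ∀ e : Fin N.graph.numEdges, s.real 11 e = st.flow e)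
    (hK : ∀ e : Fin N.graph.numEdges, s.nat 9 (s.nat 21 0 + e) = if e ∈ K then 1 else 0)
    (hflag : s.nat 20 0 < 1) (hact : st.Active L) :
    Runs O update s (N.graph.numEdges * 7 + 2) fun s' =>
      SameExcept [10, 20] [10, 11] s s' ∧
      (∀ e : Fin N.graph.numEdges, s'.real 10 e = (st.augment eps K u).len e) ∧
      (∀ e : Fin N.graph.numEdges, s'.real 11 e = (st.augment eps K u).flow e) ∧
      (s'.nat 20 0 < 1 ↔ (st.augment eps K u).Active L) := by
  refine (Runs.forLoop N.graph.numEdges (tb := 5) (fun n s' =>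
    SameExcept [10, 20] [10, 11] s s' ∧
      (∀ e : Fin N.graph.numEdges, s'.real 10 e =
        if (e : ℕ) < n then (st.augment eps K u).len e else st.len e) ∧
      (∀ e : Fin N.graph.numEdges, s'.real 11 e =
        if (e : ℕ) < n then (st.augment eps K u).flow e else st.flow e) ∧
      (s'.nat 20 0 < 1 ↔ ∀ e : Fin N.graph.numEdges, (e : ℕ) < n →
        (st.augment eps K u).flow e < L * N.cap e)) ?_ ?_ ?_).mono le_rfl ?_
  · rintro n s1 ⟨hs1, -⟩
    exact (hin.of_same hs1 (by simp) (by simp)).numEdges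
  · rintro n s1 hn hn1 ⟨hs1, hl1, hf1, hflag1⟩
    have hin1 := hin.of_same hs1 (by simp) (by simp)
    have hK1 : s1.nat 9 (s1.nat 21 0 + n) = if (⟨n, hn⟩ : Fin _) ∈ K then 1 else 0 := by
      rw [hs1.nat 9 (by simp), hs1.nat 21 (by simp)]; exact hK ⟨n, hn⟩
    have hc : s1.nat 3 n = N.cap ⟨n, hn⟩ := hin1.cap ⟨n, hn⟩
    have heps1 : s1.real 16 0 = eps := by rw [hs1.real 16 (by simp), heps]
    have hL1 : s1.real 17 0 = L := by rw [hs1.real 17 (by simp), hL]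
    have hu1 : s1.real 18 0 = u := by rw [hs1.real 18 (by simp), hu]
    have hl1n : s1.real 10 n = st.len ⟨n, hn⟩ := by simpa using hl1 ⟨n, hn⟩
    have hf1n : s1.real 11 n = st.flow ⟨n, hn⟩ := by simpa using hf1 ⟨n, hn⟩
    have hlt : ∀ e : Fin N.graph.numEdges, (e : ℕ) < n + 1 ↔ (e : ℕ) < n ∨ e = ⟨n, hn⟩ := by
      intro e; rw [Nat.lt_succ_iff_lt_or_eq, Fin.ext_iff]
    have hall : (∀ e : Fin N.graph.numEdges, (e : ℕ) < n + 1 →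
        (st.augment eps K u).flow e < L * N.cap e) ↔
        s1.nat 20 0 < 1 ∧ (st.augment eps K u).flow ⟨n, hn⟩ < L * N.cap ⟨n, hn⟩ := by
      rw [hflag1]
      constructor
      · exact fun h => ⟨fun e he => h e (by omega), h ⟨n, hn⟩ (Nat.lt_succ_self n)⟩
      · rintro ⟨h1, h2⟩ e he
        rcases (hlt e).1 he with he | rfl
        · exact h1 e he
        · exact h2
    apply Runs.ite
    · intro hb
      simp only [Test.Holds, NExp.eval, hn1, hK1] at hb
      have hmem : (⟨n, hn⟩ : Fin _) ∈ K := by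
        by_contra h; simp [h] at hb
      apply Runs.setReal_seq
      apply Runs.setReal_seq
      simp only [RExp.eval, NExp.eval, hn1, heps1, hu1, hl1n, hc, Nat.cast_one]
      set s2 := s1.writeReal 10 n (st.len ⟨n, hn⟩ * (1 + eps * u / N.cap ⟨n, hn⟩)) with hs2
      have hs2r : s2.real 11 = s1.real 11 ∧ s2.real 18 = s1.real 18 := by
        simp [hs2, State.writeReal_real]
      have hs2n : s2.nat = s1.nat := rfl
      simp only [hs2r, hs2n, hn1, hf1n, hu1]
      set s3 := s2.writeReal 11 n (st.flow ⟨n, hn⟩ + u) with hs3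
      have hs3n : s3.nat = s1.nat := rfl
      have hs3r : s3.real 17 = s1.real 17 := by
        simp [hs3, hs2, State.writeReal_real]
      have h10 : s3.real 10 = Function.update (s1.real 10) n
          (st.len ⟨n, hn⟩ * (1 + eps * u / N.cap ⟨n, hn⟩)) := by
        simp [hs3, hs2, State.writeReal_real]
      have h11 : s3.real 11 = Function.update (s1.real 11) n (st.flow ⟨n, hn⟩ + u) := by
        simp [hs3, hs2, State.writeReal_real]
      have hsame3 : SameExcept [10, 20] [10, 11] s s3 :=
        (hs1.writeReal (by simp) _ _).writeReal (by simp) _ _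
      have hfn : (st.augment eps K u).flow ⟨n, hn⟩ = st.flow ⟨n, hn⟩ + u := by
        simp [Network.FlowState.augment, hmem]
      have hln : (st.augment eps K u).len ⟨n, hn⟩ =
          st.len ⟨n, hn⟩ * (1 + eps * u / N.cap ⟨n, hn⟩) := by
        simp [Network.FlowState.augment, hmem]
      have key : ∀ s4 : State, SameExcept [10, 20] [10, 11] s s4 → s4.nat 10 = s1.nat 10 →
          s4.real = s3.real →
          (s4.nat 20 0 < 1 ↔ s1.nat 20 0 < 1 ∧
            (st.augment eps K u).flow ⟨n, hn⟩ < L * N.cap ⟨n, hn⟩) →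
          s4.nat 10 0 = n ∧ SameExcept [10, 20] [10, 11] s (s4.writeNat 10 0 (n + 1)) ∧
          (∀ e : Fin N.graph.numEdges, (s4.writeNat 10 0 (n + 1)).real 10 e =
            if (e : ℕ) < n + 1 then (st.augment eps K u).len e else st.len e) ∧
          (∀ e : Fin N.graph.numEdges, (s4.writeNat 10 0 (n + 1)).real 11 e =
            if (e : ℕ) < n + 1 then (st.augment eps K u).flow e else st.flow e) ∧
          ((s4.writeNat 10 0 (n + 1)).nat 20 0 < 1 ↔ ∀ e : Fin N.graph.numEdges, (e : ℕ) < n + 1 →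
            (st.augment eps K u).flow e < L * N.cap e) := by
        intro s4 hsame hn4 hr4 hf4
        refine ⟨by rw [hn4, hn1], hsame.writeNat (by simp) _ _, ?_, ?_, ?_⟩
        · intro e
          rw [State.writeNat_real, hr4, h10]
          by_cases he : e = ⟨n, hn⟩
          · subst he; simp [hln]
          · have hne : (e : ℕ) ≠ n := fun h => he (Fin.ext h)
            rw [Function.update_of_ne hne, hl1 e]
            simp only [hlt, he, or_false]
        · intro e
          rw [State.writeNat_real, hr4, h11]
          by_cases he : e = ⟨n, hn⟩
          · subst he; simp [hfn]
          · have hne : (e : ℕ) ≠ n := fun h => he (Fin.ext h)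
            rw [Function.update_of_ne hne, hf1 e]
            simp only [hlt, he, or_false]
        · rw [hall, ← hf4]
          simp [State.writeNat_nat]
      apply Runs.ite (t := 1)
      · intro hb'
        simp only [Test.Holds, RExp.eval, NExp.eval, hs3n, hn1, h11, hs3r, hL1, hc,
          Function.update_self] at hb'
        refine Runs.skip (key _ hsame3 rfl rfl ?_)
        rw [hfn, hs3n]
        simp [hb']
      · intro hb'
        simp only [Test.Holds, RExp.eval, NExp.eval, hs3n, hn1, h11, hs3r, hL1, hc,
          Function.update_self] at hb'
        apply Runs.setNat
        refine key _ (hsame3.writeNat (by simp) _ _) ?_ rfl ?_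
        · simp [State.writeNat_nat, hs3n]
        · rw [hfn]
          simp [State.writeNat_nat, NExp.eval, hb']
    · intro hb
      simp only [Test.Holds, NExp.eval, hn1, hK1] at hb
      have hmem : (⟨n, hn⟩ : Fin _) ∉ K := by
        intro h; simp [h] at hb
      have hfn : (st.augment eps K u).flow ⟨n, hn⟩ = st.flow ⟨n, hn⟩ := by
        simp [Network.FlowState.augment, hmem]
      have hln : (st.augment eps K u).len ⟨n, hn⟩ = st.len ⟨n, hn⟩ := by
        simp [Network.FlowState.augment, hmem]
      refine Runs.skip ⟨hn1, hs1.writeNat (by simp) _ _, ?_, ?_, ?_⟩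
      · intro e
        rw [State.writeNat_real, hl1 e]
        by_cases he : e = ⟨n, hn⟩
        · subst he; simp [hln]
        · simp only [hlt, he, or_false]
      · intro e
        rw [State.writeNat_real, hf1 e]
        by_cases he : e = ⟨n, hn⟩
        · subst he; simp [hfn]
        · simp only [hlt, he, or_false]
      · rw [hall, hfn]
        -- An edge outside the tree keeps its flow, which was below the bound before; it needs no
        -- test.
        have := hact ⟨n, hn⟩
        simp [State.writeNat_nat, this]
  · refine ⟨(SameExcept.refl _ _ _).writeNat (by simp) _ _, ?_, ?_, ?_⟩
    · simpa [State.writeNat_real] using hlen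
    · simpa [State.writeNat_real] using hflow
    · simpa [State.writeNat_nat] using hflag
  · rintro s1 ⟨hs1, hl1, hf1, hflag1⟩
    refine ⟨hs1, fun e => by rw [hl1 e, if_pos e.2], fun e => by rw [hf1 e, if_pos e.2], ?_⟩
    rw [hflag1]
    exact ⟨fun h e => h e e.2, fun h e _ => h e⟩

end Algorithm
end Routing

/-! ### One step of the algorithm and the whole program -/

namespace Routing
namespace Algorithm

variable {N : Network} {q : Fin N.numMessages → ℝ} {ω A : ℝ} {O : SteinerOracle} {s : State}

/-- Appending one weighted tree to the output. -/
theorem outputVector_append {s' : State} {i : ℕ} {K : Finset (Fin N.graph.numEdges)} {w : ℝ}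
    (h7 : s'.nat 7 0 = s.nat 7 0 + 1)
    (h8 : s'.nat 8 = Function.update (s.nat 8) (s.nat 7 0) i)
    (h3 : s'.real 3 = Function.update (s.real 3) (s.nat 7 0) w)
    (hold : ∀ c, c < s.nat 7 0 * N.graph.numEdges → s'.nat 9 c = s.nat 9 c)
    (hnew : ∀ e : Fin N.graph.numEdges,
      s'.nat 9 (s.nat 7 0 * N.graph.numEdges + e) = if e ∈ K then 1 else 0)
    (j : Fin N.numMessages) (F : Finset (Fin N.graph.numEdges)) :
    N.outputVector s' j F = N.outputVector s j F + if i = j ∧ K = F then w else 0 := by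
  have hK : N.outputTree s' (s.nat 7 0) = K := by
    ext e
    simp [Network.outputTree, hnew]
  simp only [Network.outputVector, h7, Finset.sum_range_succ, hK, h8, h3, Function.update_self]
  congr 1
  refine Finset.sum_congr rfl fun p hp => ?_
  have hp := Finset.mem_range.1 hp
  have ht : N.outputTree s' p = N.outputTree s p := by
    ext e
    -- The block of an earlier tree ends before the block of the new tree begins.
    have h1 := Nat.mul_le_mul_right N.graph.numEdges (Nat.succ_le_of_lt hp)
    have h2 := e.2
    rw [Nat.succ_mul] at h1
    simp only [Network.outputTree, Finset.mem_filter, Finset.mem_univ, true_and]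
    rw [hold _ (by omega)]
  rw [ht, Function.update_of_ne hp.ne, Function.update_of_ne hp.ne]

theorem augment_runs {P : Network.Params N q} {ord : ℕ → Fin N.graph.numEdges} {T : ℕ}
    {st : Network.FlowState N} (hO : GoodOracle O N P.A T) (ho : N.graph.IsTopOrder ord)
    (h : Rep P ω ord s st) (hpos : ∀ e, 0 < st.len e) (hact : st.Active P.L) (hr : 0 < st.rem) :
    Runs O augment s (T + N.graph.numEdges * 14 + 12) fun s' =>
      ∃ K ∈ N.trees st.i, ∃ u, ∑ e ∈ K, st.len e ≤ P.A * N.minCost st.i st.len ∧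
        Amount N st.rem K u ∧ Rep P ω ord s' (st.augment P.eps K u) := by
  have hL := P.L_pos
  refine (Runs.seq (call_runs hO h.input h.i h.len hpos) (t₂ := N.graph.numEdges * 14 + 11)
    ?_).mono (by omega) fun _ h => h
  rintro s1 ⟨hs1, F, hF, hcost, hans⟩
  have hin1 := h.input.of_same hs1 (by simp) (by simp)
  apply Runs.setNat_seq
  apply Runs.setReal_seq
  have hi1 : s1.nat 17 0 = st.i := by rw [hs1.nat 17 (by simp), h.i]
  have h71 : s1.nat 7 = s.nat 7 := hs1.nat 7 (by simp)
  have hsrc : s1.nat 4 st.i = N.source st.i := hin1.source _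
  have hr1 : s1.real 15 0 = st.rem := by rw [hs1.real 15 (by simp), h.rem]
  simp only [NExp.eval, RExp.eval, hi1, hsrc, h71, State.writeNat_real, hr1]
  set s3 := (s1.writeNat 16 (N.source st.i) (s.nat 7 0 + 1)).writeReal 18 0 st.rem with hs3
  have hsame3 : SameExcept [15, 16] [18] s s3 :=
    ((hs1.mono (by simp) (by simp)).writeNat (by simp) _ _).writeReal (by simp) _ _
  have hin3 := h.input.of_same hsame3 (by simp) (by simp)
  have h16 : s3.nat 16 = Function.update (s.nat 16) (N.source st.i) (s.nat 7 0 + 1) := by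
    simp [hs3, State.writeNat_nat, State.writeReal_nat, hs1.nat 16]
  have h15 : s3.nat 15 = s1.nat 15 := by
    simp [hs3, State.writeNat_nat, State.writeReal_nat]
  have h73 : s3.nat 7 = s.nat 7 := hsame3.nat 7 (by simp)
  have h93 : s3.nat 9 = s.nat 9 := hsame3.nat 9 (by simp)
  have h213 : s3.nat 21 = s.nat 21 := hsame3.nat 21 (by simp)
  have h0 : ExtractInv (N := N) st.rem s3 s3 {N.source st.i} ∅ := by
    constructor
    · exact SameExcept.refl _ _ _
    · intro v
      rw [h16, h73, Finset.mem_singleton]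
      by_cases hv : v = N.source st.i
      · subst hv; simp
      · rw [Function.update_of_ne (fun h => hv (Fin.ext h))]
        simp [hv, h.stamp v]
    · intro v
      rw [h16, h73]
      by_cases hv : v = N.source st.i
      · subst hv; simp
      · rw [Function.update_of_ne hv]
        exact (h.stamp v).trans (Nat.le_succ _)
    · exact fun _ _ => rfl
    · intro e
      -- The cells from the offset on have never been written, so the new block starts as the empty
      -- tree.
      rw [h93, h213, h.fresh _ (by omega)]
      simp
    · intro c hc
      rw [h93]
      rw [h213] at hc
      exact h.fresh c (by omega)
    · have : s3.real 18 0 = st.rem := by simp [hs3, State.writeReal_real]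
      rw [this]
      exact ⟨hr, le_rfl, by simp, .inl rfl⟩
  refine (Runs.seq (extract_runs hin3 (ord := ord) (by rw [hsame3.nat 13 (by simp)]; exact h.ord_eq)
    (by rw [h15]; exact hans) h0) (t₂ := N.graph.numEdges * 7 + 7) ?_).mono (by omega) fun _ h => h
  intro s4 h4
  set K := (MultiDigraph.scan ord (N.source st.i) F N.graph.numEdges).2 with hK
  set V := (MultiDigraph.scan ord (N.source st.i) F N.graph.numEdges).1
  have hKtree : K ∈ N.trees st.i :=
    N.mem_trees.2 (ho.isSteinerTree_scan (N.mem_connecting.1 hF))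
  -- The scan only discards edges of positive length, so the tree inherits the guarantee of the
  -- oracle.
  have hKcost : ∑ e ∈ K, st.len e ≤ P.A * N.minCost st.i st.len :=
    (Finset.sum_le_sum_of_subset_of_nonneg (MultiDigraph.scan_snd_subset _ _ _ _)
      fun e _ _ => (hpos e).le).trans hcost
  have hsame4 : SameExcept [9, 10, 15, 16] [18] s s4 :=
    (hsame3.mono (by simp) (by simp)).trans (h4.same.mono (by simp) (by simp))
  have h214 : s4.nat 21 = s.nat 21 := hsame4.nat 21 (by simp)
  have h74 : s4.nat 7 = s.nat 7 := hsame4.nat 7 (by simp)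
  have hlen4 : ∀ e : Fin N.graph.numEdges, s4.real 10 e = st.len e := by
    rw [hsame4.real 10 (by simp)]; exact h.len
  have hflow4 : ∀ e : Fin N.graph.numEdges, s4.real 11 e = st.flow e := by
    rw [hsame4.real 11 (by simp)]; exact h.flow
  refine (Runs.seq (update_runs (K := K) (st := st) (eps := P.eps) (L := P.L)
    (h.input.of_same hsame4 (by simp) (by simp)) (by rw [hsame4.real 16 (by simp), h.eps])
    (by rw [hsame4.real 17 (by simp), h.L]) rfl hlen4 hflow4 h4.new
    (by rw [hsame4.nat 20 (by simp)]; exact h.flag.2 hact) hact) (t₂ := 5) ?_).mono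
    (by omega) fun _ h => h
  rintro s5 ⟨hs5, hlen5, hflow5, hflag5⟩
  have hu5 : s5.real 18 = s4.real 18 := hs5.real 18 (by simp)
  set u := s4.real 18 0 with hu
  have hsame5 : SameExcept [9, 10, 15, 16, 20] [10, 11, 18] s s5 :=
    (hsame4.mono (by simp) (by simp)).trans (hs5.mono (by simp) (by simp))
  apply Runs.setNat_seq
  apply Runs.setReal_seq
  apply Runs.setNat_seq
  apply Runs.setNat_seq
  apply Runs.setReal
  have h75 : s5.nat 7 = s.nat 7 := hsame5.nat 7 (by simp)
  have h175 : s5.nat 17 0 = st.i := by rw [hsame5.nat 17 (by simp), h.i]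
  have hL5 : s5.real 17 0 = P.L := by rw [hsame5.real 17 (by simp), h.L]
  have h215 : s5.nat 21 = s.nat 21 := hsame5.nat 21 (by simp)
  have hm5 : s5.nat 0 1 = N.graph.numEdges := by rw [hsame5.nat 0 (by simp), h.input.numEdges]
  have hr5 : s5.real 15 0 = st.rem := by rw [hsame5.real 15 (by simp), h.rem]
  have hu5' : s5.real 18 0 = u := by rw [hu5]
  simp only [NExp.eval, RExp.eval, State.writeNat_nat, State.writeReal_nat, State.writeNat_real,
    State.writeReal_real, if_false, Nat.reduceEqDiff, h75, h175, hL5,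
    h215, hm5, hr5, hu5', Nat.cast_one, OfNat.zero_ne_ofNat]
  set s6 := ((((s5.writeNat 8 (s.nat 7 0) st.i).writeReal 3 (s.nat 7 0) (u / (P.L + 1))).writeNat 21
    0 (s.nat 21 0 + N.graph.numEdges)).writeNat 7 0 (s.nat 7 0 + 1)).writeReal 15 0
    (st.rem - u) with hs6
  have hsame56 : SameExcept [7, 8, 21] [3, 15] s5 s6 :=
    (((((SameExcept.refl _ _ _).writeNat (by simp) _ _).writeReal (by simp) _ _).writeNat (by simp)
      _ _).writeNat (by simp) _ _).writeReal (by simp) _ _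
  have hsame6 : SameExcept [7, 8, 9, 10, 15, 16, 20, 21] [3, 10, 11, 15, 18] s s6 :=
    (hsame5.mono (by simp) (by simp)).trans (hsame56.mono (by simp) (by simp))
  have h76 : s6.nat 7 0 = s.nat 7 0 + 1 := by
    simp [hs6, State.writeNat_nat, State.writeReal_nat]
  have h216 : s6.nat 21 0 = s.nat 21 0 + N.graph.numEdges := by
    simp [hs6, State.writeNat_nat, State.writeReal_nat]
  have h96 : s6.nat 9 = s4.nat 9 := by
    rw [hsame56.nat 9 (by simp), hs5.nat 9 (by simp)]
  refine ⟨K, hKtree, u, hKcost, h4.amount, h.input.of_same hsame6 (by simp) (by simp),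
    ?_, ?_, ?_, ?_, ?_, ?_, ?_, ?_, ?_, ?_, ?_, ?_, ?_, ?_⟩
  · rw [hsame6.nat 13 (by simp)]; exact h.ord_eq
  · rw [hsame6.real 16 (by simp)]; exact h.eps
  · rw [hsame6.real 17 (by simp)]; exact h.L
  · rw [hsame6.real 13 (by simp)]; exact h.W₀
  · rw [hsame56.real 10 (by simp)]; exact hlen5
  · rw [hsame56.real 11 (by simp)]; exact hflow5
  · rw [hsame6.real 14 (by simp)]; exact h.W
  · simp [hs6, State.writeReal_real, Network.FlowState.augment]
  · rw [hsame6.nat 17 (by simp)]; exact h.i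
  · rw [h76, h216, h.offset]; ring
  · rw [h76, hsame56.nat 16 (by simp), hs5.nat 16 (by simp), ← h74]; exact h4.stamp_le
  · rw [h216, h96, ← h214]; exact h4.fresh
  · intro j F'
    rw [outputVector_append (s := s) (i := st.i) (K := K) (w := u / (P.L + 1)) h76 ?_ ?_ ?_ ?_, h.x]
    · simp only [Network.FlowState.augment, Network.addTree, add_div]
      congr 1
      by_cases hj : j = st.i ∧ F' = K
      · rw [if_pos hj, if_pos ⟨by rw [hj.1], hj.2.symm⟩]
      · rw [if_neg hj, if_neg fun h' => hj ⟨(Fin.ext h'.1).symm, h'.2.symm⟩, zero_div]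
    · have : s5.nat 8 = s.nat 8 := hsame5.nat 8 (by simp)
      simp [hs6, State.writeNat_nat, State.writeReal_nat, this]
    · have : s5.real 3 = s.real 3 := hsame5.real 3 (by simp)
      simp [hs6, State.writeReal_real, State.writeNat_real, this]
    · rw [h96, ← h.offset, ← h214, ← h93]; exact h4.old
    · rw [h96, ← h.offset, ← h214]; exact h4.new
  · rw [hsame56.nat 20 (by simp)]; exact hflag5

/-- One step of the algorithm preserves the invariant. -/
theorem body_runs {P : Network.Params N q} {ord : ℕ → Fin N.graph.numEdges} {T : ℕ}
    {st : Network.FlowState N} {n p : ℕ} (hO : GoodOracle O N P.A T) (ho : N.graph.IsTopOrder ord)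
    (h : Rep P ω ord s st) (hI : st.Inv P n p) (hact : st.Active P.L) :
    Runs O body s (T + N.graph.numEdges * 14 + 13) fun s' =>
      ∃ st' p', Rep P ω ord s' st' ∧ st'.Inv P (n + 1) p' := by
  apply Runs.ite
  · intro hb
    simp only [Test.Holds, RExp.eval, NExp.eval, h.rem, Nat.cast_zero] at hb
    refine (augment_runs hO ho h hI.len_pos hact hb).mono le_rfl ?_
    rintro s' ⟨K, hK, u, hcost, hu, hrep⟩
    exact ⟨_, _, hrep, hI.augment hact hb hK hcost hu.pos hu.le hu.le_cap hu.eq⟩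
  · intro hb
    simp only [Test.Holds, RExp.eval, NExp.eval, h.rem, Nat.cast_zero, not_lt] at hb
    obtain ⟨p', hp'⟩ := hI.switch (le_antisymm hb hI.rem_nonneg)
    exact (switch_runs h).mono (by omega) fun s' hs' => ⟨_, p', hs', hp'⟩

/-- Set the initial scale of the demands. -/
def start : Prog :=
  .seq (.setReal 13 (.lit 0) (.div (.add (.var 17) (.ofNat (.lit 1))) (.var 12)))
  (.seq (.setReal 14 (.lit 0) (.var 13))
  (.setReal 15 (.lit 0) (.mul (.mul etaExp (.var 14)) (.get 1 (.var 17)))))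

/-- Write the value of the solution. -/
def finish : Prog :=
  .setReal 2 (.lit 0) (.div (.sub (.var 14) (.var 13)) (.add (.var 17) (.ofNat (.lit 1))))

/-- The main loop. -/
def mainLoop : Prog := .while (.natLt (.var 20) (.lit 1)) body

/-- The approximation algorithm. -/
def program : Prog :=
  .seq setup (.seq levels (.seq order (.seq lengths (.seq estimate
    (.seq start (.seq mainLoop finish))))))

theorem mainLoop_runs {P : Network.Params N q} {ord : ℕ → Fin N.graph.numEdges} {T B : ℕ}
    {st : Network.FlowState N} (hO : GoodOracle O N P.A T) (ho : N.graph.IsTopOrder ord)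
    (h : Rep P ω ord s st) (hI : st.Inv P 0 0)
    (hB : ∀ (st : Network.FlowState N) (n p : ℕ), st.Inv P n p → n ≤ B) :
    Runs O mainLoop s ((B + 1) * (T + N.graph.numEdges * 14 + 14)) fun s' =>
      ∃ st' n p, Rep P ω ord s' st' ∧ st'.Inv P n p ∧ ¬ st'.Active P.L := by
  refine (Runs.while_le B (fun n s => ∃ st p, Rep P ω ord s st ∧ st.Inv P n p) ?_ ?_
    (tb := T + N.graph.numEdges * 14 + 13) (n := 0) ⟨st, 0, h, hI⟩).mono le_rfl ?_
  · rintro n s ⟨st, p, -, hI⟩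
    exact hB st n p hI
  · rintro n s ⟨st, p, h, hI⟩ hb
    exact body_runs hO ho h hI (h.flag.1 hb)
  · rintro s' ⟨n, ⟨st, p, h, hI⟩, hb⟩
    exact ⟨st, n, p, h, hI, fun hact => hb (h.flag.2 hact)⟩

/-- The output of the finishing step is nearly optimal. -/
theorem finish_runs {P : Network.Params N q} {ord : ℕ → Fin N.graph.numEdges}
    {st : Network.FlowState N} {n p : ℕ} (hω : 0 < ω) (heps : P.eps = min ω 1 / 10)
    (h : Rep P ω ord s st) (hI : st.Inv P n p) (hact : ¬ st.Active P.L) :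
    Runs O finish s 1 fun s' =>
      N.IsApproxSolution q ((1 + ω) * P.A) (N.outputVector s') (Network.outputValue s') := by
  apply Runs.setReal (t := 0)
  have hL := P.L_pos
  have hA := P.A_pos
  simp only [RExp.eval, NExp.eval, h.W, h.W₀, h.L, Nat.cast_one]
  have hx : N.outputVector (s.writeReal 2 0 ((st.W - P.W₀) / (P.L + 1))) =
      fun i F => st.x i F / (P.L + 1) := by
    rw [outputVector_congr (s := s) (s' := s.writeReal 2 0 _) rfl rfl rfl
      (by simp [State.writeReal_real])]
    funext i F
    exact h.x i F
  have hv : Network.outputValue (s.writeReal 2 0 ((st.W - P.W₀) / (P.L + 1))) =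
      (st.W - P.W₀) / (P.L + 1) := by
    simp [Network.outputValue, State.writeReal_real]
  rw [hx, hv]
  refine ⟨hI.feasible, fun x' lam' h' => (Network.le_opt P.q_nonneg P.q_ne h').trans ?_⟩
  refine (hI.opt_le hact (lt_min hω one_pos) (min_le_right _ _) heps).trans ?_
  have := hI.feasible.lam_nonneg
  gcongr
  exact min_le_left _ _

end Algorithm
end Routing

/-! ### Running-time estimates -/

namespace Routing

/-- If 2m ≤ k², then log(2m) ≤ 2·log k. Otherwise k < √(2m), and log(2m) ≤ 2√(2m) makes the product
at most 4m. This removes the logarithm of m from the number of steps. -/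
theorem mul_log_le {k m : ℝ} (hk : 1 ≤ k) (hm : 0 < m) :
    k * Real.log (2 * m) ≤ 2 * (k * Real.log k) + 4 * m := by
  have hk0 : 0 < k := by linarith
  have hlk : 0 ≤ k * Real.log k := mul_nonneg hk0.le (Real.log_nonneg hk)
  rcases le_total (2 * m) (k ^ 2) with h | h
  · have h1 := Real.log_le_log (by positivity) h
    rw [Real.log_pow] at h1
    have := mul_le_mul_of_nonneg_left h1 hk0.le
    push_cast at this
    linarith
  · have h1 : k ≤ √(2 * m) := Real.le_sqrt_of_sq_le h
    have h2 : Real.log (2 * m) ≤ 2 * √(2 * m) := by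
      have h3 := Real.log_le_self (Real.sqrt_nonneg (2 * m))
      rw [Real.log_sqrt (by positivity)] at h3
      linarith
    have h4 : √(2 * m) * √(2 * m) = 2 * m := Real.mul_self_sqrt (by positivity)
    have h5 : k * Real.log (2 * m) ≤ √(2 * m) * (2 * √(2 * m)) :=
      (mul_le_mul_of_nonneg_left h2 hk0.le).trans
        (mul_le_mul_of_nonneg_right h1 (by positivity))
    linarith

/-- Rounding up adds at most 1 to the binary logarithm, hence at most doubles it for m ≥ 2; and
2/log 2 < 3. -/
theorem clog_le_log {m : ℕ} (hm : 2 ≤ m) : (Nat.clog 2 m : ℝ) ≤ 3 * Real.log m := by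
  have h0 : 0 < Nat.clog 2 m := Nat.clog_pos (by norm_num) hm
  have h1 : 2 ^ (Nat.clog 2 m - 1) < m := Nat.pow_lt_of_lt_clog (by omega)
  have h2 : ((2 : ℝ) ^ (Nat.clog 2 m - 1)) ≤ m := by exact_mod_cast h1.le
  have h3 := Real.log_le_log (by positivity) h2
  rw [Real.log_pow, Nat.cast_sub h0] at h3
  have h4 := Real.log_two_gt_d9
  have h5 : Real.log 2 ≤ Real.log m := Real.log_le_log (by norm_num) (by exact_mod_cast hm)
  push_cast at h3
  have h6 : (Nat.clog 2 m : ℝ) * Real.log 2 ≤ 2 * Real.log m := by linarith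
  have h7 : (0 : ℝ) ≤ Nat.clog 2 m := Nat.cast_nonneg _
  nlinarith

theorem log_le_clog {m : ℕ} (hm : 2 ≤ m) : Real.log m ≤ Nat.clog 2 m := by
  have h1 : (m : ℝ) ≤ 2 ^ Nat.clog 2 m := by exact_mod_cast Nat.le_pow_clog (by norm_num) m
  have h2 := Real.log_le_log (by positivity) h1
  rw [Real.log_pow] at h2
  have h3 := Real.log_two_lt_d9
  have h4 : (0 : ℝ) ≤ Nat.clog 2 m := Nat.cast_nonneg _
  nlinarith

/-- The number of steps of the algorithm in terms of the parameters. -/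
theorem time_le {m k T B t : ℕ} {A ω w L : ℝ} (hm : 2 ≤ m) (hk : 1 ≤ k) (hT : m ≤ T) (hA : 1 ≤ A)
    (hω : 0 < ω) (hw : w = min ω 1) (hL : L = Nat.clog 2 m / (w / 10 * (w / 10)))
    (hB : (B : ℝ) ≤ 2 * k * (4 * (L + 1) * A * Real.log (2 * m * A) + 1) + 1 + m * (L + 1))
    (ht : t ≤ (3 * Nat.clog 2 m + 5) + ((m * (m * 4 + 4) + 2) + ((m * (m * 5 + 4) + 2) +
      ((m * 3 + 2) + ((k * (T + m * 4 + 5) + 2) + (3 + ((B + 1) * (T + m * 14 + 14) + 1))))))) :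
    (t : ℝ) ≤ 1000000 * (max 1 (ω⁻¹ ^ 2) * ((k : ℝ) * Real.log (A * k) + m) * A * Real.log m *
      T) := by
  have hm' : (2 : ℝ) ≤ m := by exact_mod_cast hm
  have hk' : (1 : ℝ) ≤ k := by exact_mod_cast hk
  have hT' : (m : ℝ) ≤ T := by exact_mod_cast hT
  set X := max 1 (ω⁻¹ ^ 2) with hX
  set Y := (k : ℝ) * Real.log (A * k) + m with hY
  have hX1 : 1 ≤ X := le_max_left _ _
  have hw0 : 0 < w := by rw [hw]; exact lt_min hω one_pos
  have hwX : 1 / (w * w) ≤ X := by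
    rw [hw, hX]
    rcases le_total ω 1 with h | h
    · rw [min_eq_left h]
      refine le_trans (le_of_eq ?_) (le_max_right _ _)
      field_simp
    · rw [min_eq_right h]
      refine le_trans (le_of_eq ?_) (le_max_left _ _)
      norm_num
  have hb1 : (1 : ℝ) ≤ Nat.clog 2 m := by
    exact_mod_cast Nat.clog_pos (by norm_num) hm
  have hb := clog_le_log hm
  -- The factor 100 comes from eps = w/10, the summand 1 makes it 101, and the change of logarithm
  -- multiplies by 3.
  have hLX : L + 1 ≤ 303 * (X * Real.log m) := by
    have h1 : L = 100 * Nat.clog 2 m * (1 / (w * w)) := by rw [hL]; field_simp; norm_num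
    have h2 : L ≤ 100 * Nat.clog 2 m * X := by rw [h1]; gcongr
    have h3 : (1 : ℝ) ≤ Nat.clog 2 m * X := by nlinarith
    have h4 : (Nat.clog 2 m : ℝ) * X ≤ 3 * Real.log m * X := by gcongr
    linarith
  have hL0 : 0 ≤ L := by rw [hL]; positivity
  have hlogA : 0 ≤ Real.log A := Real.log_nonneg hA
  have hlogAk : Real.log (A * k) = Real.log A + Real.log k :=
    Real.log_mul (by linarith) (by linarith)
  have hlogk : 0 ≤ Real.log k := Real.log_nonneg hk'
  have hlogmA : Real.log (2 * m * A) = Real.log (2 * m) + Real.log A :=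
    Real.log_mul (by linarith) (by linarith)
  have hYm : (m : ℝ) ≤ Y := by
    have : 0 ≤ (k : ℝ) * Real.log (A * k) := by rw [hlogAk]; positivity
    linarith
  -- By `mul_log_le` the left side is at most 2k·log k + 4m + k·log A.
  have hkl : (k : ℝ) * Real.log (2 * m * A) ≤ 4 * Y := by
    have h1 := mul_log_le hk' (by linarith : (0 : ℝ) < m)
    have h2 : 0 ≤ (k : ℝ) * Real.log A := by positivity
    have h3 : 0 ≤ (k : ℝ) * Real.log k := by positivity
    rw [hY, hlogmA, hlogAk]
    linarith only [h1, h2, h3]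
  have hkY : (k : ℝ) ≤ 4 * Y := by
    refine le_trans ?_ hkl
    have h1 : 1 ≤ Real.log (2 * m * A) := by
      have h2 : Real.log 4 ≤ Real.log (2 * m) := Real.log_le_log (by norm_num) (by linarith)
      have h3 : Real.log 4 = 2 * Real.log 2 := by
        rw [show (4 : ℝ) = 2 ^ 2 by norm_num, Real.log_pow]; norm_num
      have h4 := Real.log_two_gt_d9
      linarith
    nlinarith
  have hY0 : 0 ≤ Y := by linarith
  set G := (L + 1) * A * Y with hG
  have hLA : 1 ≤ (L + 1) * A := by nlinarith
  have hYG : Y ≤ G := le_mul_of_one_le_left hY0 hLA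
  have hG0 : 0 ≤ G := hY0.trans hYG
  -- The phases contribute 32G, the summand 2k at most 8G, the saturations G, and the constants at
  -- most G.
  have hBG : (B : ℝ) + 1 ≤ 43 * G := by
    have h1 : 2 * (k : ℝ) * (4 * (L + 1) * A * Real.log (2 * m * A)) ≤ 32 * G := by
      have := mul_le_mul_of_nonneg_left hkl (by positivity : 0 ≤ 8 * ((L + 1) * A))
      rw [hG]; linarith only [this]
    have h2 : (m : ℝ) * (L + 1) ≤ G := by
      have h3 : (m : ℝ) * (L + 1) ≤ Y * (L + 1) := by gcongr
      have h4 : Y * (L + 1) * 1 ≤ Y * (L + 1) * A := by gcongr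
      rw [hG]; linarith only [h3, h4]
    linarith only [hB, h1, h2, hkY, hYG, hYm, hm']
  have hGT : G * T ≤ 303 * (X * Y * A * Real.log m * T) := by
    have h1 : G ≤ 303 * (X * Real.log m) * A * Y := by rw [hG]; gcongr
    have := mul_le_mul_of_nonneg_right h1 (by linarith : (0 : ℝ) ≤ T)
    linarith
  have hclog : (Nat.clog 2 m : ℝ) ≤ m := by
    have : Nat.clog 2 m ≤ m := by
      rw [Nat.clog_le_iff_le_pow (by norm_num)]
      exact Nat.lt_two_pow_self.le
    exact_mod_cast this
  have hT2 : (2 : ℝ) ≤ T := hm'.trans hT'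
  have hmT : (m : ℝ) ≤ G * T := by nlinarith
  have hGT2 : 2 ≤ G * T := hm'.trans hmT
  have hmm : (m : ℝ) * m ≤ G * T := mul_le_mul (hYm.trans hYG) hT' (by linarith) hG0
  have hkT : (k : ℝ) * (T + m * 4 + 5) ≤ 32 * (G * T) := by
    have h1 : (T : ℝ) + m * 4 + 5 ≤ 8 * T := by linarith
    have h2 : (k : ℝ) * (T + m * 4 + 5) ≤ (4 * G) * (8 * T) :=
      mul_le_mul (by linarith) h1 (by positivity) (by linarith)
    linarith
  have hBT : ((B : ℝ) + 1) * (T + m * 14 + 14) ≤ 946 * (G * T) := by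
    have h1 : (T : ℝ) + m * 14 + 14 ≤ 22 * T := by linarith
    have h2 : ((B : ℝ) + 1) * (T + m * 14 + 14) ≤ (43 * G) * (22 * T) :=
      mul_le_mul hBG h1 (by positivity) (by linarith)
    linarith
  have ht' : (t : ℝ) ≤ (3 * Nat.clog 2 m + 5) + ((m * (m * 4 + 4) + 2) + ((m * (m * 5 + 4) + 2) +
      ((m * 3 + 2) + ((k * (T + m * 4 + 5) + 2) + (3 + ((B + 1) * (T + m * 14 + 14) + 1)))))) := by
    exact_mod_cast ht
  -- The two products are abstracted to `x` and `y` to keep the inequality linear. Afterwards 1100 ·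
  -- 303 is well below the final constant.
  have hsum : ∀ x y : ℝ, x ≤ 32 * (G * T) → y ≤ 946 * (G * T) →
      ((3 * Nat.clog 2 m + 5) + ((m * (m * 4 + 4) + 2) + ((m * (m * 5 + 4) + 2) +
      ((m * 3 + 2) + ((x + 2) + (3 + (y + 1)))))) : ℝ) ≤ 1100 * (G * T) := by
    intro x y hx hy
    linarith only [hx, hy, hmm, hmT, hclog, hGT2]
  have := ht'.trans (hsum _ _ hkT hBT)
  have hpos : 0 ≤ G * T := by linarith only [hGT2]
  linarith only [this, hGT, hpos]

/-! ### Assembly of the program -/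

namespace Algorithm

theorem program_runs {N : Network} {q : Fin N.numMessages → ℝ} {ω A : ℝ} {O : SteinerOracle}
    {T : ℕ} (hm : 2 ≤ N.graph.numEdges) (hq : ∀ i, 0 ≤ q i) (hq0 : q ≠ 0) (hω : 0 < ω)
    (hA : 1 ≤ A) (hO : GoodOracle O N A T) (hT : N.graph.numEdges ≤ T) :
    ∃ t : ℕ, (t : ℝ) ≤ 1000000 * (max 1 (ω⁻¹ ^ 2) *
        ((N.numMessages : ℝ) * Real.log (A * N.numMessages) + N.graph.numEdges) *
        A * Real.log N.graph.numEdges * T) ∧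
      Runs O program (N.input q ω A) t fun s =>
        N.IsApproxSolution q ((1 + ω) * A) (N.outputVector s) (Network.outputValue s) := by
  have hk : 0 < N.numMessages := by
    obtain ⟨i, -⟩ := Function.ne_iff.1 hq0
    exact i.pos
  set m := N.graph.numEdges with hm'
  set w := min ω 1 with hw
  have hw0 : 0 < w := lt_min hω one_pos
  set L : ℝ := Nat.clog 2 m / (w / 10 * (w / 10)) with hL
  set B : ℕ := ⌊2 * N.numMessages * (4 * (L + 1) * A * Real.log (2 * m * A) + 1) + 1 +
    m * (L + 1)⌋₊ with hB
  have hL0 : 0 ≤ L := by rw [hL]; positivity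
  have hm2 : (2 : ℝ) ≤ m := by exact_mod_cast hm
  have hBle : (B : ℝ) ≤ 2 * N.numMessages * (4 * (L + 1) * A * Real.log (2 * m * A) + 1) + 1 +
      m * (L + 1) := by
    apply Nat.floor_le
    have : 0 ≤ Real.log (2 * m * A) := Real.log_nonneg (by nlinarith)
    positivity
  -- Unification fixes the time as the nested sum in `time_le`, which mirrors the sequence of the
  -- program parts.
  refine ⟨_, time_le hm hk hT hA hω hw hL hBle le_rfl, ?_⟩
  set s₀ := N.input q ω A with hs₀
  have hin : HasInput N q ω A s₀ := hasInput_input N q ω A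
  have hnat : ∀ a, 7 ≤ a → s₀.nat a = fun _ => 0 := by
    intro a ha
    obtain ⟨a, rfl⟩ := Nat.exists_eq_add_of_le' ha
    rfl
  have hreal : ∀ a, 2 ≤ a → s₀.real a = fun _ => 0 := by
    intro a ha
    obtain ⟨a, rfl⟩ := Nat.exists_eq_add_of_le' ha
    rfl
  refine Runs.seq (setup_runs hin (by rw [hnat 18 (by norm_num)])) ?_
  rintro s1 ⟨hs1, heps1, hL1⟩
  refine Runs.seq (levels_runs (hin.of_same hs1 (by simp) (by simp))
    (by rw [hs1.nat 12 (by simp), hnat 12 (by norm_num)])) ?_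
  rintro s2 ⟨hs12, hlev⟩
  have hs2 : SameExcept [10, 11, 12, 18, 19] [16, 17] s₀ s2 :=
    (hs1.mono (by simp) (by simp)).trans (hs12.mono (by simp) (by simp))
  refine Runs.seq (order_runs (hin.of_same hs2 (by simp) (by simp)) (by omega) hlev
    (by rw [hs2.nat 14 (by simp), hnat 14 (by norm_num)])) ?_
  rintro s3 ⟨hs23, ord, ho, hord⟩
  have hs3 : SameExcept [10, 11, 12, 13, 14, 18, 19] [16, 17] s₀ s3 :=
    (hs2.mono (by simp) (by simp)).trans (hs23.mono (by simp) (by simp))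
  refine Runs.seq (lengths_runs (hin.of_same hs3 (by simp) (by simp))) ?_
  rintro s4 ⟨hs34, hlen⟩
  have hs4 : SameExcept [10, 11, 12, 13, 14, 18, 19] [10, 16, 17] s₀ s4 :=
    (hs3.mono (by simp) (by simp)).trans (hs34.mono (by simp) (by simp))
  have hpos : ∀ e, 0 < 1 / (N.cap e : ℝ) := fun e => one_div_pos.2 (Network.cap_pos' e)
  refine Runs.seq (estimate_runs hO (hin.of_same hs4 (by simp) (by simp)) hlen hpos
    (by rw [hs4.real 12 (by simp), hreal 12 (by norm_num)])) ?_
  rintro s5 ⟨hs45, F, hF, ha⟩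
  set a := ∑ i, q i * ∑ e ∈ F i, 1 / (N.cap e : ℝ) with ha'
  have hs5 : SameExcept [10, 11, 12, 13, 14, 15, 18, 19] [10, 12, 16, 17] s₀ s5 :=
    (hs4.mono (by simp) (by simp)).trans (hs45.mono (by simp) (by simp))
  have hin5 := hin.of_same hs5 (by simp) (by simp)
  have hmc : ∑ i, q i * N.minCost i (fun e => 1 / (N.cap e : ℝ)) ≤ a :=
    Finset.sum_le_sum fun i _ => mul_le_mul_of_nonneg_left (Network.minCost_le _ (hF i).1) (hq i)
  have ha0 : 0 < a := (Network.sum_mul_minCost_pos hq hq0 hpos).trans_le hmc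
  have haA : a ≤ A * ∑ i, q i * N.minCost i (fun e => 1 / (N.cap e : ℝ)) := by
    rw [Finset.mul_sum]
    refine Finset.sum_le_sum fun i _ => ?_
    rw [mul_left_comm]
    exact mul_le_mul_of_nonneg_left (hF i).2 (hq i)
  have hvol : Network.vol (N := N) (fun e => 1 / (N.cap e : ℝ)) = m := by
    simp only [Network.vol]
    rw [Finset.sum_congr rfl fun e _ => mul_one_div_cancel (Network.cap_pos' e).ne']
    simp [hm']
  -- Trees inside the oracle answers cost no more than the answers, so routing along them achieves
  -- the value 1/a.
  have hinv : 1 / a ≤ N.opt q := by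
    refine Network.inv_le_opt hq hq0
      (fun i => (MultiDigraph.scan ord (N.source i) (F i) N.graph.numEdges).2)
      (fun i => N.mem_trees.2 (ho.isSteinerTree_scan (N.mem_connecting.1 (hF i).1))) ha0 ?_
    refine Finset.sum_le_sum fun i _ => mul_le_mul_of_nonneg_left ?_ (hq i)
    exact Finset.sum_le_sum_of_subset_of_nonneg (MultiDigraph.scan_snd_subset _ _ _ _)
      fun e _ _ => (hpos e).le
  have hopt0 : 0 ≤ N.opt q := (one_div_pos.2 ha0).le.trans hinv
  have hmul : w / 10 * (w / 10) * L = Nat.clog 2 m := by rw [hL]; field_simp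
  have hb1 : (1 : ℝ) ≤ Nat.clog 2 m := by exact_mod_cast Nat.clog_pos (by norm_num) hm
  let P : Network.Params N q :=
    { eps := w / 10
      A := A
      L := L
      a := a
      q_nonneg := hq
      q_ne := hq0
      eps_pos := by positivity
      eps_le := by
        have : w ≤ 1 := min_le_right _ _
        linarith
      one_le_A := hA
      log_le := by rw [sq, hmul]; exact log_le_clog hm
      one_le_L := by rw [sq, hmul]; exact hb1
      edges_pos := by omega
      a_pos := ha0
      inv_le_opt := hinv
      -- Duality at the lengths 1/c(e), whose volume is m, combined with the guarantee A of the
      -- oracle.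
      opt_mul_le := by
        have h1 := mul_le_mul_of_nonneg_left haA hopt0
        have h2 := Network.opt_mul_le hq hq0 hpos
        rw [hvol] at h2
        have h3 := mul_le_mul_of_nonneg_left h2 (by linarith : 0 ≤ A)
        linarith }
  have heps5 : s5.real 16 0 = w / 10 := by
    rw [hs45.real 16 (by simp), hs34.real 16 (by simp), hs23.real 16 (by simp),
      hs12.real 16 (by simp), heps1]
  have hL5 : s5.real 17 0 = L := by
    rw [hs45.real 17 (by simp), hs34.real 17 (by simp), hs23.real 17 (by simp),
      hs12.real 17 (by simp), hL1]
  have hzn : ∀ b, 7 ≤ b → b ∉ [10, 11, 12, 13, 14, 15, 18, 19] → s5.nat b = fun _ => 0 :=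
    fun b hb hb' => (hs5.nat b hb').trans (hnat b hb)
  refine Runs.seq (R := fun s6 => Rep P ω ord s6 (Network.FlowState.init P hk)) (t₁ := 3) ?_ ?_
  · apply Runs.setReal_seq
    apply Runs.setReal_seq
    apply Runs.setReal (t := 0)
    have heta : ∀ s : State, SameExcept [] [13, 14] s5 s → etaExp.eval s = P.eta := by
      intro s hs
      exact etaExp_eval (by rw [hs.real 17 (by simp), hL5])
        (by rw [hs.real 0 (by simp), hin5.guarantee])
    have h17 : s5.nat 17 = fun _ => 0 := hzn 17 (by norm_num) (by simp)
    have hq5 : s5.real 1 0 = q ⟨0, hk⟩ := hin5.demand ⟨0, hk⟩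
    simp only [NExp.eval, RExp.eval, hL5, ha, Nat.cast_one]
    have hW₀ : (L + 1) / a = P.W₀ := rfl
    rw [hW₀]
    have h13 : (s5.writeReal 13 0 P.W₀).real 13 0 = P.W₀ := by simp [State.writeReal_real]
    rw [h13]
    set s6 := (s5.writeReal 13 0 P.W₀).writeReal 14 0 P.W₀ with hs6
    have hs56 : SameExcept [] [13, 14] s5 s6 :=
      ((SameExcept.refl _ _ _).writeReal (by simp) _ _).writeReal (by simp) _ _
    have h146 : s6.real 14 0 = P.W₀ := by simp [hs6, State.writeReal_real]
    have hn6 : s6.nat = s5.nat := rfl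
    rw [heta s6 hs56, h146, hn6, h17, hs56.real 1 (by simp), hq5]
    set s7 := s6.writeReal 15 0 (P.eta * P.W₀ * q ⟨0, hk⟩) with hs7
    have hs57 : SameExcept [] [13, 14, 15] s5 s7 :=
      (hs56.mono (by simp) (by simp)).writeReal (by simp) _ _
    have hn7 : s7.nat = s5.nat := rfl
    have h7 : s7.nat 7 = fun _ => 0 := by rw [hn7]; exact hzn 7 (by norm_num) (by simp)
    refine ⟨hin5.of_same hs57 (by simp) (by simp), ?_, ?_, ?_, ?_, ?_, ?_, ?_, ?_, ?_, ?_, ?_, ?_,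
      ?_, ?_⟩
    · rw [hn7, hs45.nat 13 (by simp), hs34.nat 13 (by simp)]; exact hord
    · rw [hs57.real 16 (by simp), heps5]
    · rw [hs57.real 17 (by simp), hL5]
    · simp [hs7, hs6, State.writeReal_real]
    · rw [hs57.real 10 (by simp), hs45.real 10 (by simp)]; exact hlen
    · rw [hs57.real 11 (by simp), hs5.real 11 (by simp), hreal 11 (by norm_num)]
      exact fun _ => rfl
    · simp [hs7, hs6, State.writeReal_real, Network.FlowState.init]
    · simp [hs7, State.writeReal_real, Network.FlowState.init]
    · rw [hn7, h17]; rfl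
    · rw [h7, hn7, hzn 21 (by norm_num) (by simp)]; simp
    · rw [hn7, hzn 16 (by norm_num) (by simp)]; simp
    · rw [hn7, hzn 9 (by norm_num) (by simp)]; simp
    · intro i F
      simp [Network.outputVector, h7, Network.FlowState.init]
    · rw [hn7, hzn 20 (by norm_num) (by simp)]
      refine iff_of_true (by norm_num) fun e => ?_
      exact mul_pos P.L_pos (Network.cap_pos' e)
  · intro s6 hrep
    refine Runs.seq (mainLoop_runs (P := P) (B := B) hO ho hrep (Network.FlowState.init_inv hk)
      ?_) ?_
    · intro st n p hI
      exact Nat.le_floor hI.steps_le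
    · rintro s7 ⟨st, n, p, hrep, hI, hact⟩
      exact finish_runs hω rfl hrep hI hact

end Algorithm
end Routing

theorem theorem3 :
    ∃ (P : Routing.Prog) (C : ℝ),
      ∀ (N : Routing.Network) (q : Fin N.numMessages → ℝ) (ω A : ℝ)
        (O : Routing.SteinerOracle) (T : ℕ),
        2 ≤ N.graph.numEdges →
        (∀ i, 0 ≤ q i) → q ≠ 0 →
        0 < ω → 1 ≤ A →
        O.HasGuarantee N.graph A →
        (∀ I : Routing.SteinerInstance N.graph, I.Valid → O.time N.graph I ≤ T) →
        N.graph.numEdges ≤ T →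
        ∃ (s : Routing.State) (t : ℕ),
          Routing.Exec O P (N.input q ω A) s t ∧
          N.IsApproxSolution q ((1 + ω) * A) (N.outputVector s) (Routing.Network.outputValue s) ∧
          (t : ℝ) ≤ C * (max 1 (ω⁻¹ ^ 2) *
            ((N.numMessages : ℝ) * Real.log (A * N.numMessages) + N.graph.numEdges) *
            A * Real.log N.graph.numEdges * T) := by
  refine ⟨Routing.Algorithm.program, 1000000, fun N q ω A O T hm hq hq0 hω hA hO hO' hT => ?_⟩
  obtain ⟨t, ht, s, t', hexec, htt, happrox⟩ :=
    Routing.Algorithm.program_runs hm hq hq0 hω hA ⟨hO, hO'⟩ hT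
  exact ⟨s, t', hexec, happrox, le_trans (by exact_mod_cast htt) ht⟩
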